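/- **Setting.** Let $d\ge 1$, let $\Omega\subset\mathbb R^d$ be a bounded open set (e.g. a bounded Lipschitz domain), let $0=t_0<t_1<\dots<t_N=T$ ($N\ge1$), $I_n=(t_n,t_{n+1})$, and for $n=0,\dots,N-1$ let $\mathcal T_n$ be a finite set of pairwise disjoint elements $K\subseteq\Omega$ (open nondegenerate simplices or open box-type elements, i.e. affine images of the unit cube) with $\overline\Omega=\bigcup_{K\in\mathcal T_n}\overline K$; hanging nodes are allowed and the meshes may change with $n$. Let $a:\Omega\to\mathbb R$ be constant on every element of every $\mathcal T_n$, with $0<c_a<a<C_a$. Write $\rho_K$ for the radius of the largest ball in $K$, and assume $$\operatorname{diam}K\le c_{\mathcal T}\,\rho_K\quad(K\in\mathcal T_n,\ 0\le n<N),\qquad c_{\mathcal T}>0,$$ and $\operatorname{diam}K\le c_q\operatorname{diam}K'$ for distinct $K,K'\in\mathcal T_n$ for which $\overline K\cap\overline{K'}$ has positive $(d-1)$-dimensional measure (local quasi-uniformity). Let $p\in\mathbb N$. $S_n^{h,p}$ is the space of functions on $\Omega\times I_n$ which on every $K\times I_n$, $K\in\mathcal T_n$, are polynomials in $(t,x)$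 of total degree at most $p$; $V^{h,p}$ is the space of functions on $\Omega\times(0,T)$ with restriction in $S_n^{h,p}$ for all $n$. The Trefftz spaces $S_{n,\mathrm{Trefftz}}^{h,p}\subseteq S_n^{h,p}$, $V^{h,p}_{\mathrm{Trefftz}}\subseteq V^{h,p}$ consist of the functions with $\ddot v-\nabla\cdot(a\nabla v)=0$ in every $K\times I_n$. Let $\Gamma_n=\bigcup_{K\in\mathcal T_n}\partial K$ and $\hat\Gamma_n=\Gamma_{n-1}\cup\Gamma_n$. On interior faces $\{w\}=\frac12(w^++w^-)$, $[w]=w^+\mathbf n^++w^-\mathbf n^-$ for scalar $w$, $[\mathbf w]=\mathbf w^+\cdot\mathbf n^++\mathbf w^-\cdot\mathbf n^-$ for vector fields; on $\partial\Omega$, $\{w\}=w^+$, $[w]=w^+\mathbf n^+$ for scalar $w$, and $[\mathbf w]=0$ for vector fields. All gradients are taken element by element, $(\cdot,\cdot)_\Sigma$ is the $L^2(\Sigma)$ inner product, and $v(t_n^\pm)$ are the one-sided limits in time. On $\Gamma_n\times I_n$ and at $t_n^+$ put $\sigma_0=C_{\sigma_0}p^2/h$, where $h=h_n$ is the average of the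 diameters of the adjacent elements of $\mathcal T_n$; at the instant $t_n$ between two slabs (in the last term of $b_n$) put $h=\max(h_{n-1},h_n)$. Let $\sigma_1,\sigma_2>0$ be positive integrable functions on each $\Gamma_n\times I_n$. Define $$\begin{aligned}a_n(u,v)={}&(\ddot u,\dot v)_{\Omega\times I_n}+(\dot u(t_n^+),\dot v(t_n^+))_\Omega+(a\nabla u,\nabla\dot v)_{\Omega\times I_n}+(a\nabla u(t_n^+),\nabla v(t_n^+))_\Omega\\&-(\{a\nabla u\},[\dot v])_{\Gamma_n\times I_n}-(\{a\nabla u(t_n^+)\},[v(t_n^+)])_{\Gamma_n}-([u],\{a\nabla\dot v\})_{\Gamma_n\times I_n}-([u(t_n^+)],\{a\nabla v(t_n^+)\})_{\Gamma_n}\\&+(\sigma_0[u],[\dot v])_{\Gamma_n\times I_n}+(\sigma_0[u(t_n^+)],[v(t_n^+)])_{\Gamma_n}+(\sigma_1[u],[v])_{\Gamma_n\times I_n}+(\sigma_2[a\nabla u],[a\nabla v])_{\Gamma_n\times I_n},\end{aligned}$$ $$\begin{aligned}b_n(u,v)={}&(\dot u(t_n^-),\dot v(t_n^+))_\Omega+(a\nabla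 u(t_n^-),\nabla v(t_n^+))_\Omega-(\{a\nabla u(t_n^-)\},[v(t_n^+)])_{\Gamma_n}\\&-([u(t_n^-)],\{a\nabla v(t_n^+)\})_{\Gamma_{n-1}}+(\sigma_0[u(t_n^-)],[v(t_n^+)])_{\hat\Gamma_n},\end{aligned}$$ $a(u,v)=\sum_{n=0}^{N-1}a_n(u,v)-\sum_{n=1}^{N-1}b_n(u,v)$, and $$\begin{aligned}b^{\mathrm{init}}(v)={}&(v_0,\dot v(t_0^+))_\Omega+(a\nabla u_0,\nabla v(t_0^+))_\Omega-(\{a\nabla u_0\},[v(t_0^+)])_{\Gamma_0}\\&-([u_0],\{a\nabla v(t_0^+)\})_{\Gamma_0}+(\sigma_0[u_0],[v(t_0^+)])_{\Gamma_0}.\end{aligned}$$ **Statement.** There is a constant $C_{\mathrm{inv}}>0$ depending only on $d$ and $c_q$ such that, whenever $$C_{\sigma_0}\ge c_{\mathcal T}\,C_a^2\,C_{\mathrm{inv}}/c_a,$$ the following holds. 1. For every $n$, $a_n(v,v)\ge0$ for $v\in S_n^{h,p}$, $v\mapsto a_n(v,v)^{1/2}$ is a seminorm on $S_n^{h,p}$,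 and it is a norm on $S^{h,p}_{n,\mathrm{Trefftz}}$. 2. Assume in addition that $c_{\mathcal T}$ bounds the shape of the overlay of consecutive meshes: $\max(\operatorname{diam}K,\operatorname{diam}K')\le c_{\mathcal T}\,\rho_{K\cap K'}$ for all $K\in\mathcal T_{n-1}$, $K'\in\mathcal T_n$ with $K\cap K'\ne\emptyset$, $1\le n<N$. (This follows from the first assumption on $c_{\mathcal T}$ if the mesh does not change, and for any given meshes it holds if $c_{\mathcal T}$ is large enough.) Then $a(v,v)\ge0$ for $v\in V^{h,p}$, $v\mapsto a(v,v)^{1/2}$ is a seminorm on $V^{h,p}$, and it is a norm on $V^{h,p}_{\mathrm{Trefftz}}$. 3. Under the assumptions of 2, for every linear functional $\ell$ on $V^{h,p}_{\mathrm{Trefftz}}$ there is exactly one $u\in V^{h,p}_{\mathrm{Trefftz}}$ with $a(u,v)=\ell(v)$ for all $v\in V^{h,p}_{\mathrm{Trefftz}}$. In particular, if $u_0\in H^1_0(\Omega)$ and $v_0\in L^2(\Omega)$, and $u_0$ and $\nabla u_0$ have $L^2$ traces on $\partial K$ from inside every $K\in\mathcal T_0$ (so that $b^{\mathrm{init}}$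 is defined; the trace of a function at a point of $\partial K$ is the limit of its averages over the parts of small balls in $K$), then there is exactly one $u\in V^{h,p}_{\mathrm{Trefftz}}$ with $a(u,v)=b^{\mathrm{init}}(v)$ for all $v\in V^{h,p}_{\mathrm{Trefftz}}$. -/

import Mathlib

open MeasureTheory Filter Topology Set
open scoped ContDiff Gradient MeasureTheory

namespace TrefftzDG

noncomputable section

/-- The space `ℝ^d` with its Euclidean norm. -/
abbrev Space (d : ℕ) : Type := EuclideanSpace ℝ (Fin d)

/-! ### Spatial meshes -/

/-- Open nondegenerate `d`-simplices, and open `d`-box-type elements (affine images of the open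
unit cube). -/
def IsElement {d : ℕ} (K : Set (Space d)) : Prop :=
  (∃ P : Fin (d + 1) → Space d, AffineIndependent ℝ P ∧
      K = interior (convexHull ℝ (range P))) ∨
  (∃ f : Space d ≃ᵃ[ℝ] Space d, K = f '' {x | ∀ i, 0 < x i ∧ x i < 1})

/-- `T` is a mesh of `Ω`: finitely many pairwise disjoint elements inside `Ω` whose closures cover
the closure of `Ω`. Hanging nodes are allowed. -/
structure IsMesh {d : ℕ} (Ω : Set (Space d)) (T : Finset (Set (Space d))) : Prop where
  isElement : ∀ K ∈ T, IsElement K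
  subset : ∀ K ∈ T, K ⊆ Ω
  disjoint : ∀ K ∈ T, ∀ K' ∈ T, K ≠ K' → Disjoint K K'
  cover : closure Ω = ⋃ K ∈ T, closure K

/-- The `(d-1)`-dimensional surface measure in `ℝ^d`. -/
def surf (d : ℕ) : Measure (Space d) := μHE[d - 1]

/-- The skeleton `Γ = ⋃_K ∂K` of a mesh. -/
def skeleton {d : ℕ} (T : Finset (Set (Space d))) : Set (Space d) := ⋃ K ∈ T, frontier K

/-- The radius of the largest ball inside `K`. -/
def inradius {d : ℕ} (K : Set (Space d)) : ℝ := sSup {r : ℝ | ∃ x, Metric.ball x r ⊆ K}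

/-- `diam K / ρ_K ≤ c` for all elements. -/
def ShapeRegular {d : ℕ} (T : Finset (Set (Space d))) (c : ℝ) : Prop :=
  ∀ K ∈ T, Metric.diam K ≤ c * inradius K

/-- Elements that share a piece of the skeleton of positive surface measure have comparable
diameters. -/
def LocallyQuasiUniform {d : ℕ} (T : Finset (Set (Space d))) (c : ℝ) : Prop :=
  ∀ K ∈ T, ∀ K' ∈ T, K ≠ K' → surf d (closure K ∩ closure K') ≠ 0 →
    Metric.diam K ≤ c * Metric.diam K'

/-- Shape regularity of the overlay of two meshes: nonempty intersections `K ∩ K'` contain balls of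
radius comparable to the diameters of `K` and `K'`. For `T = T'` this is `ShapeRegular T c`, and
for given meshes it holds for some `c`. -/
def OverlayRegular {d : ℕ} (T T' : Finset (Set (Space d))) (c : ℝ) : Prop :=
  ∀ K ∈ T, ∀ K' ∈ T', (K ∩ K').Nonempty →
    Metric.diam K ≤ c * inradius (K ∩ K') ∧ Metric.diam K' ≤ c * inradius (K ∩ K')

/-- The outward unit normal of the convex set `K` at the boundary point `x`: the unit vector
spanning the normal cone, wherever it is unique (for a polytope: off the faces of codimension at
least two), and `0` elsewhere. It is `0` at interior points. -/
def outwardNormal {d : ℕ} (K : Set (Space d)) (x : Space d) : Space d :=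
  open scoped Classical in
  if h : ∃! ν : Space d, ‖ν‖ = 1 ∧ ∀ y ∈ K, inner ℝ ν (y - x) ≤ 0 then h.choose else 0

/-! ### Functions that are given element by element

A function on the broken domain is a family `f K`, one function for each element `K`, every member
being defined up to the boundary of `K`; its trace from `K` at `x ∈ ∂K` is `f K x`. -/

/-- The elements whose closure contains `x`: on the skeleton, for almost every `x`, the one or two
elements adjacent to the face at `x`; inside an element, that element. -/
def adjacent {d : ℕ} (T : Finset (Set (Space d))) (x : Space d) : Finset T :=
  open scoped Classical in Finset.univ.filter fun K => x ∈ closure (K : Set (Space d))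

/-- The function on `⋃ K` with restrictions `f K`. -/
def broken {d : ℕ} {T : Finset (Set (Space d))} {F : Type*} [AddCommMonoid F]
    (f : T → Space d → F) (x : Space d) : F :=
  ∑ K : T, (K : Set (Space d)).indicator (f K) x

/-- The average `{f}`: `(f⁺ + f⁻) / 2` on interior faces, `f⁺` on boundary faces. -/
def avg {d : ℕ} {T : Finset (Set (Space d))} {F : Type*} [AddCommGroup F] [Module ℝ F]
    (f : T → Space d → F) (x : Space d) : F :=
  ((adjacent T x).card : ℝ)⁻¹ • ∑ K ∈ adjacent T x, f K x

/-- The jump `[f]` of a scalar function: `f⁺ n⁺ + f⁻ n⁻` on interior faces, `f⁺ n⁺` on boundary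
faces, `0` inside the elements. -/
def jump {d : ℕ} {T : Finset (Set (Space d))} (f : T → Space d → ℝ) (x : Space d) : Space d :=
  ∑ K ∈ adjacent T x, f K x • outwardNormal (K : Set (Space d)) x

/-- The jump `[F]` of a vector field: `F⁺ · n⁺ + F⁻ · n⁻` on the interior skeleton. There is no
such jump on the boundary of `Ω`, where the value is set to `0`. -/
def jumpVec {d : ℕ} (Ω : Set (Space d)) {T : Finset (Set (Space d))}
    (F : T → Space d → Space d) (x : Space d) : ℝ :=
  open scoped Classical in
  if x ∈ frontier Ω then 0
  else ∑ K ∈ adjacent T x, inner ℝ (F K x) (outwardNormal (K : Set (Space d)) x)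

/-- The meshsize on the skeleton: the average of the diameters of the adjacent elements. -/
def meshsize {d : ℕ} (T : Finset (Set (Space d))) (x : Space d) : ℝ :=
  avg (fun (K : T) (_ : Space d) => Metric.diam (K : Set (Space d))) x

/-! ### The discretization -/

/-- A bounded open set `Ω`, a coefficient `a`, time nodes `0 = t_0 < t_1 < ⋯ < t_N` with
`N = M + 1`, and for every time slab `I_n = (t_n, t_{n+1})` a mesh of `Ω` on whose elements `a` is
constant. -/
structure Discretization (d : ℕ) where
  Ω : Set (Space d)
  isOpen : IsOpen Ω
  isBounded : Bornology.IsBounded Ω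
  a : Space d → ℝ
  M : ℕ
  node : Fin (M + 2) → ℝ
  node_zero : node 0 = 0
  node_strictMono : StrictMono node
  mesh : Fin (M + 1) → Finset (Set (Space d))
  isMesh : ∀ n, IsMesh Ω (mesh n)
  a_const : ∀ n, ∀ K ∈ mesh n, ∀ x ∈ K, ∀ y ∈ K, a x = a y

/-- The value of the coefficient on the element `K` on which it is constant. -/
def coeffOn {d : ℕ} (a : Space d → ℝ) (K : Set (Space d)) : ℝ :=
  open scoped Classical in if h : K.Nonempty then a h.some else 0

/-- The time derivative, element by element. -/
def dt {d : ℕ} {T : Finset (Set (Space d))} (v : T → ℝ → Space d → ℝ) : T → ℝ → Space d → ℝ :=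
  fun K t x => deriv (fun s => v K s x) t

/-- The broken spatial gradient at time `t`. -/
def grad {d : ℕ} {T : Finset (Set (Space d))} (v : T → ℝ → Space d → ℝ) (t : ℝ) :
    T → Space d → Space d :=
  fun K x => gradient (fun y => v K t y) x

/-- The flux `a ∇v` at time `t`, element by element. -/
def flux {d : ℕ} (a : Space d → ℝ) {T : Finset (Set (Space d))} (v : T → ℝ → Space d → ℝ)
    (t : ℝ) : T → Space d → Space d :=
  fun K x => coeffOn a (K : Set (Space d)) • gradient (fun y => v K t y) x

/-- The divergence of a vector field. -/
def divergence {d : ℕ} (F : Space d → Space d) (x : Space d) : ℝ :=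
  ∑ i : Fin d, (fderiv ℝ F x (EuclideanSpace.single i 1)) i

/-- `v(t)` as a family of functions of `x`. -/
def atTime {d : ℕ} {T : Finset (Set (Space d))} (v : T → ℝ → Space d → ℝ) (t : ℝ) :
    T → Space d → ℝ :=
  fun K x => v K t x

/-! ### The discrete spaces -/

/-- The polynomials of total degree at most `p` in the `d + 1` variables `(t, x)`, as functions. -/
def polySpace (d p : ℕ) : Submodule ℝ (ℝ → Space d → ℝ) where
  carrier := {f | ∃ P : MvPolynomial (Option (Fin d)) ℝ, P.totalDegree ≤ p ∧
    ∀ t x, f t x = MvPolynomial.eval (fun o : Option (Fin d) => o.elim t fun i => x i) P}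
  zero_mem' := ⟨0, by simp, by simp⟩
  add_mem' := by
    rintro f g ⟨P, hP, hf⟩ ⟨Q, hQ, hg⟩
    exact ⟨P + Q, (MvPolynomial.totalDegree_add P Q).trans (max_le hP hQ), by simp [hf, hg]⟩
  smul_mem' := by
    rintro c f ⟨P, hP, hf⟩
    exact ⟨c • P, (MvPolynomial.totalDegree_smul_le c P).trans hP, by
      simp [hf, MvPolynomial.smul_eval]⟩

theorem polySpace_contDiff {d p : ℕ} {f : ℝ → Space d → ℝ} (hf : f ∈ polySpace d p) :
    ContDiff ℝ ∞ (fun z : ℝ × Space d => f z.1 z.2) := by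
  obtain ⟨P, -, h⟩ := hf
  have h' : (fun z : ℝ × Space d => f z.1 z.2) = fun z : ℝ × Space d =>
      MvPolynomial.eval (fun o : Option (Fin d) => o.elim z.1 fun i => z.2 i) P := by
    funext z
    exact h z.1 z.2
  rw [h']
  simp only [MvPolynomial.eval_eq]
  refine ContDiff.sum fun m _ => contDiff_const.mul ?_
  refine contDiff_prod fun o _ => ContDiff.pow ?_ _
  cases o with
  | none => exact contDiff_fst
  | some i => simp only [Option.elim]; fun_prop

/-- The space of piecewise polynomials of total degree at most `p` on `T × I_n`. As a polynomial is
determined by its values on the open set `I_n × K`, this is the space of all `v ∈ L²(I_n × Ω)` with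
`v|_{I_n × K}` a polynomial of total degree at most `p` for every `K`. -/
def slabSpace {d : ℕ} (D : Discretization d) (p : ℕ) (n : Fin (D.M + 1)) :
    Submodule ℝ (D.mesh n → ℝ → Space d → ℝ) :=
  Submodule.pi univ fun _ => polySpace d p

/-- The space-time finite element space over all slabs. -/
def fullSpace {d : ℕ} (D : Discretization d) (p : ℕ) :
    Submodule ℝ ((n : Fin (D.M + 1)) → D.mesh n → ℝ → Space d → ℝ) :=
  Submodule.pi univ fun n => slabSpace D p n

/-- The time slab `I_n = (t_n, t_{n+1})`. -/
def Discretization.slab {d : ℕ} (D : Discretization d) (n : Fin (D.M + 1)) : Set ℝ :=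
  Ioo (D.node n.castSucc) (D.node n.succ)

/-- The wave operator `v̈ - ∇ · (c ∇v)` with constant coefficient `c`. -/
def waveOp {d : ℕ} (c : ℝ) (f : ℝ → Space d → ℝ) (t : ℝ) (x : Space d) : ℝ :=
  deriv (fun s => deriv (fun r => f r x) s) t -
    divergence (fun y => c • gradient (fun z => f t z) y) x

theorem waveOp_add_smul {d : ℕ} (c b : ℝ) {f g : ℝ → Space d → ℝ}
    (hf : ContDiff ℝ ∞ (fun z : ℝ × Space d => f z.1 z.2))
    (hg : ContDiff ℝ ∞ (fun z : ℝ × Space d => g z.1 z.2)) (t : ℝ) (x : Space d) :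
    waveOp c (f + b • g) t x = waveOp c f t x + b * waveOp c g t x := by
  have ft : ContDiff ℝ ∞ (fun s => f s x) := hf.comp (contDiff_prodMk_left x)
  have gt : ContDiff ℝ ∞ (fun s => g s x) := hg.comp (contDiff_prodMk_left x)
  have fx : ContDiff ℝ ∞ (fun z => f t z) := hf.comp (contDiff_prodMk_right t)
  have gx : ContDiff ℝ ∞ (fun z => g t z) := hg.comp (contDiff_prodMk_right t)
  have gradC : ∀ {u : Space d → ℝ}, ContDiff ℝ ∞ u →
      Differentiable ℝ (fun y => gradient u y) := by
    intro u hu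
    have h1 : ContDiff ℝ 1 (fderiv ℝ u) := hu.fderiv_right (by norm_cast)
    exact (InnerProductSpace.toDual ℝ (Space d)).symm.differentiable.comp
      (h1.differentiable one_ne_zero)
  have e1 : (fun s => deriv (fun r => (f + b • g) r x) s) =
      fun s => deriv (fun r => f r x) s + b * deriv (fun r => g r x) s := by
    funext s
    have h := ((ft.differentiable (by simp)) s).hasDerivAt.add
      (((gt.differentiable (by simp)) s).hasDerivAt.const_mul b)
    exact h.deriv
  have ft' : Differentiable ℝ (fun s => deriv (fun r => f r x) s) :=
    (ContDiff.iterate_deriv 1 ft).differentiable (by simp)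
  have gt' : Differentiable ℝ (fun s => deriv (fun r => g r x) s) :=
    (ContDiff.iterate_deriv 1 gt).differentiable (by simp)
  have e2 : deriv (fun s => deriv (fun r => (f + b • g) r x) s) t =
      deriv (fun s => deriv (fun r => f r x) s) t +
        b * deriv (fun s => deriv (fun r => g r x) s) t := by
    rw [e1]
    exact ((ft' t).hasDerivAt.add ((gt' t).hasDerivAt.const_mul b)).deriv
  have e3 : (fun y => c • gradient (fun z => (f + b • g) t z) y) =
      fun y => c • gradient (fun z => f t z) y + b • (c • gradient (fun z => g t z) y) := by
    funext y
    have h : gradient (fun z => (f + b • g) t z) y =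
        gradient (fun z => f t z) y + b • gradient (fun z => g t z) y := by
      have h' := ((fx.differentiable (by simp)) y).hasFDerivAt.add
        (((gx.differentiable (by simp)) y).hasFDerivAt.const_smul b)
      simp only [gradient]
      rw [show fderiv ℝ (fun z => (f + b • g) t z) y = _ from h'.fderiv]
      simp
    rw [h, smul_add, smul_comm]
  have e4 : divergence (fun y => c • gradient (fun z => (f + b • g) t z) y) x =
      divergence (fun y => c • gradient (fun z => f t z) y) x +
        b * divergence (fun y => c • gradient (fun z => g t z) y) x := by
    rw [e3]
    have h' := (((gradC fx).const_smul c) x).hasFDerivAt.add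
      ((((gradC gx).const_smul c) x).hasFDerivAt.const_smul b)
    simp only [divergence]
    rw [show fderiv ℝ (fun y => c • gradient (fun z => f t z) y +
      b • (c • gradient (fun z => g t z) y)) x = _ from h'.fderiv]
    simp only [Finset.mul_sum, ← Finset.sum_add_distrib]
    rfl
  simp only [waveOp, e2, e4]
  ring

/-- The polynomial Trefftz space on the slab `n`: the piecewise polynomials `v` with
`v̈ - ∇ · (a ∇v) = 0` in `I_n × K` for every element `K`. -/
def slabTrefftz {d : ℕ} (D : Discretization d) (p : ℕ) (n : Fin (D.M + 1)) :
    Submodule ℝ (D.mesh n → ℝ → Space d → ℝ) where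
  carrier := {v | v ∈ slabSpace D p n ∧ ∀ K : D.mesh n, ∀ t ∈ D.slab n,
    ∀ x ∈ (K : Set (Space d)), waveOp (coeffOn D.a (K : Set (Space d))) (v K) t x = 0}
  zero_mem' := by
    refine ⟨zero_mem _, fun K t _ x _ => ?_⟩
    simp [waveOp, divergence, gradient]
  add_mem' := by
    rintro v w ⟨hv, hv'⟩ ⟨hw, hw'⟩
    refine ⟨add_mem hv hw, fun K t ht x hx => ?_⟩
    have h := waveOp_add_smul (coeffOn D.a K) 1 (polySpace_contDiff (hv K (mem_univ K)))
      (polySpace_contDiff (hw K (mem_univ K))) t x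
    rw [one_smul, hv' K t ht x hx, hw' K t ht x hx] at h
    simpa using h
  smul_mem' := by
    rintro c v ⟨hv, hv'⟩
    refine ⟨Submodule.smul_mem _ c hv, fun K t ht x hx => ?_⟩
    have h := waveOp_add_smul (coeffOn D.a K) c
      (polySpace_contDiff (zero_mem (polySpace d p)))
      (polySpace_contDiff (hv K (mem_univ K))) t x
    have h0 : waveOp (coeffOn D.a K) (0 : ℝ → Space d → ℝ) t x = 0 := by
      simp [waveOp, divergence, gradient]
    rw [h0, zero_add, hv' K t ht x hx] at h
    simpa using h

/-- The polynomial Trefftz space over all slabs. -/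
def trefftz {d : ℕ} (D : Discretization d) (p : ℕ) :
    Submodule ℝ ((n : Fin (D.M + 1)) → D.mesh n → ℝ → Space d → ℝ) :=
  Submodule.pi univ fun n => slabTrefftz D p n

/-! ### The bilinear forms -/

/-- The product measure on `I_n × Γ_n`. -/
def slabSkeleton {d : ℕ} (D : Discretization d) (n : Fin (D.M + 1)) : Measure (ℝ × Space d) :=
  (volume.restrict (D.slab n)).prod ((surf d).restrict (skeleton (D.mesh n)))

/-- An admissible penalty function `σ₁`, `σ₂`: positive and integrable on every `I_n × Γ_n`. -/
def IsPenalty {d : ℕ} (D : Discretization d) (σ : ℝ → Space d → ℝ) : Prop :=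
  ∀ n, (∀ t ∈ D.slab n, ∀ x ∈ skeleton (D.mesh n), 0 < σ t x) ∧
    Integrable (fun z : ℝ × Space d => σ z.1 z.2) (slabSkeleton D n)

/-- `σ₀ = C p² / h`. -/
def sigma0 (C : ℝ) (p : ℕ) (h : ℝ) : ℝ := C * (p : ℝ) ^ 2 * h⁻¹

/-- The bilinear form `a_n(u, v)`, with `s = t_n`. -/
def aSlab {d : ℕ} (D : Discretization d) (p : ℕ) (C : ℝ) (σ₁ σ₂ : ℝ → Space d → ℝ)
    (n : Fin (D.M + 1)) (u v : D.mesh n → ℝ → Space d → ℝ) : ℝ :=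
  let s := D.node n.castSucc
  let Γ := skeleton (D.mesh n)
  let σ₀ : Space d → ℝ := fun x => sigma0 C p (meshsize (D.mesh n) x)
  (∫ z in D.slab n ×ˢ D.Ω,
      broken (atTime (dt (dt u)) z.1) z.2 * broken (atTime (dt v) z.1) z.2)
  + (∫ x in D.Ω, broken (atTime (dt u) s) x * broken (atTime (dt v) s) x)
  + (∫ z in D.slab n ×ˢ D.Ω,
      D.a z.2 * inner ℝ (broken (grad u z.1) z.2) (broken (grad (dt v) z.1) z.2))
  + (∫ x in D.Ω, D.a x * inner ℝ (broken (grad u s) x) (broken (grad v s) x))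
  - (∫ z, inner ℝ (avg (flux D.a u z.1) z.2) (jump (atTime (dt v) z.1) z.2) ∂slabSkeleton D n)
  - (∫ x in Γ, inner ℝ (avg (flux D.a u s) x) (jump (atTime v s) x) ∂surf d)
  - (∫ z, inner ℝ (jump (atTime u z.1) z.2) (avg (flux D.a (dt v) z.1) z.2) ∂slabSkeleton D n)
  - (∫ x in Γ, inner ℝ (jump (atTime u s) x) (avg (flux D.a v s) x) ∂surf d)
  + (∫ z, σ₀ z.2 * inner ℝ (jump (atTime u z.1) z.2) (jump (atTime (dt v) z.1) z.2)
      ∂slabSkeleton D n)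
  + (∫ x in Γ, σ₀ x * inner ℝ (jump (atTime u s) x) (jump (atTime v s) x) ∂surf d)
  + (∫ z, σ₁ z.1 z.2 * inner ℝ (jump (atTime u z.1) z.2) (jump (atTime v z.1) z.2)
      ∂slabSkeleton D n)
  + (∫ z, σ₂ z.1 z.2 * (jumpVec D.Ω (flux D.a u z.1) z.2 * jumpVec D.Ω (flux D.a v z.1) z.2)
      ∂slabSkeleton D n)

/-- The bilinear form `b_n(u, v)` for `n = m + 1`, where `u` lives on the slab `m`, `v` on the slab
`m + 1`, and `s = t_n` is the time node between them. At the time node the meshsize in `σ₀` is the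
larger one of the meshsizes of the two meshes. -/
def bSlab {d : ℕ} (D : Discretization d) (p : ℕ) (C : ℝ) (m : Fin D.M)
    (u : D.mesh m.castSucc → ℝ → Space d → ℝ) (v : D.mesh m.succ → ℝ → Space d → ℝ) : ℝ :=
  let s := D.node m.succ.castSucc
  let Γm := skeleton (D.mesh m.castSucc)
  let Γp := skeleton (D.mesh m.succ)
  let σ₀ : Space d → ℝ := fun x =>
    sigma0 C p (max (meshsize (D.mesh m.castSucc) x) (meshsize (D.mesh m.succ) x))
  (∫ x in D.Ω, broken (atTime (dt u) s) x * broken (atTime (dt v) s) x)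
  + (∫ x in D.Ω, D.a x * inner ℝ (broken (grad u s) x) (broken (grad v s) x))
  - (∫ x in Γp, inner ℝ (avg (flux D.a u s) x) (jump (atTime v s) x) ∂surf d)
  - (∫ x in Γm, inner ℝ (jump (atTime u s) x) (avg (flux D.a v s) x) ∂surf d)
  + (∫ x in Γm ∪ Γp, σ₀ x * inner ℝ (jump (atTime u s) x) (jump (atTime v s) x) ∂surf d)

/-- The bilinear form `a(u, v) = ∑_{n=0}^{N-1} a_n(u, v) - ∑_{n=1}^{N-1} b_n(u, v)`. -/
def aForm {d : ℕ} (D : Discretization d) (p : ℕ) (C : ℝ) (σ₁ σ₂ : ℝ → Space d → ℝ)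
    (u v : (n : Fin (D.M + 1)) → D.mesh n → ℝ → Space d → ℝ) : ℝ :=
  (∑ n, aSlab D p C σ₁ σ₂ n (u n) (v n)) - ∑ m, bSlab D p C m (u m.castSucc) (v m.succ)

/-! ### Initial data -/

/-- `u₀ ∈ H¹₀(Ω)` with weak gradient `G`: limit in `H¹(Ω)` of smooth functions with compact support
in `Ω`. -/
def MemH10 {d : ℕ} (Ω : Set (Space d)) (u₀ : Space d → ℝ) (G : Space d → Space d) : Prop :=
  MemLp u₀ 2 (volume.restrict Ω) ∧ MemLp G 2 (volume.restrict Ω) ∧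
  ∀ ε : ℝ, 0 < ε → ∃ φ : Space d → ℝ, ContDiff ℝ ∞ φ ∧ HasCompactSupport φ ∧ tsupport φ ⊆ Ω ∧
    eLpNorm (fun x => u₀ x - φ x) 2 (volume.restrict Ω) ≤ ENNReal.ofReal ε ∧
    eLpNorm (fun x => G x - gradient φ x) 2 (volume.restrict Ω) ≤ ENNReal.ofReal ε

/-- `g ∈ L²(∂K)` is the trace of `f` from inside `K`: at almost every boundary point it is the limit
of the averages of `f` over the parts of small balls in `K`. -/
def HasTrace {d : ℕ} {F : Type*} [NormedAddCommGroup F] [NormedSpace ℝ F]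
    (K : Set (Space d)) (f g : Space d → F) : Prop :=
  MemLp g 2 ((surf d).restrict (frontier K)) ∧
  ∀ᵐ x ∂(surf d).restrict (frontier K),
    Tendsto (fun r : ℝ => ⨍ y in K ∩ Metric.ball x r, f y) (𝓝[>] 0) (𝓝 (g x))

/-- The linear form `b^init(v)` for initial data `u₀` with gradient `G`, and `v₀`; the families `τ`
and `γ` are the traces of `u₀` and of `∇u₀` on the boundaries of the elements of the first mesh. -/
def bInit {d : ℕ} (D : Discretization d) (p : ℕ) (C : ℝ) (G : Space d → Space d)
    (v₀ : Space d → ℝ) (τ : D.mesh 0 → Space d → ℝ) (γ : D.mesh 0 → Space d → Space d)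
    (v : (n : Fin (D.M + 1)) → D.mesh n → ℝ → Space d → ℝ) : ℝ :=
  let s := D.node 0
  let Γ := skeleton (D.mesh 0)
  let σ₀ : Space d → ℝ := fun x => sigma0 C p (meshsize (D.mesh 0) x)
  (∫ x in D.Ω, v₀ x * broken (atTime (dt (v 0)) s) x)
  + (∫ x in D.Ω, D.a x * inner ℝ (G x) (broken (grad (v 0) s) x))
  - (∫ x in Γ, inner ℝ (avg (fun (K : D.mesh 0) y => coeffOn D.a (K : Set (Space d)) • γ K y) x)
      (jump (atTime (v 0) s) x) ∂surf d)
  - (∫ x in Γ, inner ℝ (jump τ x) (avg (flux D.a (v 0) s) x) ∂surf d)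
  + (∫ x in Γ, σ₀ x * inner ℝ (jump τ x) (jump (atTime (v 0) s) x) ∂surf d)

end

end TrefftzDG

/-!
The proof is an energy argument. With `u = v`, every space-time integral of `a_n` without `σ₁` and
`σ₂` is part of the integral of the time derivative of a quadratic expression, and together with
the terms at the lower time node these integrals leave half of the expression at both ends of the
slab. So `a_n(v, v)` is the sum of the energies
`E(v) = ½ ‖v̇‖² + ½ ‖a^{1/2} ∇v‖² - ({a ∇v}, [v]) + ½ (σ₀ [v], [v])` at both ends and of the
nonnegative terms with `σ₁` and `σ₂` (`aSlab_self`). In `a(v, v)` the initial and the final energy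
remain, and at every inner node the two one-sided energies minus `b_n(v, v)` (`aForm_self`). With
the penalty weight of the node on both sides, this difference would be the energy of the jump of
`v` in time; as that weight belongs to the larger meshsize, it is the smaller one, and the true
difference is no less (`PenaltyDominates.bSlab_le`). Everything thus reduces to the nonnegativity
of the energy of a difference `w` of functions on two meshes.

The only term without a sign is the consistency term, which Young's inequality bounds by
`½ (σ₀⁻¹ {a ∇w}, {a ∇w}) + ½ (σ₀ [w], [w])`. It remains to absorb the first part in a quarter of
`‖a^{1/2} ∇w‖²` (`Discretization.integral_inner_avgFlux_jump_le`), which takes two facts.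

* A polynomial trace inequality `ρ ∫_{∂P} |∇w|² ≤ (p + 1) (p + d) ∫_P |∇w|²` for a polyhedron `P`
  that contains a ball of radius `ρ` (`IsPolyhedron.integral_frontier_sq_le`). On an interval with
  weight `s ^ (d - 1)` it follows from an expansion in orthogonal polynomials (`eval_one_sq_le`).
  The cones over the faces of the polyhedron with apex at the centre of the ball are disjoint, and
  the distance of the centre to every face is at least `ρ` (`IsPolyhedron.lintegral_frontier_le`).
  The resulting order `p² / ρ` is that of `σ₀`, by shape regularity.
* A comparison of averages on different meshes. At almost every boundary point the elements are
  half spaces locally, so the elements of a mesh that touch the point occupy equal shares of a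
  small ball. The averages over the elements of two meshes are therefore marginals of one
  probability distribution on the pairs of overlapping elements (`IsMesh.exists_weights`), and
  Jensen's inequality bounds the difference of the average fluxes by traces from the intersections
  `K ∩ K'`, on each of which the difference is one polynomial.

If the form vanishes at a Trefftz function, then so do its initial energy and its `σ₁` term. At
the initial time its time derivative and its broken gradient vanish, so that it is constant on
every element, and it has no jumps, including those at the boundary of the domain; hence it is
zero (`IsMesh.eq_zero_of_jump_eq_zero`). A polynomial solution of the wave equation with zero
Cauchy data is zero (`eq_zero_of_waveOp_eq_zero`). For `a` the argument passes from slab to slab,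
as no energy is lost at the nodes (`PenaltyDominates.eq_zero_of_aForm_eq_zero`).

The rest is linear algebra: a nonnegative bilinear form has the Cauchy–Schwarz inequality, which
gives the triangle inequality (`IsBilin.exists_seminorm`), and on a finite-dimensional space a
definite one represents every linear functional (`IsBilin.existsUnique`), in particular that of
the initial data (`isLin_bInit`).
-/

namespace TrefftzDG

section OneDim

/-! ### The trace inequality for polynomials on an interval -/

open Polynomial

/-- The functional `f ↦ ∫₀¹ sⁿ f(s) ds` on polynomials. -/
noncomputable def weightedIntegral (n : ℕ) : ℝ[X] →ₗ[ℝ] ℝ where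
  toFun f := ∫ s in (0 : ℝ)..1, s ^ n * f.eval s
  map_add' f g := by
    rw [← intervalIntegral.integral_add]
    · simp [mul_add]
    · exact (by fun_prop : Continuous fun s : ℝ => s ^ n * f.eval s).intervalIntegrable _ _
    · exact (by fun_prop : Continuous fun s : ℝ => s ^ n * g.eval s).intervalIntegrable _ _
  map_smul' c f := by
    rw [RingHom.id_apply, smul_eq_mul, ← intervalIntegral.integral_const_mul]
    simp [mul_left_comm]

theorem weightedIntegral_sq_pos (n : ℕ) {f : ℝ[X]} (hf : f ≠ 0) :
    0 < weightedIntegral n (f * f) := by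
  have hc : Continuous fun s : ℝ => s ^ n * (f * f).eval s := by fun_prop
  refine intervalIntegral.integral_pos one_pos hc.continuousOn (fun s hs => ?_) ?_
  · have := hs.1
    simp only [eval_mul]
    exact mul_nonneg (by positivity) (mul_self_nonneg _)
  · by_contra! h
    refine hf (eq_zero_of_infinite_isRoot f ((Ioc_infinite (zero_lt_one' ℝ)).mono fun s hs => ?_))
    have h1 := h s ⟨hs.1.le, hs.2⟩
    have h2 : 0 < s ^ n := pow_pos hs.1 n
    simp only [eval_mul] at h1
    exact mul_self_eq_zero.1 (le_antisymm (by nlinarith) (mul_self_nonneg _))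

theorem weightedIntegral_sq_nonneg (n : ℕ) (f : ℝ[X]) : 0 ≤ weightedIntegral n (f * f) := by
  rcases eq_or_ne f 0 with rfl | hf
  · simp
  · exact (weightedIntegral_sq_pos n hf).le

/-- The fundamental theorem of calculus for `sⁿ⁺¹ f(s)`. -/
theorem eval_one_eq_weightedIntegral (n : ℕ) (f : ℝ[X]) :
    f.eval 1 = (n + 1) * weightedIntegral n f + weightedIntegral n (X * derivative f) := by
  have h : ∀ s ∈ uIcc (0 : ℝ) 1, HasDerivAt (fun s => s ^ (n + 1) * f.eval s)
      ((n + 1) * (s ^ n * f.eval s) + s ^ n * (X * derivative f).eval s) s := by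
    intro s _
    have := (hasDerivAt_pow (n + 1) s).mul (f.hasDerivAt s)
    refine this.congr_deriv ?_
    simp only [eval_mul, eval_X, Nat.add_sub_cancel]
    push_cast
    ring
  have hc : ∀ g : ℝ[X], Continuous fun s : ℝ => s ^ n * g.eval s := fun g => by fun_prop
  have key := intervalIntegral.integral_eq_sub_of_hasDerivAt h
    ((((hc f).const_mul ((n : ℝ) + 1)).add (hc (X * derivative f))).intervalIntegrable _ _)
  rw [intervalIntegral.integral_add (((hc f).const_mul _).intervalIntegrable _ _)
    ((hc _).intervalIntegrable _ _), intervalIntegral.integral_const_mul] at key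
  simpa [weightedIntegral] using key.symm

/-- The monic orthogonal polynomial of degree `m` for the weight `sⁿ` on `(0, 1)`. -/
theorem exists_monic_orthogonal (n m : ℕ) : ∃ e : ℝ[X], e - X ^ m ∈ degreeLT ℝ m ∧
    ∀ q ∈ degreeLT ℝ m, weightedIntegral n (q * e) = 0 := by
  let B : degreeLT ℝ m →ₗ[ℝ] Module.Dual ℝ (degreeLT ℝ m) :=
    LinearMap.mk₂ ℝ (fun f g => weightedIntegral n ((f : ℝ[X]) * g))
      (by intros; simp [add_mul]) (by intros; simp) (by intros; simp [mul_add]) (by intros; simp)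
  have hB : Function.Injective B := by
    rw [← LinearMap.ker_eq_bot, LinearMap.ker_eq_bot']
    intro f hf
    by_contra h
    have h0 : (f : ℝ[X]) ≠ 0 := by simpa using h
    exact (weightedIntegral_sq_pos n h0).ne' (LinearMap.congr_fun hf f)
  have : FiniteDimensional ℝ (degreeLT ℝ m) :=
    Module.Finite.equiv (degreeLTEquiv ℝ m).symm
  have hS := (LinearMap.injective_iff_surjective_of_finrank_eq_finrank
    (Subspace.dual_finrank_eq (K := ℝ) (V := degreeLT ℝ m)).symm).1 hB
  obtain ⟨r, hr⟩ := hS ((weightedIntegral n).comp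
    ((LinearMap.mulLeft ℝ (X ^ m)).comp (degreeLT ℝ m).subtype))
  refine ⟨X ^ m - (r : ℝ[X]), by simp, fun q hq => ?_⟩
  have := LinearMap.congr_fun hr ⟨q, hq⟩
  simp only [B, LinearMap.mk₂_apply, LinearMap.comp_apply, Submodule.subtype_apply,
    LinearMap.mulLeft_apply] at this
  rw [mul_sub, map_sub, mul_comm q (X ^ m), ← this, mul_comm q, sub_self]

/-- Orthogonal polynomials satisfy `e(1)² = (2m + n + 1) ∫₀¹ sⁿ e²`, because `X e' - m e` has lower
degree; summing over the degrees gives the sharp trace inequality on the interval. -/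
theorem eval_one_sq_le (n m : ℕ) (f : ℝ[X]) (hf : f ∈ degreeLT ℝ m) :
    f.eval 1 ^ 2 ≤ m * (m + n) * weightedIntegral n (f * f) := by
  induction m generalizing f with
  | zero =>
    have : f = 0 := by
      ext k
      simpa using coeff_eq_zero_of_degree_lt
        ((mem_degreeLT.1 hf).trans_le (by simp : ((0 : ℕ) : WithBot ℕ) ≤ (k : WithBot ℕ)))
    simp [this]
  | succ m ih =>
    obtain ⟨e, he, horth⟩ := exists_monic_orthogonal n m
    have hcoeff : e.coeff m = 1 := by
      have := coeff_eq_zero_of_degree_lt (mem_degreeLT.1 he)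
      simpa [sub_eq_zero] using this
    have hdeg : e ∈ degreeLT ℝ (m + 1) := by
      have h1 : X ^ m ∈ degreeLT ℝ (m + 1) := by
        rw [mem_degreeLT, degree_X_pow]; exact_mod_cast m.lt_succ_self
      have h2 := degreeLT_mono m.le_succ he
      simpa using add_mem h2 h1
    have lower : ∀ g ∈ degreeLT ℝ (m + 1), g.coeff m = 0 → g ∈ degreeLT ℝ m := by
      intro g hg h0
      rw [mem_degreeLT, degree_lt_iff_coeff_zero] at hg ⊢
      intro k hk
      rcases hk.eq_or_lt with rfl | hk
      · exact h0
      · exact hg k hk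
    have he1 : e.eval 1 ^ 2 = (2 * m + n + 1) * weightedIntegral n (e * e) := by
      have h1 := eval_one_eq_weightedIntegral n (e * e)
      have h2 : X * derivative e - C (m : ℝ) * e ∈ degreeLT ℝ m := by
        rw [mem_degreeLT, degree_lt_iff_coeff_zero]
        intro k hk
        rw [mem_degreeLT, degree_lt_iff_coeff_zero] at hdeg
        have hX : (X * derivative e).coeff k = k * e.coeff k := by
          cases k with
          | zero => simp
          | succ k => simp [coeff_X_mul, coeff_derivative, mul_comm]
        rw [coeff_sub, hX, coeff_C_mul]
        rcases hk.eq_or_lt with rfl | hk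
        · simp
        · simp [hdeg k hk]
      have h3 := horth _ h2
      rw [sub_mul, map_sub, mul_assoc (C _), ← smul_eq_C_mul, map_smul, smul_eq_mul] at h3
      have h4 : X * derivative (e * e) = (2 : ℝ) • (X * derivative e * e) := by
        rw [derivative_mul, two_smul]; ring
      rw [h4, map_smul, smul_eq_mul] at h1
      rw [eval_mul] at h1
      rw [sq, h1]
      linear_combination 2 * h3
    set α := f.coeff m
    set r := f - α • e
    have hr : r ∈ degreeLT ℝ m := by
      refine lower _ (sub_mem hf (Submodule.smul_mem _ _ hdeg)) ?_
      simp [r, α, hcoeff]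
    have hfr : f = r + α • e := by simp [r]
    have hsplit : weightedIntegral n (f * f) =
        weightedIntegral n (r * r) + α ^ 2 * weightedIntegral n (e * e) := by
      have : f * f = r * r + (2 * α) • (r * e) + α ^ 2 • (e * e) := by
        rw [hfr]; simp only [smul_eq_C_mul, map_mul, map_pow, map_ofNat]; ring
      rw [this, map_add, map_add, map_smul, map_smul, horth r hr]
      simp
    have hA := ih r hr
    have hP := weightedIntegral_sq_nonneg n r
    have hQ := weightedIntegral_sq_nonneg n e
    rw [hsplit, hfr]
    simp only [eval_add, eval_smul, smul_eq_mul]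
    set a := r.eval 1
    set b := e.eval 1
    set P := weightedIntegral n (r * r)
    set Q := weightedIntegral n (e * e)
    push_cast
    set A : ℝ := m * (m + n)
    have hA0 : 0 ≤ A := by positivity
    have hB0 : 0 ≤ (2 * m + n + 1 : ℝ) := by positivity
    set B : ℝ := 2 * m + n + 1
    have hAB : ((m : ℝ) + 1) * (m + 1 + n) = A + B := by simp only [A, B]; ring
    rw [hAB]
    -- Cauchy-Schwarz: the mixed term `2 a (α b)` is at most `B P + A α² Q`
    have h5 : 2 * a * (α * b) ≤ B * P + A * (α ^ 2 * Q) := by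
      have h6 : (a * (α * b)) ^ 2 ≤ (B * P) * (A * (α ^ 2 * Q)) := by
        have : (a * (α * b)) ^ 2 = a ^ 2 * (α ^ 2 * (B * Q)) := by rw [← he1]; ring
        rw [this]
        calc a ^ 2 * (α ^ 2 * (B * Q)) ≤ A * P * (α ^ 2 * (B * Q)) := by gcongr
          _ = _ := by ring
      have h7 : 0 ≤ B * P + A * (α ^ 2 * Q) := by positivity
      refine (abs_le_of_sq_le_sq' ?_ h7).2
      nlinarith [sq_nonneg (B * P - A * (α ^ 2 * Q))]
    nlinarith [he1]

end OneDim

section PolynomialCalculus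

/-! ### Calculus of space-time polynomials -/

theorem hasFDerivAt_mvPolynomial_eval {σ : Type*} [Fintype σ] (P : MvPolynomial σ ℝ) (z : σ → ℝ) :
    HasFDerivAt (fun z : σ → ℝ => MvPolynomial.eval z P)
      (∑ i, MvPolynomial.eval z (MvPolynomial.pderiv i P) •
        (ContinuousLinearMap.proj i : (σ → ℝ) →L[ℝ] ℝ)) z := by
  classical
  induction P using MvPolynomial.induction_on with
  | C a => simpa using hasFDerivAt_const a z
  | add P Q hP hQ =>
    simp only [map_add, add_smul, Finset.sum_add_distrib]
    exact hP.add hQ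
  | mul_X P i hP =>
    have h : HasFDerivAt (fun z : σ → ℝ => z i)
        (ContinuousLinearMap.proj i : (σ → ℝ) →L[ℝ] ℝ) z :=
      (ContinuousLinearMap.proj i : (σ → ℝ) →L[ℝ] ℝ).hasFDerivAt
    have h2 := hP.mul h
    simp only [map_mul, MvPolynomial.eval_X]
    refine h2.congr_fderiv ?_
    ext w
    simp [MvPolynomial.pderiv_X, Pi.single_apply, add_mul, Finset.sum_add_distrib,
      Finset.mul_sum, apply_ite]
    ring_nf

theorem totalDegree_pderiv_le {σ : Type*} (i : σ) (P : MvPolynomial σ ℝ) :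
    (MvPolynomial.pderiv i P).totalDegree ≤ P.totalDegree := by
  classical
  conv_lhs => rw [P.as_sum, map_sum]
  refine MvPolynomial.totalDegree_finsetSum_le fun m hm => ?_
  rw [MvPolynomial.pderiv_monomial]
  refine (MvPolynomial.totalDegree_monomial_le _ _).trans ?_
  refine le_trans ?_ (MvPolynomial.le_totalDegree (p := P) hm)
  have h : m - Finsupp.single i 1 ≤ m := tsub_le_self
  exact Finsupp.sum_le_sum_index h (fun _ _ => fun _ _ hab => hab) (fun _ _ => rfl)

theorem pderiv_pderiv_comm {σ : Type*} (i j : σ) (P : MvPolynomial σ ℝ) :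
    MvPolynomial.pderiv i (MvPolynomial.pderiv j P) =
      MvPolynomial.pderiv j (MvPolynomial.pderiv i P) := by
  classical
  have h : ⁅MvPolynomial.pderiv (R := ℝ) i, MvPolynomial.pderiv (R := ℝ) j⁆ = 0 := by
    refine MvPolynomial.derivation_ext fun k => ?_
    simp [Derivation.commutator_apply, MvPolynomial.pderiv_X, Pi.single_apply, apply_ite]
  have := congrArg (fun D => D P) h
  simpa [Derivation.commutator_apply, sub_eq_zero] using this

theorem eval_aeval_polynomial {σ : Type*} (P : MvPolynomial σ ℝ) (φ : σ → Polynomial ℝ) (s : ℝ) :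
    (MvPolynomial.aeval φ P).eval s = MvPolynomial.eval (fun i => (φ i).eval s) P := by
  induction P using MvPolynomial.induction_on with
  | C a => simp
  | add P Q hP hQ => simp [hP, hQ]
  | mul_X P i hP => simp [hP]

/-- The restriction of a polynomial of total degree at most `p` to a line is a polynomial of degree
at most `p`. -/
theorem exists_polynomial_on_line {σ : Type*} (P : MvPolynomial σ ℝ) {p : ℕ}
    (hP : P.totalDegree ≤ p) (a b : σ → ℝ) :
    ∃ g ∈ Polynomial.degreeLT ℝ (p + 1),
      ∀ s : ℝ, MvPolynomial.eval (fun i => a i + b i * s) P = g.eval s := by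
  classical
  refine ⟨MvPolynomial.aeval (fun i => Polynomial.C (a i) + Polynomial.C (b i) * Polynomial.X) P,
    ?_, fun s => by simp [eval_aeval_polynomial]⟩
  rw [MvPolynomial.aeval_def, MvPolynomial.eval₂_eq]
  refine Submodule.sum_mem _ fun m hm => ?_
  rw [Polynomial.mem_degreeLT]
  refine lt_of_le_of_lt Polynomial.degree_le_natDegree ?_
  refine Nat.cast_lt.2 (Nat.lt_succ_of_le ?_)
  refine (Polynomial.natDegree_C_mul_le _ _).trans ?_
  refine (Polynomial.natDegree_prod_le _ _).trans ?_
  refine le_trans ?_ ((MvPolynomial.le_totalDegree (p := P) hm).trans hP)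
  refine Finset.sum_le_sum fun i _ => ?_
  refine (Polynomial.natDegree_pow_le).trans ?_
  have : (Polynomial.C (a i) + Polynomial.C (b i) * Polynomial.X).natDegree ≤ 1 := by
    compute_degree
  nlinarith

/-- The point of `ℝ^{1+d}` with time `t` and position `x`, as a family indexed by the variables. -/
abbrev stPoint {d : ℕ} (t : ℝ) (x : Space d) : Option (Fin d) → ℝ :=
  fun o => o.elim t fun i => x i

variable {d : ℕ}

theorem hasDerivAt_eval_time (P : MvPolynomial (Option (Fin d)) ℝ) (t : ℝ) (x : Space d) :
    HasDerivAt (fun s => MvPolynomial.eval (stPoint s x) P)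
      (MvPolynomial.eval (stPoint t x) (MvPolynomial.pderiv none P)) t := by
  have h : HasDerivAt (fun s => stPoint s x) (Pi.single none 1) t := by
    rw [hasDerivAt_pi]
    rintro (_ | i)
    · simpa using hasDerivAt_id' t
    · simpa using hasDerivAt_const t (x i)
  have := (hasFDerivAt_mvPolynomial_eval P (stPoint t x)).comp_hasDerivAt t h
  refine this.congr_deriv ?_
  simp [Pi.single_apply, -Fintype.sum_option]

theorem hasGradientAt_eval_space (P : MvPolynomial (Option (Fin d)) ℝ) (t : ℝ) (x : Space d) :
    HasGradientAt (fun y => MvPolynomial.eval (stPoint t y) P)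
      (WithLp.toLp 2 fun i => MvPolynomial.eval (stPoint t x) (MvPolynomial.pderiv (some i) P))
      x := by
  have h : HasFDerivAt (fun y : Space d => stPoint t y)
      (ContinuousLinearMap.pi fun o : Option (Fin d) =>
        o.elim (0 : Space d →L[ℝ] ℝ) fun i => EuclideanSpace.proj i) x := by
    rw [hasFDerivAt_pi]
    rintro (_ | i)
    · simpa using hasFDerivAt_const t x
    · simpa using (EuclideanSpace.proj (𝕜 := ℝ) i).hasFDerivAt
  have := (hasFDerivAt_mvPolynomial_eval P (stPoint t x)).comp x h
  rw [hasGradientAt_iff_hasFDerivAt]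
  refine this.congr_fderiv ?_
  ext w
  simp [PiLp.inner_apply, mul_comm]

variable {p : ℕ} {f : ℝ → Space d → ℝ}

theorem polySpace_dt (hf : f ∈ polySpace d p) :
    (fun t x => deriv (fun s => f s x) t) ∈ polySpace d p := by
  obtain ⟨P, hP, h⟩ := hf
  refine ⟨MvPolynomial.pderiv none P, (totalDegree_pderiv_le _ _).trans hP, fun t x => ?_⟩
  simp only [h]
  exact (hasDerivAt_eval_time P t x).deriv

theorem polySpace_gradient (hf : f ∈ polySpace d p) (i : Fin d) :
    (fun t x => gradient (fun y => f t y) x i) ∈ polySpace d p := by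
  obtain ⟨P, hP, h⟩ := hf
  refine ⟨MvPolynomial.pderiv (some i) P, (totalDegree_pderiv_le _ _).trans hP, fun t x => ?_⟩
  simp only [h]
  rw [(hasGradientAt_eval_space P t x).gradient]

theorem polySpace_hasDerivAt (hf : f ∈ polySpace d p) (t : ℝ) (x : Space d) :
    HasDerivAt (fun s => f s x) (deriv (fun s => f s x) t) t := by
  obtain ⟨P, hP, h⟩ := hf
  simp only [h]
  exact (hasDerivAt_eval_time P t x).differentiableAt.hasDerivAt

theorem polySpace_hasGradientAt (hf : f ∈ polySpace d p) (t : ℝ) (x : Space d) :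
    HasGradientAt (fun y => f t y) (gradient (fun y => f t y) x) x := by
  obtain ⟨P, hP, h⟩ := hf
  simp only [h]
  exact (hasGradientAt_eval_space P t x).differentiableAt.hasGradientAt

theorem polySpace_hasDerivAt_gradient (hf : f ∈ polySpace d p) (t : ℝ) (x : Space d) :
    HasDerivAt (fun s => gradient (fun y => f s y) x)
      (gradient (fun y => deriv (fun r => f r y) t) x) t := by
  obtain ⟨P, hP, h⟩ := hf
  simp only [h]
  have h1 : (fun y => deriv (fun r => MvPolynomial.eval (stPoint r y) P) t) =
      fun y => MvPolynomial.eval (stPoint t y) (MvPolynomial.pderiv none P) := by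
    funext y
    exact (hasDerivAt_eval_time P t y).deriv
  rw [h1, (hasGradientAt_eval_space _ t x).gradient]
  have h2 : (fun s => gradient (fun y : Space d => MvPolynomial.eval (stPoint s y) P) x) =
      fun s => WithLp.toLp 2 fun i =>
        MvPolynomial.eval (stPoint s x) (MvPolynomial.pderiv (some i) P) := by
    funext s
    exact (hasGradientAt_eval_space _ s x).gradient
  rw [h2]
  refine (PiLp.continuousLinearEquiv 2 ℝ (fun _ : Fin d => ℝ)).symm.hasFDerivAt.comp_hasDerivAt t ?_
  rw [hasDerivAt_pi]
  intro i
  rw [← pderiv_pderiv_comm none (some i) P]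
  exact hasDerivAt_eval_time _ t x

theorem polySpace_continuous (hf : f ∈ polySpace d p) :
    Continuous fun z : ℝ × Space d => f z.1 z.2 := (polySpace_contDiff hf).continuous

theorem polySpace_continuous_gradient (hf : f ∈ polySpace d p) :
    Continuous fun z : ℝ × Space d => gradient (fun y => f z.1 y) z.2 := by
  refine (PiLp.continuous_toLp 2 (fun _ : Fin d => ℝ)).comp
    (f := fun z : ℝ × Space d => WithLp.ofLp (gradient (fun y => f z.1 y) z.2)) ?_
  exact continuous_pi fun i => polySpace_continuous (polySpace_gradient hf i)

theorem polySpace_zero_const (hf : f ∈ polySpace d 0) : ∃ c, f = fun _ _ => c := by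
  obtain ⟨P, hP, h⟩ := hf
  rw [MvPolynomial.totalDegree_eq_zero_iff_eq_C.1 (Nat.le_zero.1 hP)] at h
  exact ⟨_, by funext t x; simpa using h t x⟩

/-- The restriction of a space-time polynomial to a spatial line at a fixed time. -/
theorem polySpace_line (hf : f ∈ polySpace d p) (t : ℝ) (x₀ y : Space d) :
    ∃ g ∈ Polynomial.degreeLT ℝ (p + 1), ∀ s : ℝ, f t (x₀ + s • (y - x₀)) = g.eval s := by
  obtain ⟨P, hP, h⟩ := hf
  obtain ⟨g, hg, hg'⟩ := exists_polynomial_on_line P hP (stPoint t x₀) (stPoint 0 (y - x₀))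
  refine ⟨g, hg, fun s => ?_⟩
  rw [h, ← hg']
  congr 2
  funext o
  cases o <;> simp [mul_comm]

/-- The restriction of a space-time polynomial to a line in the direction of time. -/
theorem polySpace_timeLine (hf : f ∈ polySpace d p) (x : Space d) :
    ∃ g : Polynomial ℝ, ∀ s : ℝ, f s x = g.eval s := by
  obtain ⟨P, hP, h⟩ := hf
  obtain ⟨g, -, hg'⟩ := exists_polynomial_on_line P hP (stPoint 0 x) (stPoint 1 (0 : Space d))
  refine ⟨g, fun s => ?_⟩
  rw [h, ← hg']
  congr 2
  funext o
  cases o <;> simp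

theorem polynomial_eq_zero_of_eventually {g : Polynomial ℝ} {a : ℝ}
    (h : ∀ᶠ s in 𝓝 a, g.eval s = 0) : g = 0 :=
  g.eq_zero_of_infinite_isRoot (infinite_of_mem_nhds a h)

theorem polySpace_eq_zero_of_open (hf : f ∈ polySpace d p) {t : ℝ} {U : Set (Space d)}
    (hU : IsOpen U) (hne : U.Nonempty) (h0 : ∀ x ∈ U, f t x = 0) (x : Space d) : f t x = 0 := by
  obtain ⟨x₀, hx₀⟩ := hne
  obtain ⟨g, -, hg⟩ := polySpace_line hf t x₀ x
  have hc : Continuous fun s : ℝ => x₀ + s • (x - x₀) := by fun_prop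
  have : ∀ᶠ s in 𝓝 (0 : ℝ), g.eval s = 0 := by
    have h1 : ∀ᶠ s in 𝓝 (0 : ℝ), x₀ + s • (x - x₀) ∈ U :=
      hc.continuousAt.eventually_mem (hU.mem_nhds (by simpa using hx₀))
    filter_upwards [h1] with s hs
    rw [← hg, h0 _ hs]
  have h2 := hg 1
  rw [polynomial_eq_zero_of_eventually this] at h2
  simpa using h2

theorem polySpace_eq_zero_of_open_time (hf : f ∈ polySpace d p) {I : Set ℝ} {U : Set (Space d)}
    (hI : IsOpen I) (hIne : I.Nonempty) (hU : IsOpen U) (hne : U.Nonempty)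
    (h0 : ∀ t ∈ I, ∀ x ∈ U, f t x = 0) (t : ℝ) (x : Space d) : f t x = 0 := by
  obtain ⟨t₀, ht₀⟩ := hIne
  obtain ⟨g, hg⟩ := polySpace_timeLine hf x
  have : ∀ᶠ s in 𝓝 t₀, g.eval s = 0 := by
    filter_upwards [hI.mem_nhds ht₀] with s hs
    rw [← hg, polySpace_eq_zero_of_open hf hU hne (h0 s hs)]
  rw [hg, polynomial_eq_zero_of_eventually this]
  simp

theorem eval_stPoint_surjective (z : Option (Fin d) → ℝ) :
    z = stPoint (z none) (WithLp.toLp 2 fun i => z (some i)) := by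
  funext o
  cases o <;> simp

/-- A polynomial solution of the wave equation with zero Cauchy data at time `t₀` vanishes: the
equation expresses the time derivatives of order `k + 2` at `t₀` through those of order `k`. -/
theorem eq_zero_of_waveOp_eq_zero (hf : f ∈ polySpace d p) {c t₀ : ℝ} {I : Set ℝ}
    {U : Set (Space d)} (hI : IsOpen I) (hIne : I.Nonempty) (hU : IsOpen U) (hne : U.Nonempty)
    (hwave : ∀ t ∈ I, ∀ x ∈ U, waveOp c f t x = 0) (h0 : ∀ x ∈ U, f t₀ x = 0)
    (h1 : ∀ x ∈ U, deriv (fun s => f s x) t₀ = 0) : f = 0 := by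
  have h0' := polySpace_eq_zero_of_open hf hU hne h0
  have h1' := polySpace_eq_zero_of_open (polySpace_dt hf) hU hne h1
  obtain ⟨P, hP, h⟩ := hf
  set W : MvPolynomial (Option (Fin d)) ℝ := MvPolynomial.pderiv none (MvPolynomial.pderiv none P)
    - MvPolynomial.C c * ∑ i, MvPolynomial.pderiv (some i) (MvPolynomial.pderiv (some i) P)
    with hW
  have hWeval : ∀ t x, waveOp c f t x = MvPolynomial.eval (stPoint t x) W := by
    intro t x
    simp only [h, waveOp, divergence, hW]
    have e1 : (fun s => deriv (fun r => MvPolynomial.eval (stPoint r x) P) s) =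
        fun s => MvPolynomial.eval (stPoint s x) (MvPolynomial.pderiv none P) := by
      funext s
      exact (hasDerivAt_eval_time P s x).deriv
    have e2 : (fun y => c • gradient (fun z => MvPolynomial.eval (stPoint t z) P) y) =
        fun y => c • WithLp.toLp 2 fun i =>
          MvPolynomial.eval (stPoint t y) (MvPolynomial.pderiv (some i) P) := by
      funext y
      rw [(hasGradientAt_eval_space P t y).gradient]
    have e3 : HasFDerivAt (fun y : Space d => (WithLp.toLp 2 fun i =>
          MvPolynomial.eval (stPoint t y) (MvPolynomial.pderiv (some i) P) : Space d))
        ((PiLp.continuousLinearEquiv 2 ℝ (fun _ : Fin d => ℝ)).symm.toContinuousLinearMap.comp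
          (ContinuousLinearMap.pi fun i => InnerProductSpace.toDual ℝ (Space d)
          (WithLp.toLp 2 fun j => MvPolynomial.eval (stPoint t x)
            (MvPolynomial.pderiv (some j) (MvPolynomial.pderiv (some i) P))))) x := by
      refine (PiLp.continuousLinearEquiv 2 ℝ (fun _ : Fin d => ℝ)).symm.hasFDerivAt.comp x ?_
      rw [hasFDerivAt_pi]
      intro i
      exact (hasGradientAt_eval_space _ t x).hasFDerivAt
    rw [e1, e2, show fderiv ℝ (fun y : Space d => c • (WithLp.toLp 2 fun i =>
          MvPolynomial.eval (stPoint t y) (MvPolynomial.pderiv (some i) P) : Space d)) x = _ from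
        (e3.const_smul c).fderiv, (hasDerivAt_eval_time _ t x).deriv]
    simp [Finset.mul_sum, EuclideanSpace.inner_single_right]
  have hWpoly : (fun t x => MvPolynomial.eval (stPoint t x) W) ∈ polySpace d W.totalDegree :=
    ⟨W, le_rfl, fun _ _ => rfl⟩
  have hW0 : W = 0 := by
    refine MvPolynomial.funext fun z => ?_
    rw [eval_stPoint_surjective z, map_zero]
    refine polySpace_eq_zero_of_open_time hWpoly hI hIne hU hne (fun t ht x hx => ?_) _ _
    rw [← hWeval, hwave t ht x hx]
  -- spatial derivatives of a polynomial that vanishes at time `t₀` vanish at time `t₀`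
  have hspace : ∀ (Q : MvPolynomial (Option (Fin d)) ℝ) (i : Fin d),
      (∀ x : Space d, MvPolynomial.eval (stPoint t₀ x) Q = 0) →
      ∀ x : Space d, MvPolynomial.eval (stPoint t₀ x) (MvPolynomial.pderiv (some i) Q) = 0 := by
    intro Q i hQ x
    have e := (hasGradientAt_eval_space Q t₀ x).gradient
    simp only [hQ] at e
    have e' := congrArg (fun v : Space d => v i) e
    simpa [gradient] using e'.symm
  let D := fun Q : MvPolynomial (Option (Fin d)) ℝ => MvPolynomial.pderiv none Q
  have hDcomm : ∀ k Q i, D^[k] (MvPolynomial.pderiv (some i) Q) =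
      MvPolynomial.pderiv (some i) (D^[k] Q) := by
    intro k Q i
    induction k with
    | zero => rfl
    | succ k ih =>
      rw [Function.iterate_succ_apply', ih, Function.iterate_succ_apply']
      exact pderiv_pderiv_comm _ _ _
  have hDrec : ∀ k, D^[k + 2] P = MvPolynomial.C c *
      ∑ i, MvPolynomial.pderiv (some i) (MvPolynomial.pderiv (some i) (D^[k] P)) := by
    intro k
    have hD : ∀ Q, D^[k] Q = ((MvPolynomial.pderiv (R := ℝ) none).toLinearMap ^ k) Q := by
      intro Q
      rw [Module.End.pow_apply]
      rfl
    have e : D (D P) = MvPolynomial.C c *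
        ∑ i, MvPolynomial.pderiv (some i) (MvPolynomial.pderiv (some i) P) := sub_eq_zero.1 hW0
    rw [Function.iterate_add_apply, show D^[2] P = D (D P) from rfl, e, hD,
      ← MvPolynomial.smul_eq_C_mul, map_smul, map_sum, ← MvPolynomial.smul_eq_C_mul]
    simp only [← hD, hDcomm]
  have hall : ∀ k, (∀ x : Space d, MvPolynomial.eval (stPoint t₀ x) (D^[k] P) = 0) ∧
      ∀ x : Space d, MvPolynomial.eval (stPoint t₀ x) (D^[k + 1] P) = 0 := by
    intro k
    induction k with
    | zero =>
      refine ⟨fun x => by simpa [h] using h0' x, fun x => ?_⟩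
      have := h1' x
      simp only [h] at this
      rw [← this]
      exact (hasDerivAt_eval_time P t₀ x).deriv.symm
    | succ k ih =>
      refine ⟨ih.2, fun x => ?_⟩
      rw [hDrec, map_mul, map_sum, Finset.sum_eq_zero, mul_zero]
      intro i _
      exact hspace _ i (hspace _ i ih.1) x
  funext t x
  -- the polynomial `s ↦ f(s, x)` has vanishing Taylor coefficients at `t₀`
  let ψ : MvPolynomial (Option (Fin d)) ℝ →ₐ[ℝ] Polynomial ℝ :=
    MvPolynomial.aeval fun o => o.elim Polynomial.X fun i => Polynomial.C (x i)
  have hψ : ∀ Q s, (ψ Q).eval s = MvPolynomial.eval (stPoint s x) Q := by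
    intro Q s
    rw [eval_aeval_polynomial]
    congr 2
    funext o
    cases o <;> simp
  have hder : ∀ Q, Polynomial.derivative (ψ Q) = ψ (D Q) := by
    intro Q
    refine Polynomial.funext fun s => ?_
    rw [hψ, ← (hasDerivAt_eval_time Q s x).deriv, ← Polynomial.deriv]
    simp only [hψ]
  have hiter : ∀ k, Polynomial.derivative^[k] (ψ P) = ψ (D^[k] P) := by
    intro k
    induction k with
    | zero => rfl
    | succ k ih => rw [Function.iterate_succ_apply', ih, hder, Function.iterate_succ_apply']
  have hzero : ψ P = 0 := by
    refine Polynomial.eq_zero_of_hasseDeriv_eq_zero _ t₀ fun k => ?_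
    have e := congrFun (Polynomial.factorial_smul_hasseDeriv (R := ℝ) k) (ψ P)
    have e2 := congrArg (Polynomial.eval t₀) e
    simp only [hiter, hψ, (hall k).1 x] at e2
    simpa [Nat.factorial_ne_zero] using e2
  rw [h, ← hψ, hzero]
  simp

end PolynomialCalculus

section Polytopes

/-! ### Open polyhedra -/

variable {d : ℕ}

/-- `P` is the open polyhedron cut out by the finite set `H` of open half-spaces `⟪ν, x⟫ < b`, given
by pairs `(ν, b)` with a unit vector `ν`. As `H` is a set, no half-space is listed twice, so that
different members of `H` have different boundary hyperplanes as soon as `P` is nonempty. -/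
structure IsPolyhedron (P : Set (Space d)) (H : Finset (Space d × ℝ)) : Prop where
  unit : ∀ h ∈ H, ‖h.1‖ = 1
  eq : P = {x | ∀ h ∈ H, inner ℝ h.1 x < h.2}

theorem IsPolyhedron.mem {P : Set (Space d)} {H : Finset (Space d × ℝ)} (hP : IsPolyhedron P H)
    {x : Space d} : x ∈ P ↔ ∀ h ∈ H, inner ℝ h.1 x < h.2 := by
  rw [hP.eq]; rfl

open scoped Classical in
theorem IsPolyhedron.inter {P P' : Set (Space d)} {H H' : Finset (Space d × ℝ)}
    (hP : IsPolyhedron P H) (hP' : IsPolyhedron P' H') : IsPolyhedron (P ∩ P') (H ∪ H') where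
  unit h hh := (Finset.mem_union.1 hh).elim (hP.unit h) (hP'.unit h)
  eq := by
    ext x
    simp only [mem_inter_iff, hP.mem, hP'.mem, mem_ofPred_eq, Finset.mem_union]
    exact ⟨fun h k hk => hk.elim (h.1 k) (h.2 k),
      fun h => ⟨fun k hk => h k (Or.inl hk), fun k hk => h k (Or.inr hk)⟩⟩

theorem IsPolyhedron.isOpen {P : Set (Space d)} {H : Finset (Space d × ℝ)}
    (hP : IsPolyhedron P H) : IsOpen P := by
  have : P = ⋂ h ∈ H, {x | inner ℝ h.1 x < h.2} := by
    ext x; simp [hP.mem]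
  rw [this]
  exact isOpen_biInter_finset fun h _ => isOpen_lt (by fun_prop) continuous_const

theorem IsPolyhedron.convex {P : Set (Space d)} {H : Finset (Space d × ℝ)}
    (hP : IsPolyhedron P H) : Convex ℝ P := by
  have : P = ⋂ h ∈ H, {x | inner ℝ h.1 x < h.2} := by
    ext x; simp [hP.mem]
  rw [this]
  exact convex_iInter₂ fun h _ => convex_halfSpace_lt (innerₛₗ ℝ h.1).isLinear h.2

theorem IsPolyhedron.inner_le_of_mem_closure {P : Set (Space d)} {H : Finset (Space d × ℝ)}
    (hP : IsPolyhedron P H) {x : Space d} (hx : x ∈ closure P) {h : Space d × ℝ} (hh : h ∈ H) :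
    inner ℝ h.1 x ≤ h.2 :=
  closure_minimal (t := {x | inner ℝ h.1 x ≤ h.2}) (fun y hy => (hP.mem.1 hy h hh).le)
    (isClosed_le (by fun_prop) continuous_const) hx

theorem IsPolyhedron.exists_eq_of_mem_frontier {P : Set (Space d)} {H : Finset (Space d × ℝ)}
    (hP : IsPolyhedron P H) {x : Space d} (hx : x ∈ frontier P) : ∃ h ∈ H, inner ℝ h.1 x = h.2 := by
  rw [hP.isOpen.frontier_eq] at hx
  have := hx.2
  rw [hP.mem] at this
  push Not at this
  obtain ⟨h, hh, hle⟩ := this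
  exact ⟨h, hh, le_antisymm (hP.inner_le_of_mem_closure hx.1 hh) hle⟩

theorem exists_isPolyhedron_of_affineMap {ι : Type*} [Fintype ι] (L : ι → Space d →ᵃ[ℝ] ℝ)
    (hL : ∀ i, ∃ x y, L i x ≠ L i y) :
    ∃ H, IsPolyhedron {x | ∀ i, 0 < L i x} H := by
  classical
  let g : ι → Space d := fun i =>
    (InnerProductSpace.toDual ℝ (Space d)).symm (LinearMap.toContinuousLinearMap (L i).linear)
  have hg : ∀ i x, L i x = inner ℝ (g i) x + L i 0 := by
    intro i x
    have h1 : inner ℝ (g i) x = (L i).linear x := by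
      simp [g, InnerProductSpace.toDual_symm_apply]
    have h2 := (L i).linearMap_vsub x 0
    simp only [vsub_eq_sub, sub_zero] at h2
    rw [h1, h2]; ring
  have hg0 : ∀ i, 0 < ‖g i‖ := by
    intro i
    rw [norm_pos_iff]
    intro h0
    obtain ⟨x, y, hxy⟩ := hL i
    exact hxy (by rw [hg i x, hg i y, h0]; simp)
  refine ⟨Finset.univ.image fun i => (-(‖g i‖⁻¹ • g i), ‖g i‖⁻¹ * L i 0), ?_, ?_⟩
  · intro h hh
    obtain ⟨i, -, rfl⟩ := Finset.mem_image.1 hh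
    simp [norm_smul, (hg0 i).ne']
  · ext x
    simp only [mem_ofPred_eq, Finset.mem_image, Finset.mem_univ, true_and, forall_exists_index,
      forall_apply_eq_imp_iff]
    refine forall_congr' fun i => ?_
    have hi : 0 < ‖g i‖⁻¹ := inv_pos.2 (hg0 i)
    rw [hg i x, inner_neg_left, real_inner_smul_left]
    constructor
    · intro h; nlinarith
    · intro h
      have : 0 < ‖g i‖⁻¹ * (inner ℝ (g i) x + L i 0) := by linarith
      exact (mul_pos_iff_of_pos_left hi).1 this

theorem IsElement.exists_isPolyhedron (hd : 1 ≤ d) {K : Set (Space d)} (hK : IsElement K) :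
    (∃ H, IsPolyhedron K H) ∧ K.Nonempty ∧ Bornology.IsBounded K := by
  rcases hK with ⟨P, hP, rfl⟩ | ⟨f, rfl⟩
  · let b : AffineBasis (Fin (d + 1)) ℝ (Space d) := ⟨P, hP, by
      rw [hP.affineSpan_eq_top_iff_card_eq_finrank_add_one]; simp⟩
    have hb : interior (convexHull ℝ (range P)) = {x | ∀ i, 0 < b.coord i x} :=
      b.interior_convexHull
    refine ⟨?_, ⟨_, b.centroid_mem_interior_convexHull⟩,
      (isBounded_convexHull.2 (finite_range P).isBounded).subset interior_subset⟩
    rw [hb]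
    refine exists_isPolyhedron_of_affineMap _ fun i => ?_
    have : Nontrivial (Fin (d + 1)) := Fin.nontrivial_iff_two_le.2 (by omega)
    obtain ⟨j, hj⟩ := exists_ne i
    exact ⟨b i, b j, by rw [b.coord_apply_eq, b.coord_apply_ne hj.symm]; exact one_ne_zero⟩
  · have hf : Continuous f := f.toAffineMap.continuous_of_finiteDimensional
    refine ⟨?_, ⟨f (WithLp.toLp 2 fun _ => 1 / 2), mem_image_of_mem _ fun i => by norm_num⟩, ?_⟩
    · have h : f '' {x | ∀ i, 0 < x i ∧ x i < 1} = {x | ∀ j : Fin d ⊕ Fin d,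
          0 < (Sum.elim (fun i => ((EuclideanSpace.proj (𝕜 := ℝ) i).toLinearMap.toAffineMap.comp
            f.symm.toAffineMap : Space d →ᵃ[ℝ] ℝ))
          (fun i => AffineMap.const ℝ (Space d) (1 : ℝ) -
            ((EuclideanSpace.proj (𝕜 := ℝ) i).toLinearMap.toAffineMap.comp
              f.symm.toAffineMap : Space d →ᵃ[ℝ] ℝ)) j) x} := by
        ext x
        have : x ∈ f '' {x | ∀ i, 0 < x i ∧ x i < 1} ↔
            f.symm x ∈ {x : Space d | ∀ i, 0 < x i ∧ x i < 1} := by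
          constructor
          · rintro ⟨y, hy, rfl⟩
            simpa using hy
          · intro h
            exact ⟨_, h, f.apply_symm_apply x⟩
        rw [this]
        simp [Sum.forall, forall_and]
      rw [h]
      refine exists_isPolyhedron_of_affineMap _ ?_
      rintro (i | i)
      · exact ⟨f 0, f (EuclideanSpace.single i 1), by simp⟩
      · exact ⟨f 0, f (EuclideanSpace.single i 1), by simp⟩
    · have hc : IsCompact {x : Space d | ∀ i, 0 ≤ x i ∧ x i ≤ 1} := by
        have : {x : Space d | ∀ i, 0 ≤ x i ∧ x i ≤ 1} =
            (PiLp.homeomorph 2 (fun _ : Fin d => ℝ)) ⁻¹' (Set.pi univ fun _ => Icc 0 1) := by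
          ext x; simp only [mem_preimage, Set.mem_pi, mem_univ, true_imp_iff, mem_Icc]; rfl
        rw [this]
        exact (PiLp.homeomorph 2 (fun _ : Fin d => ℝ)).isCompact_preimage.2
          (isCompact_univ_pi fun _ => isCompact_Icc)
      exact (hc.image hf).isBounded.subset
        (image_mono fun x hx i => ⟨(hx i).1.le, (hx i).2.le⟩)

/-! ### The surface measure on hyperplanes -/

/-- The parametrization of the hyperplane `⟪ν, x⟫ = b` by the orthogonal complement of `ν`. -/
def hyperplaneMap (ν : Space d) (b : ℝ) (z : (ℝ ∙ ν)ᗮ) : Space d := z + b • ν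

theorem isometry_hyperplaneMap (ν : Space d) (b : ℝ) : Isometry (hyperplaneMap ν b) :=
  Isometry.of_dist_eq fun z w => by simp [hyperplaneMap, Subtype.dist_eq]

theorem inner_hyperplaneMap {ν : Space d} (hν : ‖ν‖ = 1) (b : ℝ) (z : (ℝ ∙ ν)ᗮ) :
    inner ℝ ν (hyperplaneMap ν b z) = b := by
  have : inner ℝ ν (z : Space d) = 0 :=
    Submodule.mem_orthogonal_singleton_iff_inner_right.1 z.2
  simp [hyperplaneMap, inner_add_right, this, real_inner_smul_right, hν]

theorem range_hyperplaneMap {ν : Space d} (hν : ‖ν‖ = 1) (b : ℝ) :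
    range (hyperplaneMap ν b) = {x | inner ℝ ν x = b} := by
  ext x
  constructor
  · rintro ⟨z, rfl⟩
    exact inner_hyperplaneMap hν b z
  · intro hx
    refine ⟨⟨x - b • ν, ?_⟩, by simp [hyperplaneMap]⟩
    rw [Submodule.mem_orthogonal_singleton_iff_inner_right, inner_sub_right,
      real_inner_smul_right, real_inner_self_eq_norm_sq, hν, show inner ℝ ν x = b from hx]
    ring

theorem finrank_orthogonal_span {ν : Space d} (hν : ‖ν‖ = 1) :
    Module.finrank ℝ (ℝ ∙ ν)ᗮ = d - 1 := by
  have h0 : ν ≠ 0 := by rintro rfl; simp at hν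
  have h := (ℝ ∙ ν).finrank_add_finrank_orthogonal
  rw [finrank_span_singleton h0, finrank_euclideanSpace, Fintype.card_fin] at h
  omega

/-- Surface measure on a hyperplane is Lebesgue measure in orthonormal coordinates. -/
theorem map_hyperplaneMap_volume {ν : Space d} (hν : ‖ν‖ = 1) (b : ℝ) :
    (volume : Measure (ℝ ∙ ν)ᗮ).map (hyperplaneMap ν b) =
      (surf d).restrict {x | inner ℝ ν x = b} := by
  rw [← range_hyperplaneMap hν b, surf,
    ← (isometry_hyperplaneMap ν b).map_euclideanHausdorffMeasure,
    ← finrank_orthogonal_span hν, InnerProductSpace.euclideanHausdorffMeasure_eq_volume]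

theorem measurableSet_hyperplane (ν : Space d) (b : ℝ) :
    MeasurableSet {x : Space d | inner ℝ ν x = b} :=
  (isClosed_eq (by fun_prop) continuous_const).measurableSet

theorem surf_hyperplane_inter {ν : Space d} (hν : ‖ν‖ = 1) (b : ℝ) {A : Set (Space d)}
    (hA : MeasurableSet A) :
    surf d (A ∩ {x | inner ℝ ν x = b}) = volume (hyperplaneMap ν b ⁻¹' A) := by
  rw [← Measure.restrict_apply hA, ← map_hyperplaneMap_volume hν,
    Measure.map_apply (isometry_hyperplaneMap ν b).continuous.measurable hA]

theorem surf_hyperplane_inter_lt_top {ν : Space d} (hν : ‖ν‖ = 1) (b : ℝ) {A : Set (Space d)}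
    (hA : Bornology.IsBounded A) : surf d (A ∩ {x | inner ℝ ν x = b}) < ⊤ := by
  obtain ⟨r, hr⟩ := hA.subset_closedBall 0
  refine (measure_mono (inter_subset_inter_left _ hr)).trans_lt ?_
  rw [surf_hyperplane_inter hν b Metric.isClosed_closedBall.measurableSet]
  exact ((isometry_hyperplaneMap ν b).antilipschitz.isBounded_preimage
    Metric.isBounded_closedBall).measure_lt_top

/-- Two different hyperplanes of the description of a nonempty polyhedron meet in a set of surface
measure zero. -/
theorem IsPolyhedron.surf_inter_eq_zero {P : Set (Space d)} {H : Finset (Space d × ℝ)}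
    (hP : IsPolyhedron P H) (hne : P.Nonempty) {h k : Space d × ℝ} (hh : h ∈ H) (hk : k ∈ H)
    (hhk : h ≠ k) : surf d ({x | inner ℝ k.1 x = k.2} ∩ {x | inner ℝ h.1 x = h.2}) = 0 := by
  rw [surf_hyperplane_inter (hP.unit h hh) h.2 (measurableSet_hyperplane _ _)]
  obtain ⟨x₀, hx₀⟩ := hne
  -- the affine function `⟪k, ·⟫ - b_k` on the hyperplane of `h`
  let L : (ℝ ∙ h.1)ᗮ →ᵃ[ℝ] ℝ :=
    ((innerₛₗ ℝ k.1).comp (ℝ ∙ h.1)ᗮ.subtype).toAffineMap +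
      AffineMap.const ℝ _ (h.2 * inner ℝ k.1 h.1)
  have hL : ∀ z, L z = inner ℝ k.1 (hyperplaneMap h.1 h.2 z) := by
    intro z
    simp [L, hyperplaneMap, inner_add_right, real_inner_smul_right]
  let S : AffineSubspace ℝ (ℝ ∙ h.1)ᗮ := (AffineSubspace.mk' k.2 (⊥ : Submodule ℝ ℝ)).comap L
  have hS : hyperplaneMap h.1 h.2 ⁻¹' {x | inner ℝ k.1 x = k.2} = S := by
    ext z
    simp [S, ← hL, sub_eq_zero]
  rw [hS]
  refine Measure.addHaar_affineSubspace _ _ fun htop => ?_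
  -- otherwise the hyperplane of `h` lies in that of `k`, so that `k = ± h`
  have hall : ∀ z, inner ℝ k.1 (hyperplaneMap h.1 h.2 z) = k.2 := by
    intro z
    have : z ∈ hyperplaneMap h.1 h.2 ⁻¹' {x | inner ℝ k.1 x = k.2} := by
      rw [hS, htop]; trivial
    exact this
  have hk0 : h.2 * inner ℝ k.1 h.1 = k.2 := by
    simpa [hyperplaneMap, real_inner_smul_right] using hall 0
  have horth : k.1 ∈ ((ℝ ∙ h.1)ᗮ)ᗮ := by
    rw [Submodule.mem_orthogonal']
    intro u hu
    have := hall ⟨u, hu⟩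
    simp only [hyperplaneMap, inner_add_right, real_inner_smul_right] at this
    linarith
  rw [Submodule.orthogonal_orthogonal, Submodule.mem_span_singleton] at horth
  obtain ⟨c, hc⟩ := horth
  have hu := hP.unit h hh
  have hu' := hP.unit k hk
  have hc1 : |c| = 1 := by
    rw [← hc, norm_smul, hu] at hu'
    simpa using hu'
  have hk2 : h.2 * c = k.2 := by
    rw [← hk0, ← hc, real_inner_smul_left, real_inner_self_eq_norm_sq, hu]; ring
  rcases (abs_eq zero_le_one).1 hc1 with rfl | rfl
  · exact hhk (Prod.ext (by simpa using hc) (by simpa using hk2))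
  · have h1 := hP.mem.1 hx₀ h hh
    have h2 := hP.mem.1 hx₀ k hk
    rw [← hc, ← hk2, real_inner_smul_left] at h2
    linarith

end Polytopes

section Flat

/-! ### Flat boundary points and outward normals -/

variable {d : ℕ}

/-- Near `x`, the set `K` is the open half-space with outward unit normal `ν` and boundary
through `x`. -/
def IsFlatAt (K : Set (Space d)) (x ν : Space d) : Prop :=
  ‖ν‖ = 1 ∧ ∀ᶠ y in 𝓝 x, (y ∈ K ↔ inner ℝ ν (y - x) < 0)

/-- Membership of the points `x + s z`, for small `s > 0`, in a set that is flat at `x`. -/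
theorem IsFlatAt.eventually_ray {K : Set (Space d)} {x ν : Space d} (h : IsFlatAt K x ν)
    (z : Space d) : ∀ᶠ s in 𝓝[>] (0 : ℝ), (x + s • z ∈ K ↔ inner ℝ ν z < 0) := by
  have hc : Tendsto (fun s : ℝ => x + s • z) (𝓝[>] 0) (𝓝 x) := by
    have : Continuous fun s : ℝ => x + s • z := by fun_prop
    simpa using (this.tendsto 0).mono_left nhdsWithin_le_nhds
  filter_upwards [hc.eventually h.2, self_mem_nhdsWithin] with s hs (hs0 : 0 < s)
  rw [hs, add_sub_cancel_left, real_inner_smul_right]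
  exact ⟨fun h => by nlinarith, fun h => by nlinarith⟩

theorem IsFlatAt.mem_closure {K : Set (Space d)} {x ν : Space d} (h : IsFlatAt K x ν) :
    x ∈ closure K := by
  have hc : Tendsto (fun s : ℝ => x + s • (-ν)) (𝓝[>] 0) (𝓝 x) := by
    have : Continuous fun s : ℝ => x + s • (-ν) := by fun_prop
    simpa using (this.tendsto 0).mono_left nhdsWithin_le_nhds
  refine mem_closure_of_tendsto hc ?_
  filter_upwards [h.eventually_ray (-ν)] with s hs
  rw [hs, inner_neg_right, real_inner_self_eq_norm_sq, h.1]
  norm_num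

theorem inner_lt_one_of_ne {μ ν : Space d} (hμ : ‖μ‖ = 1) (hν : ‖ν‖ = 1) (h : μ ≠ ν) :
    inner ℝ μ ν < 1 := (inner_lt_one_iff_real_of_norm_eq_one hμ hν).2 h

theorem outwardNormal_eq_of_isFlatAt {K : Set (Space d)} {x ν : Space d} (hK : IsOpen K)
    (hc : Convex ℝ K) (h : IsFlatAt K x ν) : outwardNormal K x = ν := by
  have hle : ∀ y ∈ K, inner ℝ ν (y - x) ≤ 0 := by
    intro y hy
    have h1 : ∀ᶠ s in 𝓝[>] (0 : ℝ), s < 1 := nhdsWithin_le_nhds (eventually_lt_nhds one_pos)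
    obtain ⟨s, hs, hs1, hs0⟩ := ((h.eventually_ray (y - x)).and
      (h1.and self_mem_nhdsWithin)).exists
    have hs0' : (0 : ℝ) < s := hs0
    refine (hs.1 ?_).le
    have := hc.combo_closure_interior_mem_interior h.mem_closure
      (by rwa [hK.interior_eq]) (a := 1 - s) (b := s) (by linarith) hs0 (by ring)
    rw [hK.interior_eq] at this
    convert this using 1
    module
  have huniq : ∀ μ : Space d, (‖μ‖ = 1 ∧ ∀ y ∈ K, inner ℝ μ (y - x) ≤ 0) → μ = ν := by
    rintro μ ⟨hμ, hμle⟩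
    by_contra hne
    have hlt := inner_lt_one_of_ne hμ h.1 hne
    -- the direction `μ - ν` points into `K`, and out of the half-space of `μ`
    obtain ⟨s, hs, hs0⟩ := ((h.eventually_ray (μ - ν)).and self_mem_nhdsWithin).exists
    have hs0' : (0 : ℝ) < s := hs0
    have h1 : x + s • (μ - ν) ∈ K := by
      rw [hs, inner_sub_right, real_inner_self_eq_norm_sq, h.1, real_inner_comm]
      linarith
    have h2 := hμle _ h1
    rw [add_sub_cancel_left, real_inner_smul_right, inner_sub_right, real_inner_self_eq_norm_sq,
      hμ] at h2
    nlinarith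
  have hex : ∃! ν : Space d, ‖ν‖ = 1 ∧ ∀ y ∈ K, inner ℝ ν (y - x) ≤ 0 := ⟨ν, ⟨h.1, hle⟩, huniq⟩
  rw [outwardNormal, dif_pos hex]
  exact huniq _ hex.choose_spec.1

theorem norm_outwardNormal_le (K : Set (Space d)) (x : Space d) : ‖outwardNormal K x‖ ≤ 1 := by
  unfold outwardNormal
  split_ifs with h
  · exact h.choose_spec.1.1.le
  · simp

/-- Disjoint sets that are both flat at a point have opposite normals there. -/
theorem IsFlatAt.normal_eq_neg {K K' : Set (Space d)} {x ν ν' : Space d} (h : IsFlatAt K x ν)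
    (h' : IsFlatAt K' x ν') (hd : Disjoint K K') : ν' = -ν := by
  by_contra hne
  have hlt : inner ℝ ν (-ν') < 1 := inner_lt_one_of_ne h.1 (by rw [norm_neg, h'.1]) (by
    rintro rfl; simp at hne)
  rw [inner_neg_right] at hlt
  obtain ⟨s, hs, hs'⟩ := ((h.eventually_ray (-(ν + ν'))).and
    (h'.eventually_ray (-(ν + ν')))).exists
  refine disjoint_left.1 hd (hs.2 ?_) (hs'.2 ?_)
  · rw [inner_neg_right, inner_add_right, real_inner_self_eq_norm_sq, h.1]; linarith
  · rw [inner_neg_right, inner_add_right, real_inner_self_eq_norm_sq, h'.1, real_inner_comm]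
    linarith

theorem IsPolyhedron.isFlatAt {P : Set (Space d)} {H : Finset (Space d × ℝ)}
    (hP : IsPolyhedron P H) {x : Space d} {h : Space d × ℝ} (hh : h ∈ H)
    (hx : inner ℝ h.1 x = h.2) (hlt : ∀ k ∈ H, k ≠ h → inner ℝ k.1 x < k.2) :
    IsFlatAt P x h.1 := by
  refine ⟨hP.unit h hh, ?_⟩
  have : ∀ᶠ y in 𝓝 x, ∀ k ∈ H, k ≠ h → inner ℝ k.1 y < k.2 := by
    rw [Filter.eventually_all_finset]
    intro k hk
    by_cases hkh : k = h
    · simp [hkh]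
    · have hc : Continuous fun y : Space d => inner ℝ k.1 y := by fun_prop
      filter_upwards [hc.continuousAt.eventually_lt continuousAt_const (hlt k hk hkh)] with y hy _
      exact hy
  filter_upwards [this] with y hy
  rw [hP.mem, inner_sub_right, hx]
  constructor
  · intro h1; linarith [h1 h hh]
  · intro h1 k hk
    by_cases hkh : k = h
    · subst hkh; linarith
    · exact hy k hk hkh

theorem IsPolyhedron.ae_mem_one_face {P : Set (Space d)} {H : Finset (Space d × ℝ)}
    (hP : IsPolyhedron P H) (hne : P.Nonempty) : ∀ᵐ x ∂surf d, x ∈ frontier P →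
      ∃ h ∈ H, inner ℝ h.1 x = h.2 ∧ ∀ k ∈ H, k ≠ h → inner ℝ k.1 x < k.2 := by
  have hae : ∀ᵐ x ∂surf d, ∀ h ∈ H, ∀ k ∈ H, h ≠ k →
      ¬ (inner ℝ k.1 x = k.2 ∧ inner ℝ h.1 x = h.2) := by
    rw [Finset.eventually_all]
    intro h hh
    rw [Finset.eventually_all]
    intro k hk
    by_cases hhk : h = k
    · simp [hhk]
    · have := hP.surf_inter_eq_zero hne hh hk hhk
      filter_upwards [measure_eq_zero_iff_ae_notMem.1 this] with x hx _
      exact hx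
  filter_upwards [hae] with x hx hxP
  obtain ⟨h, hh, hxh⟩ := hP.exists_eq_of_mem_frontier hxP
  refine ⟨h, hh, hxh, fun k hk hkh => ?_⟩
  refine lt_of_le_of_ne (hP.inner_le_of_mem_closure (frontier_subset_closure hxP) hk) fun hxk => ?_
  exact hx h hh k hk (Ne.symm hkh) ⟨hxk, hxh⟩

theorem IsPolyhedron.ae_isFlatAt {P : Set (Space d)} {H : Finset (Space d × ℝ)}
    (hP : IsPolyhedron P H) (hne : P.Nonempty) :
    ∀ᵐ x ∂surf d, x ∈ frontier P → ∃ ν, IsFlatAt P x ν := by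
  filter_upwards [hP.ae_mem_one_face hne] with x hx hxP
  obtain ⟨h, hh, h1, h2⟩ := hx hxP
  exact ⟨h.1, hP.isFlatAt hh h1 h2⟩

theorem IsPolyhedron.surf_frontier_lt_top {P : Set (Space d)} {H : Finset (Space d × ℝ)}
    (hP : IsPolyhedron P H) (hb : Bornology.IsBounded P) : surf d (frontier P) < ⊤ := by
  have hsub : frontier P ⊆ ⋃ h ∈ H, frontier P ∩ {x | inner ℝ h.1 x = h.2} := by
    intro x hx
    obtain ⟨h, hh, hxh⟩ := hP.exists_eq_of_mem_frontier hx
    exact mem_iUnion₂.2 ⟨h, hh, hx, hxh⟩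
  refine (measure_mono hsub).trans_lt ((measure_biUnion_finset_le _ _).trans_lt ?_)
  refine ENNReal.sum_lt_top.2 fun h hh => ?_
  exact surf_hyperplane_inter_lt_top (hP.unit h hh) _ (hb.closure.subset frontier_subset_closure)

theorem IsPolyhedron.aestronglyMeasurable_outwardNormal {P : Set (Space d)}
    {H : Finset (Space d × ℝ)} (hP : IsPolyhedron P H) (hne : P.Nonempty) :
    AEStronglyMeasurable (outwardNormal P) ((surf d).restrict (frontier P)) := by
  classical
  refine ⟨fun x => ∑ h ∈ H, {x : Space d | inner ℝ h.1 x = h.2}.indicator (fun _ => h.1) x, ?_, ?_⟩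
  · exact Finset.stronglyMeasurable_fun_sum _ fun h _ =>
      stronglyMeasurable_const.indicator (measurableSet_hyperplane _ _)
  · rw [Filter.EventuallyEq, ae_restrict_iff' isClosed_frontier.measurableSet]
    filter_upwards [hP.ae_mem_one_face hne] with x hx hxP
    obtain ⟨h, hh, h1, h2⟩ := hx hxP
    rw [outwardNormal_eq_of_isFlatAt hP.isOpen hP.convex (hP.isFlatAt hh h1 h2),
      Finset.sum_eq_single_of_mem h hh]
    · rw [indicator_of_mem]; exact h1
    · intro k hk hkh
      rw [indicator_of_notMem]
      exact fun h => (h2 k hk hkh).ne h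

/-- The boundary of a bounded set with interior points has positive surface measure: it projects
onto a set with interior points in a hyperplane. -/
theorem surf_frontier_ne_zero (hd : 1 ≤ d) {F : Set (Space d)} (hb : Bornology.IsBounded F)
    (hne : (interior F).Nonempty) : surf d (frontier F) ≠ 0 := by
  obtain ⟨ν, hν⟩ : ∃ ν : Space d, ‖ν‖ = 1 := ⟨EuclideanSpace.single ⟨0, hd⟩ 1, by simp⟩
  have hν0 : ν ≠ 0 := by rintro rfl; simp at hν
  let π := (ℝ ∙ ν)ᗮ.orthogonalProjectionOnto
  intro h0
  have hlip : LipschitzWith 1 π := by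
    refine LipschitzWith.of_dist_le_mul fun x y => ?_
    rw [dist_eq_norm, dist_eq_norm, ← map_sub]
    rw [NNReal.coe_one, one_mul]
    exact (ℝ ∙ ν)ᗮ.norm_orthogonalProjectionOnto_apply_le (x - y)
  have hvol : volume (π '' frontier F) = 0 := by
    rw [← InnerProductSpace.euclideanHausdorffMeasure_eq_volume, finrank_orthogonal_span hν,
      Measure.euclideanHausdorffMeasure_def, Measure.smul_apply]
    rw [surf, Measure.euclideanHausdorffMeasure_def, Measure.smul_apply] at h0
    have h1 := hlip.hausdorffMeasure_image_le (d := ((d - 1 : ℕ) : ℝ)) (by positivity) (frontier F)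
    rw [smul_eq_zero] at h0 ⊢
    refine h0.imp_right fun h => le_antisymm (h1.trans ?_) zero_le
    simp [h]
  have hopen : IsOpen (π '' interior F) := by
    refine (ContinuousLinearMap.isOpenMap π fun z => ⟨z, ?_⟩) _ isOpen_interior
    simp [π]
  have hsub : π '' interior F ⊆ π '' frontier F := by
    rintro _ ⟨x, hx, rfl⟩
    -- follow the line through `x` in the direction of `ν` until it leaves `F`
    let S : Set ℝ := {t | x + t • ν ∈ F}
    obtain ⟨r, hr⟩ := hb.subset_closedBall x
    have hline : Continuous fun t : ℝ => x + t • ν := by fun_prop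
    have hnot : (|r| + 1) ∉ S := by
      intro h
      have := hr h
      rw [Metric.mem_closedBall, dist_eq_norm, add_sub_cancel_left, norm_smul, hν, mul_one,
        Real.norm_eq_abs, abs_of_pos (by positivity)] at this
      linarith [le_abs_self r]
    have hmem : (0 : ℝ) ∈ S := by simpa [S] using interior_subset hx
    have hfr : (frontier S).Nonempty := by
      rw [nonempty_iff_ne_empty]
      intro h
      rcases isClopen_iff.1 (isClopen_iff_frontier_eq_empty.2 h) with h | h
      · rw [h] at hmem; exact hmem
      · rw [h] at hnot; exact hnot trivial
    obtain ⟨t, ht⟩ := hfr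
    refine ⟨x + t • ν, hline.frontier_preimage_subset F ht, ?_⟩
    have : π ν = 0 := by
      simp [π, Submodule.orthogonalProjectionOnto_eq_zero_iff]
    rw [map_add, map_smul, this, smul_zero, add_zero]
  exact (hopen.measure_pos volume (hne.image π)).ne' (measure_mono_null hsub hvol)

end Flat

section Trace

/-! ### The trace inequality on polyhedra -/

variable {d : ℕ}

theorem lintegral_eq_smul {E : Type*} [NormedAddCommGroup E] [NormedSpace ℝ E] [MeasurableSpace E]
    [BorelSpace E] [FiniteDimensional ℝ E] (μ : Measure E) [μ.IsAddHaarMeasure] {r : ℝ} (hr : 0 < r)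
    {g : E → ENNReal} (hg : Measurable g) :
    ∫⁻ x, g x ∂μ = ENNReal.ofReal (r ^ Module.finrank ℝ E) * ∫⁻ x, g (r • x) ∂μ := by
  rw [← lintegral_map (f := g) hg (measurable_const_smul r), Measure.map_addHaar_smul μ hr.ne',
    lintegral_smul_measure, smul_eq_mul, ← mul_assoc, ← ENNReal.ofReal_mul (by positivity),
    abs_of_pos (by positivity), mul_inv_cancel₀ (by positivity), ENNReal.ofReal_one, one_mul]

/-- Orthonormal coordinates with origin `x₀` and one axis in the direction of `ν`. -/
theorem measurePreserving_normal_coordinates {ν : Space d} (hν : ‖ν‖ = 1) (x₀ : Space d) :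
    MeasurePreserving (fun q : ℝ × (ℝ ∙ ν)ᗮ => x₀ + (q.1 • ν + (q.2 : Space d)))
      volume volume := by
  have h1 := ((ℝ ∙ ν).measurePreserving_measurableEquivProd x₀).symm
  rw [InnerProductSpace.euclideanHausdorffMeasure_eq_volume] at h1
  have h2 : MeasurePreserving (Prod.map (LinearIsometryEquiv.toSpanUnitSingleton ν hν)
      (id : (ℝ ∙ ν)ᗮ → (ℝ ∙ ν)ᗮ)) volume volume :=
    (LinearIsometryEquiv.measurePreserving (LinearIsometryEquiv.toSpanUnitSingleton ν hν)).prod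
      (MeasurePreserving.id volume)
  have h3 : (fun q : ℝ × (ℝ ∙ ν)ᗮ => x₀ + (q.1 • ν + (q.2 : Space d))) =
      ((ℝ ∙ ν).measurableEquivProd x₀).symm ∘
        Prod.map (LinearIsometryEquiv.toSpanUnitSingleton ν hν) id := by
    funext q
    simp [add_comm]
  rw [h3]
  exact h1.comp h2

theorem map_add_volume {ν : Space d} (hν : ‖ν‖ = 1) (y₀ : Space d) :
    (volume : Measure (ℝ ∙ ν)ᗮ).map (fun z : (ℝ ∙ ν)ᗮ => y₀ + (z : Space d)) =
      (surf d).restrict {x | inner ℝ ν x = inner ℝ ν y₀} := by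
  let w : (ℝ ∙ ν)ᗮ := ⟨y₀ - inner ℝ ν y₀ • ν, by
    rw [Submodule.mem_orthogonal_singleton_iff_inner_right, inner_sub_right, real_inner_smul_right,
      real_inner_self_eq_norm_sq, hν]
    ring⟩
  have h : (fun z : (ℝ ∙ ν)ᗮ => y₀ + (z : Space d)) =
      hyperplaneMap ν (inner ℝ ν y₀) ∘ fun z => z + w := by
    funext z
    simp only [hyperplaneMap, Function.comp_apply, Submodule.coe_add, w]
    abel
  rw [h, ← Measure.map_map (isometry_hyperplaneMap _ _).continuous.measurable (by fun_prop),
    map_add_right_eq_self, map_hyperplaneMap_volume hν]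

/-- Integration over the cone with apex `x₀` over a set in a hyperplane at distance `τ₀`, fibred by
the rays from `x₀`. -/
theorem lintegral_slab_eq {ν : Space d} (hν : ‖ν‖ = 1) (x₀ : Space d) {τ₀ : ℝ} (hτ : 0 < τ₀)
    {g : Space d → ENNReal} (hg : Measurable g)
    (hg0 : ∀ x, ¬ (0 < inner ℝ ν (x - x₀) ∧ inner ℝ ν (x - x₀) < τ₀) → g x = 0) :
    ∫⁻ x, g x = ∫⁻ t in Ioo (0 : ℝ) 1, ENNReal.ofReal (τ₀ * t ^ (d - 1)) *
      ∫⁻ z : (ℝ ∙ ν)ᗮ, g (x₀ + t • (τ₀ • ν + (z : Space d))) := by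
  have hin : ∀ (τ : ℝ) (z : (ℝ ∙ ν)ᗮ), inner ℝ ν (x₀ + (τ • ν + (z : Space d)) - x₀) = τ := by
    intro τ z
    have : inner ℝ ν (z : Space d) = 0 :=
      Submodule.mem_orthogonal_singleton_iff_inner_right.1 z.2
    rw [add_sub_cancel_left, inner_add_right, this, real_inner_smul_right,
      real_inner_self_eq_norm_sq, hν]
    ring
  have hmeas : Measurable fun q : ℝ × (ℝ ∙ ν)ᗮ => g (x₀ + (q.1 • ν + (q.2 : Space d))) :=
    hg.comp (by fun_prop)
  rw [← (measurePreserving_normal_coordinates hν x₀).lintegral_comp hg, Measure.volume_eq_prod,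
    lintegral_prod _ hmeas.aemeasurable]
  have hG : Measurable fun τ : ℝ => ∫⁻ z : (ℝ ∙ ν)ᗮ, g (x₀ + (τ • ν + (z : Space d))) :=
    hmeas.lintegral_prod_right'
  rw [lintegral_eq_smul volume hτ hG, ← lintegral_const_mul _ (by fun_prop),
    ← lintegral_indicator measurableSet_Ioo]
  refine lintegral_congr fun t => ?_
  by_cases ht : t ∈ Ioo (0 : ℝ) 1
  · rw [indicator_of_mem ht]
    have hgt : Measurable fun z : (ℝ ∙ ν)ᗮ => g (x₀ + ((τ₀ • t) • ν + (z : Space d))) :=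
      hg.comp (by fun_prop)
    rw [lintegral_eq_smul volume ht.1 hgt, finrank_orthogonal_span hν, ← mul_assoc,
      ← ENNReal.ofReal_mul (by positivity), Module.finrank_self, pow_one]
    congr 1
    refine lintegral_congr fun z => ?_
    congr 1
    simp only [smul_add, smul_smul, smul_eq_mul, Submodule.coe_smul, mul_comm]
  · rw [indicator_of_notMem ht]
    have : ∀ z : (ℝ ∙ ν)ᗮ, g (x₀ + ((τ₀ • t) • ν + (z : Space d))) = 0 := by
      intro z
      refine hg0 _ fun h => ht ?_
      rw [hin, smul_eq_mul] at h
      exact ⟨by nlinarith [h.1], by nlinarith [h.2]⟩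
    simp only [this, lintegral_zero, mul_zero]

/-- The trace inequality: a function that satisfies a one-dimensional trace inequality on the rays
from the centre `x₀` of a ball of radius `ρ` in `P` satisfies one on `P`. The cones with apex `x₀`
over the faces of `P` are disjoint subsets of `P`. -/
theorem IsPolyhedron.lintegral_frontier_le {P : Set (Space d)} {H : Finset (Space d × ℝ)}
    (hP : IsPolyhedron P H) {x₀ : Space d} {ρ : ℝ} (hρ : 0 < ρ) (hball : Metric.ball x₀ ρ ⊆ P)
    {f : Space d → ENNReal} (hf : Measurable f) {M : ENNReal}
    (hray : ∀ y, f y ≤ M * ∫⁻ s in Ioo (0 : ℝ) 1, ENNReal.ofReal (s ^ (d - 1)) *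
      f (x₀ + s • (y - x₀))) :
    ENNReal.ofReal ρ * ∫⁻ x in frontier P, f x ∂surf d ≤ M * ∫⁻ x in P, f x := by
  have hx₀ : x₀ ∈ P := hball (Metric.mem_ball_self hρ)
  have hne : P.Nonempty := ⟨x₀, hx₀⟩
  let τ : Space d × ℝ → ℝ := fun h => h.2 - inner ℝ h.1 x₀
  have hτ : ∀ h ∈ H, ρ ≤ τ h := by
    intro h hh
    refine le_of_forall_lt fun r hr => ?_
    rcases le_or_gt r 0 with hr0 | hr0
    · have := hP.mem.1 hx₀ h hh
      exact hr0.trans_lt (by simp only [τ]; linarith)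
    · have h1 : x₀ + r • h.1 ∈ P := hball (by
        rw [Metric.mem_ball, dist_eq_norm, add_sub_cancel_left, norm_smul, hP.unit h hh, mul_one,
          Real.norm_eq_abs, abs_of_pos hr0]
        exact hr)
      have h2 := hP.mem.1 h1 h hh
      rw [inner_add_right, real_inner_smul_right, real_inner_self_eq_norm_sq, hP.unit h hh] at h2
      simp only [τ]; linarith
  let F : Space d × ℝ → Set (Space d) := fun h =>
    {x | inner ℝ h.1 x = h.2 ∧ ∀ k ∈ H, k ≠ h → inner ℝ k.1 x < k.2}
  let T : Space d × ℝ → Space d → Space d := fun h x =>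
    x₀ + (τ h / inner ℝ h.1 (x - x₀)) • (x - x₀)
  let C : Space d × ℝ → Set (Space d) := fun h =>
    {x | (0 < inner ℝ h.1 (x - x₀) ∧ inner ℝ h.1 (x - x₀) < τ h) ∧
      ∀ k ∈ H, k ≠ h → inner ℝ k.1 (T h x) < k.2}
  have hopen : ∀ h : Space d × ℝ, MeasurableSet {x | ∀ k ∈ H, k ≠ h → inner ℝ k.1 x < k.2} := by
    intro h
    have : {x | ∀ k ∈ H, k ≠ h → inner ℝ k.1 x < k.2} =
        ⋂ k ∈ H, ⋂ _ : k ≠ h, {x | inner ℝ k.1 x < k.2} := by ext; simp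
    rw [this]
    refine Finset.measurableSet_biInter _ fun k _ => MeasurableSet.iInter fun _ => ?_
    exact (isOpen_lt (by fun_prop) continuous_const).measurableSet
  have hTmeas : ∀ h, Measurable (T h) := by
    intro h
    have h1 : Measurable fun x : Space d => inner ℝ h.1 (x - x₀) :=
      (by fun_prop : Continuous _).measurable
    exact measurable_const.add ((measurable_const.div h1).smul (measurable_id.sub_const _))
  have hFmeas : ∀ h, MeasurableSet (F h) := fun h => (measurableSet_hyperplane _ _).inter (hopen h)
  have hCmeas : ∀ h, MeasurableSet (C h) := by
    intro h
    refine MeasurableSet.inter ?_ (hTmeas h (hopen h))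
    have hc : Continuous fun x : Space d => inner ℝ h.1 (x - x₀) := by fun_prop
    exact ((isOpen_lt continuous_const hc).inter (isOpen_lt hc continuous_const)).measurableSet
  have hTeq : ∀ h x, x ∈ C h → inner ℝ h.1 (T h x) = h.2 := by
    intro h x hx
    simp only [T, inner_add_right, real_inner_smul_right]
    rw [div_mul_cancel₀ _ hx.1.1.ne']
    simp [τ]
  have hCsub : ∀ h ∈ H, C h ⊆ P := by
    intro h hh x hx
    have h0 := hx.1.1
    rw [hP.mem]
    intro k hk
    by_cases hkh : k = h
    · subst hkh
      have := hx.1.2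
      simp only [τ, inner_sub_right] at this
      linarith
    · -- `x` lies on the segment from `x₀` to `T h x`
      have h1 := hx.2 k hk hkh
      have h2 := hP.mem.1 hx₀ k hk
      simp only [T, inner_add_right, real_inner_smul_right] at h1
      set a := inner ℝ h.1 (x - x₀)
      have h3 : inner ℝ k.1 x = inner ℝ k.1 x₀ + inner ℝ k.1 (x - x₀) := by
        rw [inner_sub_right]; ring
      set b := inner ℝ k.1 (x - x₀)
      rw [h3]
      have h4 : 1 < τ h / a := (one_lt_div h0).2 hx.1.2
      nlinarith [mul_pos (sub_pos.2 h4) (sub_pos.2 h2)]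
  have hdisj : (H : Set (Space d × ℝ)).PairwiseDisjoint C := by
    -- on a ray from `x₀`, the point on the first face that is met lies below all other faces
    have key : ∀ h ∈ H, ∀ k ∈ H, h ≠ k → ∀ x, x ∈ C h → x ∈ C k →
        τ h / inner ℝ h.1 (x - x₀) ≤ τ k / inner ℝ k.1 (x - x₀) → False := by
      intro h hh k hk hhk x hxh hxk hle
      have h1 := hTeq h x hxh
      have h2 := hxk.2 h hh hhk
      have h3 := hP.mem.1 hx₀ h hh
      simp only [T, inner_add_right, real_inner_smul_right] at h1 h2
      nlinarith [hxh.1.1]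
    intro h hh k hk hhk
    refine disjoint_left.2 fun x hxh hxk => ?_
    rcases le_total (τ h / inner ℝ h.1 (x - x₀)) (τ k / inner ℝ k.1 (x - x₀)) with hle | hle
    · exact key h hh k hk hhk x hxh hxk hle
    · exact key k hk h hh (Ne.symm hhk) x hxk hxh hle
  -- the inequality on one face
  have hface : ∀ h ∈ H, ENNReal.ofReal ρ * ∫⁻ x in F h, f x ∂surf d ≤ M * ∫⁻ x in C h, f x := by
    intro h hh
    have hν := hP.unit h hh
    have hτ0 : 0 < τ h := hρ.trans_le (hτ h hh)
    have hy₀ : inner ℝ h.1 (x₀ + τ h • h.1) = h.2 := by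
      rw [inner_add_right, real_inner_smul_right, real_inner_self_eq_norm_sq, hν]
      simp only [τ]; ring
    let A : Set (ℝ ∙ h.1)ᗮ := {z | x₀ + (τ h • h.1 + (z : Space d)) ∈ F h}
    have hAmeas : MeasurableSet A :=
      (by fun_prop : Measurable fun z : (ℝ ∙ h.1)ᗮ => x₀ + (τ h • h.1 + (z : Space d))) (hFmeas h)
    have hleft : ∫⁻ x in F h, f x ∂surf d =
        ∫⁻ z in A, f (x₀ + (τ h • h.1 + (z : Space d))) := by
      have hFsub : F h = F h ∩ {x | inner ℝ h.1 x = h.2} := by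
        ext x; exact ⟨fun hx => ⟨hx, hx.1⟩, fun hx => hx.1⟩
      have hm : Measurable fun z : (ℝ ∙ h.1)ᗮ => x₀ + τ h • h.1 + (z : Space d) := by fun_prop
      conv_lhs => rw [hFsub]
      rw [← Measure.restrict_restrict (hFmeas h), ← hy₀, ← map_add_volume hν,
        setLIntegral_map (hFmeas h) hf hm]
      simp only [add_assoc]
      rfl
    have hinner : ∀ z : (ℝ ∙ h.1)ᗮ, inner ℝ h.1 (τ h • h.1 + (z : Space d)) = τ h := by
      intro z
      have : inner ℝ h.1 (z : Space d) = 0 :=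
        Submodule.mem_orthogonal_singleton_iff_inner_right.1 z.2
      rw [inner_add_right, this, real_inner_smul_right, real_inner_self_eq_norm_sq, hν]
      ring
    have hmem : ∀ t ∈ Ioo (0 : ℝ) 1, ∀ z : (ℝ ∙ h.1)ᗮ,
        x₀ + t • (τ h • h.1 + (z : Space d)) ∈ C h ↔ z ∈ A := by
      intro t ht z
      have e1 : inner ℝ h.1 (x₀ + t • (τ h • h.1 + (z : Space d)) - x₀) = t * τ h := by
        rw [add_sub_cancel_left, real_inner_smul_right, hinner]
      have e2 : T h (x₀ + t • (τ h • h.1 + (z : Space d))) =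
          x₀ + (τ h • h.1 + (z : Space d)) := by
        simp only [T]
        rw [e1, add_sub_cancel_left, smul_smul]
        have : τ h / (t * τ h) * t = 1 := by
          have := ht.1.ne'
          field_simp
        rw [this, one_smul]
      have e3 : inner ℝ h.1 (x₀ + (τ h • h.1 + (z : Space d))) = h.2 := by
        rw [inner_add_right, hinner]; simp [τ]
      change (_ ∧ _) ↔ (_ ∧ _)
      rw [e1, e2]
      refine and_congr ?_ Iff.rfl
      exact ⟨fun _ => e3, fun _ => ⟨mul_pos ht.1 hτ0, by nlinarith [ht.2]⟩⟩
    have hright : ∫⁻ x in C h, f x = ∫⁻ z in A, ∫⁻ t in Ioo (0 : ℝ) 1,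
        ENNReal.ofReal (τ h * t ^ (d - 1)) * f (x₀ + t • (τ h • h.1 + (z : Space d))) := by
      rw [← lintegral_indicator (hCmeas h), lintegral_slab_eq hν x₀ hτ0 (hf.indicator (hCmeas h))
        (fun x hx => indicator_of_notMem (fun hxC => hx hxC.1) _)]
      rw [lintegral_lintegral_swap (by
        refine Measurable.aemeasurable ?_
        exact ((by fun_prop : Measurable fun q : (ℝ ∙ h.1)ᗮ × ℝ =>
          ENNReal.ofReal (τ h * q.2 ^ (d - 1)))).mul (hf.comp (by fun_prop)))]
      refine setLIntegral_congr_fun measurableSet_Ioo fun t ht => ?_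
      have hm : Measurable fun z : (ℝ ∙ h.1)ᗮ => f (x₀ + t • (τ h • h.1 + (z : Space d))) :=
        hf.comp (by fun_prop)
      rw [lintegral_const_mul _ hm, ← lintegral_indicator hAmeas]
      congr 1
      refine lintegral_congr fun z => ?_
      by_cases hz : z ∈ A
      · rw [indicator_of_mem hz, indicator_of_mem ((hmem t ht z).2 hz)]
      · rw [indicator_of_notMem hz, indicator_of_notMem (fun hc => hz ((hmem t ht z).1 hc))]
    have hm1 : Measurable fun z : (ℝ ∙ h.1)ᗮ => f (x₀ + (τ h • h.1 + (z : Space d))) :=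
      hf.comp (by fun_prop)
    have hm2 : Measurable fun z : (ℝ ∙ h.1)ᗮ => ∫⁻ t in Ioo (0 : ℝ) 1,
        ENNReal.ofReal (τ h * t ^ (d - 1)) * f (x₀ + t • (τ h • h.1 + (z : Space d))) := by
      refine Measurable.lintegral_prod_right' (f := fun q : (ℝ ∙ h.1)ᗮ × ℝ =>
        ENNReal.ofReal (τ h * q.2 ^ (d - 1)) * f (x₀ + q.2 • (τ h • h.1 + (q.1 : Space d)))) ?_
      exact ((by fun_prop : Measurable fun q : (ℝ ∙ h.1)ᗮ × ℝ =>
        ENNReal.ofReal (τ h * q.2 ^ (d - 1)))).mul (hf.comp (by fun_prop))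
    rw [hleft, hright, ← lintegral_const_mul _ hm1, ← lintegral_const_mul _ hm2]
    refine lintegral_mono fun z => ?_
    set y := x₀ + (τ h • h.1 + (z : Space d)) with hy
    have hyx : τ h • h.1 + (z : Space d) = y - x₀ := by simp [hy]
    have hm3 : Measurable fun t : ℝ => ENNReal.ofReal (t ^ (d - 1)) * f (x₀ + t • (y - x₀)) :=
      (by fun_prop : Measurable fun t : ℝ => ENNReal.ofReal (t ^ (d - 1))).mul
        (hf.comp (by fun_prop))
    simp only [hyx, ENNReal.ofReal_mul hτ0.le, mul_assoc]
    rw [lintegral_const_mul _ hm3, mul_left_comm]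
    exact mul_le_mul' (ENNReal.ofReal_le_ofReal (hτ h hh)) (hray y)
  have hFdisj : (H : Set (Space d × ℝ)).PairwiseDisjoint F := fun h hh k hk hhk =>
    disjoint_left.2 fun x hxh hxk => (hxk.2 h hh hhk).ne hxh.1
  have hae : frontier P ≤ᵐ[surf d] ⋃ h ∈ H, F h := by
    filter_upwards [hP.ae_mem_one_face hne] with x hx hxP
    obtain ⟨h, hh, hxh⟩ := hx hxP
    exact mem_iUnion₂.2 ⟨h, hh, hxh⟩
  calc ENNReal.ofReal ρ * ∫⁻ x in frontier P, f x ∂surf d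
      ≤ ENNReal.ofReal ρ * ∑ h ∈ H, ∫⁻ x in F h, f x ∂surf d := by
        rw [← lintegral_biUnion_finset hFdisj fun h _ => hFmeas h]
        exact mul_le_mul' le_rfl (lintegral_mono_set' hae)
    _ ≤ M * ∑ h ∈ H, ∫⁻ x in C h, f x := by
        rw [Finset.mul_sum, Finset.mul_sum]
        exact Finset.sum_le_sum hface
    _ ≤ M * ∫⁻ x in P, f x := by
        rw [← lintegral_biUnion_finset hdisj fun h _ => hCmeas h]
        exact mul_le_mul' le_rfl (lintegral_mono_set (iUnion₂_subset hCsub))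

end Trace

section PolynomialTrace

/-! ### The trace inequality for polynomials on a polyhedron -/

variable {d : ℕ}

theorem integrableOn_of_continuous_of_isBounded {X E : Type*} [PseudoMetricSpace X] [ProperSpace X]
    [MeasurableSpace X] [OpensMeasurableSpace X] [SecondCountableTopology X]
    [NormedAddCommGroup E]
    {μ : Measure X} {S : Set X} (hS : MeasurableSet S) (hb : Bornology.IsBounded S) (hμ : μ S ≠ ⊤)
    {g : X → E} (hg : Continuous g) : IntegrableOn g S μ := by
  obtain ⟨C, hC⟩ := (hb.isCompact_closure.exists_bound_of_continuousOn hg.continuousOn)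
  refine Measure.integrableOn_of_bounded (M := C) hμ
    hg.aestronglyMeasurable ?_
  filter_upwards [ae_restrict_mem hS] with x hx
  exact hC x (subset_closure hx)

/-- The polynomial trace inequality on a polyhedron that contains a ball of radius `ρ`: on
every ray from the centre, the one-dimensional inequality applies to polynomials of degree less
than `p + 1` and the weight `s ^ (d - 1)`. -/
theorem IsPolyhedron.integral_frontier_sq_le (hd : 1 ≤ d) {P : Set (Space d)}
    {H : Finset (Space d × ℝ)} (hP : IsPolyhedron P H) (hb : Bornology.IsBounded P)
    {x₀ : Space d} {ρ : ℝ} (hρ : 0 < ρ) (hball : Metric.ball x₀ ρ ⊆ P) {p : ℕ}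
    {F : Space d → Space d}
    (hF : ∀ i, ∃ f ∈ polySpace d p, ∃ t, ∀ x, F x i = f t x) :
    ρ * ∫ x in frontier P, ‖F x‖ ^ 2 ∂surf d ≤ (p + 1) * (p + d) * ∫ x in P, ‖F x‖ ^ 2 := by
  have hFc : Continuous F := by
    refine (PiLp.continuous_toLp 2 (fun _ : Fin d => ℝ)).comp (f := fun x => WithLp.ofLp (F x)) ?_
    refine continuous_pi fun i => ?_
    obtain ⟨f, hf, t, h⟩ := hF i
    simp only [h]
    exact (polySpace_continuous hf).comp (by fun_prop : Continuous fun x : Space d => (t, x))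
  have hg : Continuous fun x => ‖F x‖ ^ 2 := by fun_prop
  have hray : ∀ y, ‖F y‖ ^ 2 ≤ (p + 1) * (p + d) *
      ∫ s in (0 : ℝ)..1, s ^ (d - 1) * ‖F (x₀ + s • (y - x₀))‖ ^ 2 := by
    intro y
    simp only [EuclideanSpace.norm_sq_eq, Real.norm_eq_abs, sq_abs, Finset.mul_sum]
    have hcont : ∀ i, Continuous fun s : ℝ => F (x₀ + s • (y - x₀)) i := by
      intro i
      have : Continuous fun s : ℝ => F (x₀ + s • (y - x₀)) := hFc.comp (by fun_prop)
      fun_prop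
    have hint : ∀ i ∈ (Finset.univ : Finset (Fin d)), IntervalIntegrable
        (fun s : ℝ => s ^ (d - 1) * F (x₀ + s • (y - x₀)) i ^ 2) volume 0 1 := by
      intro i _
      have := hcont i
      exact (by fun_prop : Continuous fun s : ℝ =>
        s ^ (d - 1) * F (x₀ + s • (y - x₀)) i ^ 2).intervalIntegrable _ _
    rw [intervalIntegral.integral_finsetSum hint, Finset.mul_sum]
    refine Finset.sum_le_sum fun i _ => ?_
    obtain ⟨f, hf, t, h⟩ := hF i
    obtain ⟨g, hg, hgs⟩ := polySpace_line hf t x₀ y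
    have key := eval_one_sq_le (d - 1) (p + 1) g hg
    have h1 : F y i = g.eval 1 := by rw [h, ← hgs]; simp
    rw [h1]
    refine key.trans (le_of_eq ?_)
    have h2 : ((p + 1 : ℕ) : ℝ) + ((d - 1 : ℕ) : ℝ) = p + d := by
      rw [Nat.cast_sub hd]; push_cast; ring
    rw [h2]
    push_cast
    congr 1
    simp only [weightedIntegral, LinearMap.coe_mk, AddHom.coe_mk, Polynomial.eval_mul, h, hgs, sq]
  have key := hP.lintegral_frontier_le hρ hball (f := fun x => ENNReal.ofReal (‖F x‖ ^ 2))
    (by fun_prop) (M := ENNReal.ofReal ((p + 1) * (p + d))) (fun y => by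
      have hc : Continuous fun s : ℝ => s ^ (d - 1) * ‖F (x₀ + s • (y - x₀))‖ ^ 2 := by fun_prop
      refine (ENNReal.ofReal_le_ofReal (hray y)).trans (le_of_eq ?_)
      rw [ENNReal.ofReal_mul (by positivity), intervalIntegral.integral_of_le zero_le_one,
        integral_Ioc_eq_integral_Ioo, ofReal_integral_eq_lintegral_ofReal]
      · congr 1
        refine setLIntegral_congr_fun measurableSet_Ioo fun s hs => ?_
        exact ENNReal.ofReal_mul (by have := hs.1; positivity)
      · exact (hc.integrableOn_Icc (a := 0) (b := 1)).mono_set Ioo_subset_Icc_self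
      · filter_upwards [ae_restrict_mem measurableSet_Ioo] with s hs
        have := hs.1
        positivity)
  have hi1 : IntegrableOn (fun x => ‖F x‖ ^ 2) (frontier P) (surf d) :=
    integrableOn_of_continuous_of_isBounded isClosed_frontier.measurableSet
      (hb.closure.subset frontier_subset_closure) (hP.surf_frontier_lt_top hb).ne hg
  have hi2 : IntegrableOn (fun x => ‖F x‖ ^ 2) P volume :=
    integrableOn_of_continuous_of_isBounded hP.isOpen.measurableSet hb hb.measure_lt_top.ne hg
  rw [← ofReal_integral_eq_lintegral_ofReal hi1 (Eventually.of_forall fun x => by positivity),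
    ← ofReal_integral_eq_lintegral_ofReal hi2 (Eventually.of_forall fun x => by positivity),
    ← ENNReal.ofReal_mul hρ.le, ← ENNReal.ofReal_mul (by positivity)] at key
  exact (ENNReal.ofReal_le_ofReal_iff (mul_nonneg (by positivity)
    (integral_nonneg fun x => by positivity))).1 key

end PolynomialTrace

section Mesh

/-! ### Meshes -/

variable {d : ℕ} {Ω : Set (Space d)} {T T' : Finset (Set (Space d))}

@[simp]
theorem mem_adjacent {x : Space d} {K : T} :
    K ∈ adjacent T x ↔ x ∈ closure (K : Set (Space d)) := by
  simp [adjacent]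

theorem IsMesh.exists_isPolyhedron (hd : 1 ≤ d) (hT : IsMesh Ω T) {K : Set (Space d)}
    (hK : K ∈ T) : (∃ H, IsPolyhedron K H) ∧ K.Nonempty ∧ Bornology.IsBounded K :=
  (hT.isElement K hK).exists_isPolyhedron hd

theorem IsMesh.isOpen (hd : 1 ≤ d) (hT : IsMesh Ω T) {K : Set (Space d)} (hK : K ∈ T) :
    IsOpen K := (hT.exists_isPolyhedron hd hK).1.choose_spec.isOpen

theorem IsMesh.convex (hd : 1 ≤ d) (hT : IsMesh Ω T) {K : Set (Space d)} (hK : K ∈ T) :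
    Convex ℝ K := (hT.exists_isPolyhedron hd hK).1.choose_spec.convex

theorem IsMesh.eq_of_mem_of_mem_closure (hd : 1 ≤ d) (hT : IsMesh Ω T) {K K' : Set (Space d)}
    (hK : K ∈ T) (hK' : K' ∈ T) {x : Space d} (hx : x ∈ K) (hx' : x ∈ closure K') : K = K' := by
  by_contra h
  exact disjoint_left.1 ((hT.disjoint K hK K' hK' h).closure_right (hT.isOpen hd hK)) hx hx'

theorem IsMesh.mem_frontier_of_mem_closure (hd : 1 ≤ d) (hT : IsMesh Ω T) {K : Set (Space d)}
    (hK : K ∈ T) {x : Space d} (hx : x ∈ closure K) (hΓ : x ∈ skeleton T) : x ∈ frontier K := by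
  rw [(hT.isOpen hd hK).frontier_eq]
  refine ⟨hx, fun hxK => ?_⟩
  obtain ⟨K', hK', hxK'⟩ := mem_iUnion₂.1 hΓ
  have := hT.eq_of_mem_of_mem_closure hd hK hK' hxK (frontier_subset_closure hxK')
  subst this
  rw [(hT.isOpen hd hK).frontier_eq] at hxK'
  exact hxK'.2 hxK

theorem skeleton_subset_closure (hT : IsMesh Ω T) : skeleton T ⊆ closure Ω := by
  rw [hT.cover]
  exact iUnion₂_mono fun K _ => frontier_subset_closure

theorem isClosed_skeleton (T : Finset (Set (Space d))) : IsClosed (skeleton T) :=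
  isClosed_biUnion_finset fun _ _ => isClosed_frontier

theorem IsMesh.surf_skeleton_lt_top (hd : 1 ≤ d) (hT : IsMesh Ω T) : surf d (skeleton T) < ⊤ := by
  refine (measure_biUnion_finset_le _ _).trans_lt (ENNReal.sum_lt_top.2 fun K hK => ?_)
  obtain ⟨⟨H, hH⟩, -, hb⟩ := hT.exists_isPolyhedron hd hK
  exact hH.surf_frontier_lt_top hb

theorem IsMesh.ae_eq_iUnion (hd : 1 ≤ d) (hT : IsMesh Ω T) : Ω =ᵐ[volume] ⋃ K ∈ T, K := by
  have hnull : volume (⋃ K ∈ T, frontier K) = 0 :=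
    (measure_biUnion_null_iff T.countable_toSet).2 fun K hK =>
      (hT.convex hd hK).addHaar_frontier volume
  filter_upwards [measure_eq_zero_iff_ae_notMem.1 hnull] with x hx
  refine propext ⟨fun h : x ∈ Ω => ?_, fun h : x ∈ ⋃ K ∈ T, K => ?_⟩
  · have h1 : x ∈ closure Ω := subset_closure h
    rw [hT.cover] at h1
    obtain ⟨K, hK, hxK⟩ := mem_iUnion₂.1 h1
    refine mem_iUnion₂.2 ⟨K, hK, ?_⟩
    by_contra hc
    exact hx (mem_iUnion₂.2 ⟨K, hK, by rw [(hT.isOpen hd hK).frontier_eq]; exact ⟨hxK, hc⟩⟩)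
  · obtain ⟨K, hK, hxK⟩ := mem_iUnion₂.1 h
    exact hT.subset K hK hxK

theorem IsMesh.volume_inter_eq_sum (hd : 1 ≤ d) (hT : IsMesh Ω T) {S : Set (Space d)}
    (hS : MeasurableSet S) (hb : Bornology.IsBounded S) :
    volume.real (Ω ∩ S) = ∑ K : T, volume.real ((K : Set (Space d)) ∩ S) := by
  have h1 : volume.real (Ω ∩ S) = volume.real (⋃ K ∈ T, (K ∩ S)) := by
    refine measureReal_congr ?_
    rw [← iUnion₂_inter]
    exact (hT.ae_eq_iUnion hd).inter (ae_eq_refl _)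
  rw [h1, measureReal_biUnion_finset (h := fun K hK =>
    (hb.subset inter_subset_right).measure_lt_top.ne)]
  · exact (Finset.sum_coe_sort T fun K => volume.real (K ∩ S)).symm
  · intro K hK K' hK' hne
    exact (hT.disjoint K hK K' hK' hne).mono inter_subset_left inter_subset_left
  · exact fun K hK => (hT.isOpen hd hK).measurableSet.inter hS

/-- Points at which every mesh element with that boundary point is flat. -/
def IsGeneric (T : Finset (Set (Space d))) (x : Space d) : Prop :=
  ∀ K ∈ T, x ∈ frontier K → ∃ ν, IsFlatAt K x ν

theorem IsMesh.ae_isGeneric (hd : 1 ≤ d) (hT : IsMesh Ω T) : ∀ᵐ x ∂surf d, IsGeneric T x := by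
  unfold IsGeneric
  rw [Finset.eventually_all]
  intro K hK
  obtain ⟨⟨H, hH⟩, hne, -⟩ := hT.exists_isPolyhedron hd hK
  exact hH.ae_isFlatAt hne

theorem IsMesh.isFlatAt_of_ne (hd : 1 ≤ d) (hT : IsMesh Ω T) {x : Space d} (hx : IsGeneric T x)
    {K K' : Set (Space d)} (hK : K ∈ T) (hK' : K' ∈ T) (hne : K ≠ K') (hxK : x ∈ closure K)
    (hxK' : x ∈ closure K') : ∃ ν, IsFlatAt K x ν ∧ IsFlatAt K' x (-ν) := by
  have hf : ∀ K ∈ T, ∀ K' ∈ T, K ≠ K' → x ∈ closure K → x ∈ closure K' → x ∈ frontier K := by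
    intro K hK K' hK' hne hxK hxK'
    rw [(hT.isOpen hd hK).frontier_eq]
    exact ⟨hxK, fun h => hne (hT.eq_of_mem_of_mem_closure hd hK hK' h hxK')⟩
  obtain ⟨ν, hν⟩ := hx K hK (hf K hK K' hK' hne hxK hxK')
  obtain ⟨ν', hν'⟩ := hx K' hK' (hf K' hK' K hK hne.symm hxK' hxK)
  have := hν.normal_eq_neg hν' (hT.disjoint K hK K' hK' hne)
  exact ⟨ν, hν, this ▸ hν'⟩

theorem IsFlatAt.eventually_inter_ball {K : Set (Space d)} {x ν : Space d} (h : IsFlatAt K x ν) :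
    ∀ᶠ r in 𝓝[>] (0 : ℝ), K ∩ Metric.ball x r = {y | inner ℝ ν (y - x) < 0} ∩ Metric.ball x r := by
  obtain ⟨ε, hε, hball⟩ := Metric.eventually_nhds_iff_ball.1 h.2
  filter_upwards [nhdsWithin_le_nhds (eventually_lt_nhds hε)] with r hr
  ext y
  exact and_congr_left fun hy => hball y (Metric.ball_subset_ball hr.le hy)

theorem volume_half_ball_neg (x ν : Space d) (r : ℝ) :
    volume.real ({y | inner ℝ (-ν) (y - x) < 0} ∩ Metric.ball x r) =
      volume.real ({y | inner ℝ ν (y - x) < 0} ∩ Metric.ball x r) := by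
  have he : MeasurePreserving (fun y : Space d => (x + x) - y) volume volume :=
    Measure.measurePreserving_sub_left volume (x + x)
  have hm : MeasurableSet ({y : Space d | inner ℝ ν (y - x) < 0} ∩ Metric.ball x r) :=
    (isOpen_lt (by fun_prop) continuous_const).measurableSet.inter measurableSet_ball
  rw [measureReal_def, measureReal_def, ← he.measure_preimage hm.nullMeasurableSet]
  congr 2
  ext y
  have h1 : x + x - y - x = -(y - x) := by abel
  have h2 : dist (x + x - y) x = dist y x := by
    rw [dist_eq_norm, dist_eq_norm, h1, norm_neg]
  simp only [mem_inter_iff, mem_ofPred_eq, mem_preimage, Metric.mem_ball, h1, h2, inner_neg_left,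
    inner_neg_right]

/-- At a generic point, the mesh elements that touch the point have equal volume in small balls. -/
theorem IsMesh.eventually_volume_eq (hd : 1 ≤ d) (hT : IsMesh Ω T) {x : Space d}
    (hx : IsGeneric T x) : ∀ᶠ r in 𝓝[>] (0 : ℝ), ∀ K ∈ adjacent T x, ∀ K' ∈ adjacent T x,
      volume.real ((K : Set (Space d)) ∩ Metric.ball x r) =
        volume.real ((K' : Set (Space d)) ∩ Metric.ball x r) := by
  rw [Filter.eventually_all_finset]
  intro K hK
  rw [Filter.eventually_all_finset]
  intro K' hK'
  by_cases hne : K = K'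
  · simp [hne]
  · obtain ⟨ν, hν, hν'⟩ := hT.isFlatAt_of_ne hd hx K.2 K'.2 (fun h => hne (Subtype.ext h))
      (mem_adjacent.1 hK) (mem_adjacent.1 hK')
    filter_upwards [hν.eventually_inter_ball, hν'.eventually_inter_ball] with r h1 h2
    rw [h1, h2, volume_half_ball_neg]

theorem IsMesh.eventually_volume_eq_zero (T : Finset (Set (Space d))) (x : Space d) :
    ∀ᶠ r in 𝓝[>] (0 : ℝ), ∀ K : T, K ∉ adjacent T x →
      volume.real ((K : Set (Space d)) ∩ Metric.ball x r) = 0 := by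
  rw [Filter.eventually_all]
  intro K
  by_cases hK : K ∈ adjacent T x
  · simp [hK]
  · rw [mem_adjacent] at hK
    obtain ⟨ε, hε, hball⟩ := Metric.mem_nhds_iff.1 (isClosed_closure.isOpen_compl.mem_nhds hK)
    filter_upwards [nhdsWithin_le_nhds (eventually_lt_nhds hε)] with r hr _
    have : (K : Set (Space d)) ∩ Metric.ball x r = ∅ := by
      rw [← disjoint_iff_inter_eq_empty]
      refine disjoint_left.2 fun y hy hyb => ?_
      exact hball (Metric.ball_subset_ball hr.le hyb) (subset_closure hy)
    rw [this, measureReal_empty]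

/-- At a generic point, the averages over two meshes of the same domain are marginals of one
probability distribution on the pairs of overlapping elements that touch the point: its weights are
the relative volumes of the overlaps in a small ball. -/
theorem IsMesh.exists_weights (hd : 1 ≤ d) (hΩ : IsOpen Ω) (hT : IsMesh Ω T) (hT' : IsMesh Ω T')
    {x : Space d} (hxΩ : x ∈ closure Ω) (hx : IsGeneric T x) (hx' : IsGeneric T' x) :
    ∃ θ : T → T' → ℝ, (∀ K K', 0 ≤ θ K K') ∧
      (∀ K K', θ K K' ≠ 0 → K ∈ adjacent T x ∧ K' ∈ adjacent T' x ∧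
        ((K : Set (Space d)) ∩ K').Nonempty) ∧
      (∀ K, ∑ K', θ K K' = if K ∈ adjacent T x then ((adjacent T x).card : ℝ)⁻¹ else 0) ∧
      (∀ K', ∑ K, θ K K' = if K' ∈ adjacent T' x then ((adjacent T' x).card : ℝ)⁻¹ else 0) := by
  obtain ⟨r, ⟨h1, h2, h1', h2'⟩, hr⟩ := (((hT.eventually_volume_eq hd hx).and
    ((eventually_volume_eq_zero T x).and ((hT'.eventually_volume_eq hd hx').and
      (eventually_volume_eq_zero T' x)))).and self_mem_nhdsWithin).exists
  have hr0 : (0 : ℝ) < r := hr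
  set B := Metric.ball x r
  have hBm : MeasurableSet B := measurableSet_ball
  have hBb : Bornology.IsBounded B := Metric.isBounded_ball
  have hpos : 0 < volume.real (Ω ∩ B) := by
    refine ENNReal.toReal_pos (IsOpen.measure_pos volume (hΩ.inter Metric.isOpen_ball) ?_).ne'
      (hBb.subset inter_subset_right).measure_lt_top.ne
    rw [inter_comm]
    exact mem_closure_iff.1 hxΩ B Metric.isOpen_ball (Metric.mem_ball_self hr0)
  have marg : ∀ {T : Finset (Set (Space d))}, IsMesh Ω T →
      (∀ K ∈ adjacent T x, ∀ K' ∈ adjacent T x,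
        volume.real ((K : Set (Space d)) ∩ B) = volume.real ((K' : Set (Space d)) ∩ B)) →
      (∀ K : T, K ∉ adjacent T x → volume.real ((K : Set (Space d)) ∩ B) = 0) →
      ∀ K : T, volume.real ((K : Set (Space d)) ∩ B) / volume.real (Ω ∩ B) =
        if K ∈ adjacent T x then ((adjacent T x).card : ℝ)⁻¹ else 0 := by
    intro T hT heq hzero K
    split_ifs with hK
    · have hsum := hT.volume_inter_eq_sum hd hBm hBb
      rw [← Finset.sum_subset (Finset.subset_univ (adjacent T x)) fun K _ hK => hzero K hK,
        Finset.sum_congr rfl fun K' hK' => heq K' hK' K hK, Finset.sum_const, nsmul_eq_mul] at hsum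
      have hc : ((adjacent T x).card : ℝ) ≠ 0 := by
        rintro h; rw [h, zero_mul] at hsum; exact hpos.ne' hsum
      rw [div_eq_iff hpos.ne', hsum]
      field_simp
    · rw [hzero K hK, zero_div]
  have hmeas : ∀ {T : Finset (Set (Space d))}, IsMesh Ω T → ∀ K : T,
      MeasurableSet (K : Set (Space d)) := fun hT K => (hT.isOpen hd K.2).measurableSet
  refine ⟨fun K K' => volume.real ((K : Set (Space d)) ∩ K' ∩ B) / volume.real (Ω ∩ B),
    fun K K' => by positivity, fun K K' hθ => ?_, fun K => ?_, fun K' => ?_⟩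
  · have hne : volume.real ((K : Set (Space d)) ∩ K' ∩ B) ≠ 0 :=
      fun h => hθ (by simp only [h, zero_div])
    have hle : ∀ S, (K : Set (Space d)) ∩ K' ∩ B ⊆ S ∩ B → volume.real (S ∩ B) ≠ 0 := by
      intro S hS h0
      have := measureReal_mono hS (μ := volume) (hBb.subset inter_subset_right).measure_lt_top.ne
      exact hne (le_antisymm (this.trans h0.le) measureReal_nonneg)
    refine ⟨?_, ?_, ?_⟩
    · by_contra h
      exact hle K (inter_subset_inter_left _ inter_subset_left) (h2 K h)
    · by_contra h
      exact hle K' (inter_subset_inter_left _ inter_subset_right) (h2' K' h)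
    · rw [nonempty_iff_ne_empty]
      intro h
      exact hne (by rw [h, empty_inter, measureReal_empty])
  · rw [← Finset.sum_div, ← marg hT h1 h2 K]
    congr 1
    have := hT'.volume_inter_eq_sum hd ((hmeas hT K).inter hBm) (hBb.subset inter_subset_right)
    rw [← inter_assoc, inter_eq_right.2 (hT.subset K K.2)] at this
    rw [this]
    refine Finset.sum_congr rfl fun K' _ => ?_
    congr 1; ac_rfl
  · rw [← Finset.sum_div, ← marg hT' h1' h2' K']
    congr 1
    have := hT.volume_inter_eq_sum hd ((hmeas hT' K').inter hBm) (hBb.subset inter_subset_right)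
    rw [← inter_assoc, inter_eq_right.2 (hT'.subset K' K'.2)] at this
    rw [this]
    refine Finset.sum_congr rfl fun K _ => ?_
    congr 1; ac_rfl

/-- A piecewise constant function whose jumps, including those at the boundary of the domain, vanish
almost everywhere on the skeleton is zero: otherwise the boundary of a level set would carry a
nonzero jump. -/
theorem IsMesh.eq_zero_of_jump_eq_zero (hd : 1 ≤ d) (hT : IsMesh Ω T) {c : T → ℝ}
    (hc : ∀ᵐ x ∂(surf d).restrict (skeleton T), jump (fun K _ => c K) x = 0) : c = 0 := by
  funext K₀
  by_contra hK₀
  rw [Pi.zero_apply] at hK₀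
  let F : Set (Space d) := ⋃ K ∈ {K : T | c K = c K₀}, closure (K : Set (Space d))
  have hFclosed : IsClosed F := (Set.toFinite _).isClosed_biUnion fun _ _ => isClosed_closure
  have hbdd : Bornology.IsBounded F := by
    refine (Bornology.isBounded_biUnion (Set.toFinite _)).2 fun K _ => ?_
    exact (hT.exists_isPolyhedron hd K.2).2.2.closure
  have hsub : ∀ K : T, c K = c K₀ → closure (K : Set (Space d)) ⊆ F := fun K hK =>
    subset_biUnion_of_mem (u := fun K : T => closure (K : Set (Space d))) hK
  have hint : ∀ K : T, c K = c K₀ → (K : Set (Space d)) ⊆ interior F := fun K hK =>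
    interior_maximal (subset_closure.trans (hsub K hK)) (hT.isOpen hd K.2)
  have hpos := surf_frontier_ne_zero hd hbdd
    ((hT.exists_isPolyhedron hd K₀.2).2.1.mono (hint K₀ rfl))
  rw [ae_restrict_iff' (isClosed_skeleton T).measurableSet] at hc
  obtain ⟨x, hxF, hxc, hxg⟩ : ∃ x ∈ frontier F, (x ∈ skeleton T →
      jump (fun K _ => c K) x = 0) ∧ IsGeneric T x := by
    by_contra! hcon
    refine hpos (measure_mono_null (fun x hx => ?_) (ae_iff.1 (hc.and (hT.ae_isGeneric hd))))
    exact fun h => hcon x hx h.1 h.2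
  have hxF' : x ∉ interior F := hxF.2
  obtain ⟨K, hKc, hxK⟩ := mem_iUnion₂.1 (hFclosed.frontier_subset hxF)
  have hKc' : c K = c K₀ := hKc
  have hxfr : ∀ K : T, c K = c K₀ → x ∈ closure (K : Set (Space d)) →
      x ∈ frontier (K : Set (Space d)) := by
    intro K hK hxK
    rw [(hT.isOpen hd K.2).frontier_eq]
    exact ⟨hxK, fun h => hxF' (hint K hK h)⟩
  have hxΓ : x ∈ skeleton T := mem_iUnion₂.2 ⟨K, K.2, hxfr K hKc hxK⟩
  have hjump := hxc hxΓ
  obtain ⟨ν, hν⟩ := hxg K K.2 (hxfr K hKc hxK)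
  have hν0 : ν ≠ 0 := by rintro rfl; simpa using hν.1
  have hnK := outwardNormal_eq_of_isFlatAt (hT.isOpen hd K.2) (hT.convex hd K.2) hν
  have hother : ∀ K' ∈ adjacent T x, K' ≠ K → IsFlatAt (K' : Set (Space d)) x (-ν) := by
    intro K' hK' hne
    obtain ⟨μ, hμ, hμ'⟩ := hT.isFlatAt_of_ne hd hxg K.2 K'.2 (fun h => hne (Subtype.ext h.symm))
      hxK (mem_adjacent.1 hK')
    have h1 := outwardNormal_eq_of_isFlatAt (hT.isOpen hd K.2) (hT.convex hd K.2) hμ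
    rw [hnK] at h1
    rwa [h1]
  by_cases hex : ∃ K' ∈ adjacent T x, K' ≠ K
  · obtain ⟨K', hK', hne⟩ := hex
    have hν' := hother K' hK' hne
    have hnK' := outwardNormal_eq_of_isFlatAt (hT.isOpen hd K'.2) (hT.convex hd K'.2) hν'
    have hadj : adjacent T x = {K, K'} := by
      ext K''
      rw [Finset.mem_insert, Finset.mem_singleton]
      constructor
      · intro hK''
        by_contra! hcon
        have h3 := hother K'' hK'' hcon.1
        have := hν'.normal_eq_neg h3 (hT.disjoint _ K'.2 _ K''.2 fun h =>
          hcon.2 (Subtype.ext h.symm))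
        rw [neg_neg] at this
        have h2 : (2 : ℝ) • ν = 0 := by
          rw [two_smul]
          nth_rewrite 1 [← this]
          exact neg_add_cancel ν
        exact hν0 ((smul_eq_zero_iff_right two_ne_zero).1 h2)
      · rintro (rfl | rfl)
        · exact mem_adjacent.2 hxK
        · exact hK'
    rw [jump, hadj, Finset.sum_pair hne.symm, hnK, hnK', smul_neg, ← sub_eq_add_neg,
      ← sub_smul, smul_eq_zero, or_iff_left hν0, sub_eq_zero] at hjump
    -- the two half-spaces cover a neighbourhood of `x`, so `x` is an interior point of `F`
    refine hxF' (mem_interior_iff_mem_nhds.2 ?_)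
    filter_upwards [eventually_eventually_nhds.2 hν.2, hν'.2] with y hy hy'
    rcases lt_trichotomy (inner ℝ ν (y - x)) 0 with hlt | heq | hgt
    · exact hsub K hKc' (subset_closure (hy.self_of_nhds.2 hlt))
    · refine hsub K hKc' ?_
      have hlim : Tendsto (fun s : ℝ => y + s • (-ν)) (𝓝[>] 0) (𝓝 y) := by
        have : Continuous fun s : ℝ => y + s • (-ν) := by fun_prop
        simpa using (this.tendsto 0).mono_left nhdsWithin_le_nhds
      refine mem_closure_of_tendsto hlim ?_
      filter_upwards [hlim.eventually hy, self_mem_nhdsWithin] with s hs (hs0 : 0 < s)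
      rw [hs, add_sub_right_comm, inner_add_right, heq, real_inner_smul_right, inner_neg_right,
        real_inner_self_eq_norm_sq, hν.1]
      linarith
    · refine hsub K' (hjump.symm.trans hKc') (subset_closure (hy'.2 ?_))
      rw [inner_neg_left]; linarith
  · push Not at hex
    have hadj : adjacent T x = {K} := by
      ext K'
      rw [Finset.mem_singleton]
      exact ⟨hex K', fun h => h ▸ mem_adjacent.2 hxK⟩
    rw [jump, hadj, Finset.sum_singleton, hnK, smul_eq_zero, or_iff_left hν0] at hjump
    exact hK₀ (hKc'.symm.trans hjump)

end Mesh

section EssBdd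

/-! ### Essentially bounded functions -/

variable {Z E F : Type*} [MeasurableSpace Z] [NormedAddCommGroup E]
  [NormedAddCommGroup F] {μ : Measure Z}

/-- `f` is almost everywhere strongly measurable and essentially bounded. -/
def EssBdd (μ : Measure Z) (f : Z → E) : Prop :=
  AEStronglyMeasurable f μ ∧ ∃ C, ∀ᵐ z ∂μ, ‖f z‖ ≤ C

theorem EssBdd.add {f g : Z → E} (hf : EssBdd μ f) (hg : EssBdd μ g) :
    EssBdd μ fun z => f z + g z := by
  obtain ⟨C, hC⟩ := hf.2
  obtain ⟨C', hC'⟩ := hg.2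
  refine ⟨hf.1.add hg.1, C + C', ?_⟩
  filter_upwards [hC, hC'] with z h h'
  exact (norm_add_le _ _).trans (add_le_add h h')

theorem EssBdd.neg {f : Z → E} (hf : EssBdd μ f) : EssBdd μ fun z => -f z := by
  obtain ⟨C, hC⟩ := hf.2
  refine ⟨hf.1.neg, C, ?_⟩
  filter_upwards [hC] with z h
  rwa [norm_neg]

theorem EssBdd.sub {f g : Z → E} (hf : EssBdd μ f) (hg : EssBdd μ g) :
    EssBdd μ fun z => f z - g z := by
  simpa only [sub_eq_add_neg] using hf.add hg.neg

theorem EssBdd.const (c : E) : EssBdd μ fun _ : Z => c :=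
  ⟨aestronglyMeasurable_const, ‖c‖, Eventually.of_forall fun _ => le_rfl⟩

theorem EssBdd.sum {ι : Type*} (s : Finset ι) {f : ι → Z → E} (hf : ∀ i ∈ s, EssBdd μ (f i)) :
    EssBdd μ fun z => ∑ i ∈ s, f i z := by
  classical
  induction s using Finset.induction_on with
  | empty => simpa using EssBdd.const (0 : E)
  | insert i s hi ih =>
    simp only [Finset.sum_insert hi]
    exact (hf i (Finset.mem_insert_self i s)).add
      (ih fun j hj => hf j (Finset.mem_insert_of_mem hj))

theorem EssBdd.smul [NormedSpace ℝ E] {c : Z → ℝ} {f : Z → E} (hc : EssBdd μ c) (hf : EssBdd μ f) :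
    EssBdd μ fun z => c z • f z := by
  obtain ⟨C, hC⟩ := hc.2
  obtain ⟨C', hC'⟩ := hf.2
  refine ⟨hc.1.smul hf.1, C * C', ?_⟩
  filter_upwards [hC, hC'] with z h h'
  rw [norm_smul]
  exact mul_le_mul h h' (norm_nonneg _) ((norm_nonneg _).trans h)

theorem EssBdd.mul {c f : Z → ℝ} (hc : EssBdd μ c) (hf : EssBdd μ f) :
    EssBdd μ fun z => c z * f z := hc.smul hf

theorem EssBdd.clm_apply [NormedSpace ℝ E] [NormedSpace ℝ F] {A : Z → E →L[ℝ] F}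
    {f : Z → E} (hA : EssBdd μ A) (hf : EssBdd μ f) :
    EssBdd μ fun z => A z (f z) := by
  obtain ⟨C, hC⟩ := hA.2
  obtain ⟨C', hC'⟩ := hf.2
  refine ⟨isBoundedBilinearMap_apply.continuous.comp_aestronglyMeasurable (hA.1.prodMk hf.1),
    C * C', ?_⟩
  filter_upwards [hC, hC'] with z h h'
  exact ((A z).le_opNorm _).trans (mul_le_mul h h' (norm_nonneg _) ((norm_nonneg _).trans h))

theorem EssBdd.comp_clm [NormedSpace ℝ E] [NormedSpace ℝ F] {f : Z → E}
    (hf : EssBdd μ f) (A : E →L[ℝ] F) :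
    EssBdd μ fun z => A (f z) := EssBdd.clm_apply (EssBdd.const A) hf

theorem EssBdd.inner {G : Type*} [NormedAddCommGroup G] [InnerProductSpace ℝ G] {f g : Z → G}
    (hf : EssBdd μ f) (hg : EssBdd μ g) : EssBdd μ fun z => inner ℝ (f z) (g z) := by
  obtain ⟨C, hC⟩ := hf.2
  obtain ⟨C', hC'⟩ := hg.2
  refine ⟨hf.1.inner hg.1, C * C', ?_⟩
  filter_upwards [hC, hC'] with z h h'
  exact (norm_inner_le_norm _ _).trans
    (mul_le_mul h h' (norm_nonneg _) ((norm_nonneg _).trans h))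

theorem EssBdd.integrable [IsFiniteMeasure μ] {f : Z → E} (hf : EssBdd μ f) : Integrable f μ := by
  obtain ⟨C, hC⟩ := hf.2
  exact Integrable.of_bound hf.1 C hC

theorem EssBdd.integrable_mul {σ f : Z → ℝ} (hσ : Integrable σ μ) (hf : EssBdd μ f) :
    Integrable (fun z => σ z * f z) μ := by
  obtain ⟨C, hC⟩ := hf.2
  exact hσ.mul_bdd hf.1 hC

theorem EssBdd.indicator {f : Z → E} (hf : EssBdd μ f) {s : Set Z} (hs : MeasurableSet s) :
    EssBdd μ (s.indicator f) := by
  obtain ⟨C, hC⟩ := hf.2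
  refine ⟨hf.1.indicator hs, C, ?_⟩
  filter_upwards [hC] with z h
  exact (norm_indicator_le_norm_self _ _).trans h

theorem EssBdd.comp_quasiMeasurePreserving {X : Type*} [MeasurableSpace X] {ν : Measure X}
    {f : X → E} (hf : EssBdd ν f) {ξ : Z → X} (hξ : Measure.QuasiMeasurePreserving ξ μ ν) :
    EssBdd μ fun z => f (ξ z) := by
  obtain ⟨C, hC⟩ := hf.2
  exact ⟨hf.1.comp_quasiMeasurePreserving hξ, C, hξ.ae hC⟩

end EssBdd

section Operators

/-! ### Linear operators on piecewise polynomials -/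

variable {d p : ℕ} {Ω : Set (Space d)} {T : Finset (Set (Space d))} {Z E : Type*}
  [MeasurableSpace Z] [NormedAddCommGroup E]

/-- Piecewise space-time polynomials of total degree at most `p`. -/
def pwPoly (T : Finset (Set (Space d))) (p : ℕ) : Submodule ℝ (T → ℝ → Space d → ℝ) :=
  Submodule.pi univ fun _ => polySpace d p

theorem pwPoly_apply {v : T → ℝ → Space d → ℝ} (hv : v ∈ pwPoly T p) (K : T) :
    v K ∈ polySpace d p := hv K (mem_univ K)

/-- The time derivative on piecewise polynomials. -/
noncomputable def dtL (T : Finset (Set (Space d))) (p : ℕ) : pwPoly T p →ₗ[ℝ] pwPoly T p where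
  toFun v := ⟨dt v.1, fun K _ => polySpace_dt (pwPoly_apply v.2 K)⟩
  map_add' u v := by
    ext K t x
    exact ((polySpace_hasDerivAt (pwPoly_apply u.2 K) t x).add
      (polySpace_hasDerivAt (pwPoly_apply v.2 K) t x)).deriv
  map_smul' c v := by
    ext K t x
    exact ((polySpace_hasDerivAt (pwPoly_apply v.2 K) t x).const_mul c).deriv

/-- The operator `v ↦ ∑_K v_K W_K` with weights `W_K` that depend on the position. -/
noncomputable def valOp [NormedSpace ℝ E] (p : ℕ) (W : T → Space d → E) :
    pwPoly T p →ₗ[ℝ] (ℝ → Space d → E) where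
  toFun v t x := ∑ K, v.1 K t x • W K x
  map_add' u v := by
    funext t x
    simp [add_smul, Finset.sum_add_distrib]
  map_smul' c v := by
    funext t x
    simp [mul_smul, Finset.smul_sum]

/-- The operator `v ↦ ∑_K W_K(∇v_K)` with weights `W_K` that depend on the position. -/
noncomputable def gradOp [NormedSpace ℝ E] (p : ℕ) (W : T → Space d → Space d →L[ℝ] E) :
    pwPoly T p →ₗ[ℝ] (ℝ → Space d → E) where
  toFun v t x := ∑ K, W K x (gradient (fun y => v.1 K t y) x)
  map_add' u v := by
    funext t x
    simp only [Pi.add_apply, ← Finset.sum_add_distrib, ← map_add]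
    refine Finset.sum_congr rfl fun K _ => congrArg _ ?_
    have h := (polySpace_hasGradientAt (pwPoly_apply u.2 K) t x).hasFDerivAt.add
      (polySpace_hasGradientAt (pwPoly_apply v.2 K) t x).hasFDerivAt
    rw [← map_add] at h
    exact (hasGradientAt_iff_hasFDerivAt.2 h).gradient
  map_smul' c v := by
    funext t x
    simp only [Pi.smul_apply, Finset.smul_sum, ← map_smul, RingHom.id_apply]
    refine Finset.sum_congr rfl fun K _ => congrArg _ ?_
    have h := (polySpace_hasGradientAt (pwPoly_apply v.2 K) t x).hasFDerivAt.const_smul c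
    rw [← map_smul] at h
    exact (hasGradientAt_iff_hasFDerivAt.2 h).gradient

theorem hasDerivAt_valOp [NormedSpace ℝ E] (W : T → Space d → E) (v : pwPoly T p)
    (t : ℝ) (x : Space d) :
    HasDerivAt (fun s => valOp p W v s x) (valOp p W (dtL T p v) t x) t := by
  refine HasDerivAt.fun_sum fun K _ => ?_
  exact (polySpace_hasDerivAt (pwPoly_apply v.2 K) t x).smul_const _

theorem hasDerivAt_gradOp [NormedSpace ℝ E] (W : T → Space d → Space d →L[ℝ] E)
    (v : pwPoly T p) (t : ℝ)
    (x : Space d) : HasDerivAt (fun s => gradOp p W v s x) (gradOp p W (dtL T p v) t x) t := by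
  refine HasDerivAt.fun_sum fun K _ => ?_
  exact (W K x).hasFDerivAt.comp_hasDerivAt t
    (polySpace_hasDerivAt_gradient (pwPoly_apply v.2 K) t x)

/-- `z ↦ (τ z, ξ z)` is a measurable map to space-time with essentially bounded range. Slabs and
time slices, over `Ω` and over skeletons, are treated at once by means of such maps. -/
structure IsBoundedChart (μ : Measure Z) (τ : Z → ℝ) (ξ : Z → Space d) : Prop where
  time : AEMeasurable τ μ
  space : AEMeasurable ξ μ
  bounded : ∃ S : Set (ℝ × Space d), IsCompact S ∧ ∀ᵐ z ∂μ, (τ z, ξ z) ∈ S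

variable {μ : Measure Z} {τ : Z → ℝ} {ξ : Z → Space d}

theorem IsBoundedChart.essBdd_comp (h : IsBoundedChart μ τ ξ) {g : ℝ × Space d → E}
    (hg : Continuous g) : EssBdd μ fun z => g (τ z, ξ z) := by
  obtain ⟨S, hS, hmem⟩ := h.bounded
  obtain ⟨C, hC⟩ := hS.exists_bound_of_continuousOn hg.continuousOn
  refine ⟨(hg.comp_aestronglyMeasurable (h.time.prodMk h.space).aestronglyMeasurable), C, ?_⟩
  filter_upwards [hmem] with z hz
  exact hC _ hz

theorem IsBoundedChart.essBdd_valOp [NormedSpace ℝ E] (h : IsBoundedChart μ τ ξ)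
    {W : T → Space d → E}
    (hW : ∀ K, EssBdd μ fun z => W K (ξ z)) (v : pwPoly T p) :
    EssBdd μ fun z => valOp p W v (τ z) (ξ z) :=
  EssBdd.sum _ fun K _ =>
    (h.essBdd_comp (polySpace_continuous (pwPoly_apply v.2 K))).smul (hW K)

theorem IsBoundedChart.essBdd_gradOp [NormedSpace ℝ E] (h : IsBoundedChart μ τ ξ)
    {W : T → Space d → Space d →L[ℝ] E} (hW : ∀ K, EssBdd μ fun z => W K (ξ z))
    (v : pwPoly T p) : EssBdd μ fun z => gradOp p W v (τ z) (ξ z) :=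
  EssBdd.sum _ fun K _ =>
    (hW K).clm_apply (h.essBdd_comp (polySpace_continuous_gradient (pwPoly_apply v.2 K)))

/-! ### Averages, jumps and broken functions as weighted sums over the elements -/

theorem measurable_adjacent {α : Type*} [MeasurableSpace α] (φ : Finset T → α) :
    Measurable fun x : Space d => φ (adjacent T x) := by
  let _ : MeasurableSpace (Finset T) := ⊤
  have h : Measurable fun x : Space d => adjacent T x := by
    refine measurable_to_countable' fun S => ?_
    have : (fun x : Space d => adjacent T x) ⁻¹' {S} =
        ⋂ K : T, {x | x ∈ closure (K : Set (Space d)) ↔ K ∈ S} := by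
      ext x
      simp only [mem_preimage, mem_singleton_iff, mem_iInter, Finset.ext_iff, mem_adjacent]
      rfl
    rw [this]
    refine MeasurableSet.iInter fun K => ?_
    by_cases hK : K ∈ S
    · simpa [hK] using (isClosed_closure (s := (K : Set (Space d)))).measurableSet
    · have e : {x | x ∈ closure (K : Set (Space d)) ↔ K ∈ S} = (closure (K : Set (Space d)))ᶜ := by
        ext x; simp [hK]
      rw [e]
      exact isClosed_closure.measurableSet.compl
  exact measurable_from_top.comp h

theorem essBdd_adjacent₂ {T' : Finset (Set (Space d))} (hξ : AEMeasurable ξ μ)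
    (φ : Finset T → Finset T' → ℝ) :
    EssBdd μ fun z => φ (adjacent T (ξ z)) (adjacent T' (ξ z)) := by
  let _ : MeasurableSpace (Finset T) := ⊤
  let _ : MeasurableSpace (Finset T') := ⊤
  have h : Measurable fun x : Space d => (adjacent T x, adjacent T' x) :=
    (measurable_adjacent id).prodMk (measurable_adjacent id)
  have h2 : Measurable fun q : Finset T × Finset T' => φ q.1 q.2 :=
    measurable_of_countable _
  refine ⟨((h2.comp h).comp_aemeasurable hξ).aestronglyMeasurable,
    ∑ S, ∑ S', ‖φ S S'‖, Eventually.of_forall fun z => ?_⟩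
  calc ‖φ (adjacent T (ξ z)) (adjacent T' (ξ z))‖
      ≤ ∑ S', ‖φ (adjacent T (ξ z)) S'‖ :=
        Finset.single_le_sum (f := fun S' => ‖φ (adjacent T (ξ z)) S'‖)
          (fun _ _ => norm_nonneg _) (Finset.mem_univ _)
    _ ≤ _ := Finset.single_le_sum (f := fun S => ∑ S', ‖φ S S'‖)
          (fun _ _ => Finset.sum_nonneg fun _ _ => norm_nonneg _) (Finset.mem_univ _)

/-- The outward normal on the boundary of an element, continued by zero. -/
noncomputable def normalW (T : Finset (Set (Space d))) (K : T) (x : Space d) : Space d :=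
  (frontier (K : Set (Space d))).indicator (outwardNormal (K : Set (Space d))) x

/-- The weight of an element in averages on the skeleton. -/
noncomputable def avgW (T : Finset (Set (Space d))) (K : T) (x : Space d) : ℝ :=
  open scoped Classical in if K ∈ adjacent T x then ((adjacent T x).card : ℝ)⁻¹ else 0

theorem outwardNormal_eq_zero_of_mem {K : Set (Space d)} (hK : IsOpen K) {x : Space d}
    (hx : x ∈ K) : outwardNormal K x = 0 := by
  rw [outwardNormal, dif_neg]
  rintro ⟨ν, ⟨hν, hle⟩, -⟩
  have hlim : Tendsto (fun s : ℝ => x + s • ν) (𝓝[>] 0) (𝓝 x) := by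
    have : Continuous fun s : ℝ => x + s • ν := by fun_prop
    simpa using (this.tendsto 0).mono_left nhdsWithin_le_nhds
  obtain ⟨s, hs, hs0⟩ := ((hlim.eventually (hK.mem_nhds hx)).and self_mem_nhdsWithin).exists
  have hs0' : (0 : ℝ) < s := hs0
  have := hle _ hs
  rw [add_sub_cancel_left, real_inner_smul_right, real_inner_self_eq_norm_sq, hν] at this
  linarith

open scoped Classical in
theorem IsMesh.normalW_eq (hd : 1 ≤ d) (hT : IsMesh Ω T) (K : T) (x : Space d) :
    normalW T K x = if x ∈ closure (K : Set (Space d)) then outwardNormal (K : Set (Space d)) x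
      else 0 := by
  have hf := (hT.isOpen hd K.2).frontier_eq
  by_cases hfr : x ∈ frontier (K : Set (Space d))
  · rw [normalW, indicator_of_mem hfr, if_pos (frontier_subset_closure hfr)]
  · rw [normalW, indicator_of_notMem hfr]
    split_ifs with hc
    · rw [outwardNormal_eq_zero_of_mem (hT.isOpen hd K.2)]
      by_contra h
      exact hfr (by rw [hf]; exact ⟨hc, h⟩)
    · rfl

theorem IsMesh.jump_eq (hd : 1 ≤ d) (hT : IsMesh Ω T) (f : T → Space d → ℝ) (x : Space d) :
    jump f x = ∑ K, f K x • normalW T K x := by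
  classical
  simp only [jump, hT.normalW_eq hd]
  simp [adjacent, Finset.sum_filter]

theorem IsMesh.jumpVec_eq (hd : 1 ≤ d) (hT : IsMesh Ω T) (F : T → Space d → Space d)
    (x : Space d) : jumpVec Ω F x =
      ∑ K, (frontier Ω)ᶜ.indicator (fun x => innerSL ℝ (normalW T K x)) x (F K x) := by
  classical
  by_cases hx : x ∈ frontier Ω
  · simp [jumpVec, hx]
  · simp only [jumpVec, if_neg hx, indicator_of_mem (mem_compl hx), hT.normalW_eq hd]
    rw [adjacent, Finset.sum_filter]
    refine Finset.sum_congr rfl fun K _ => ?_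
    split_ifs with h
    · exact real_inner_comm _ _
    · simp

theorem avg_eq {F : Type*} [AddCommGroup F] [Module ℝ F] (f : T → Space d → F) (x : Space d) :
    avg f x = ∑ K, avgW T K x • f K x := by
  classical
  simp only [avg, avgW, ite_smul, zero_smul, Finset.smul_sum]
  rw [← Finset.sum_filter]
  congr 1
  ext K
  simp

theorem IsMesh.essBdd_normalW (hd : 1 ≤ d) (hT : IsMesh Ω T) (K : T) :
    EssBdd (surf d) (normalW T K) := by
  obtain ⟨⟨H, hH⟩, hne, -⟩ := hT.exists_isPolyhedron hd K.2
  refine ⟨(aestronglyMeasurable_indicator_iff isClosed_frontier.measurableSet).2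
    (hH.aestronglyMeasurable_outwardNormal hne), 1, Eventually.of_forall fun x => ?_⟩
  exact (norm_indicator_le_norm_self _ _).trans (norm_outwardNormal_le _ _)

/-- The indicator of an element, the weight with which it enters `broken`. -/
noncomputable def brokenW (T : Finset (Set (Space d))) (K : T) (x : Space d) : ℝ :=
  (K : Set (Space d)).indicator 1 x

theorem broken_eq {F : Type*} [AddCommGroup F] [Module ℝ F] (f : T → Space d → F) (x : Space d) :
    broken f x = ∑ K, brokenW T K x • f K x := by
  refine Finset.sum_congr rfl fun K _ => ?_
  by_cases h : x ∈ (K : Set (Space d))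
  · simp [brokenW, h]
  · simp [brokenW, h]

theorem IsMesh.essBdd_brokenW (hd : 1 ≤ d) (hT : IsMesh Ω T) (hξ : AEMeasurable ξ μ) (K : T) :
    EssBdd μ fun z => brokenW T K (ξ z) := by
  have hm : Measurable (brokenW T K) :=
    measurable_one.indicator (hT.isOpen hd K.2).measurableSet
  refine ⟨(hm.comp_aemeasurable hξ).aestronglyMeasurable, 1, Eventually.of_forall fun z => ?_⟩
  refine (norm_indicator_le_norm_self _ _).trans ?_
  simp

end Operators

section Operators

/-! ### The operators of the method -/

variable {d : ℕ}

/-- The operator `v ↦ [v]`. -/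
noncomputable def jumpOp (T : Finset (Set (Space d))) (p : ℕ) :
    pwPoly T p →ₗ[ℝ] (ℝ → Space d → Space d) := valOp p (normalW T)

/-- The operator `v ↦ {a ∇v}`. -/
noncomputable def avgFluxOp (a : Space d → ℝ) (T : Finset (Set (Space d))) (p : ℕ) :
    pwPoly T p →ₗ[ℝ] (ℝ → Space d → Space d) :=
  gradOp p fun K x => (avgW T K x * coeffOn a (K : Set (Space d))) • ContinuousLinearMap.id ℝ _

/-- The operator `v ↦ [a ∇v]`. -/
noncomputable def jumpFluxOp (Ω : Set (Space d)) (a : Space d → ℝ) (T : Finset (Set (Space d)))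
    (p : ℕ) : pwPoly T p →ₗ[ℝ] (ℝ → Space d → ℝ) :=
  gradOp p fun K x => coeffOn a (K : Set (Space d)) •
    (frontier Ω)ᶜ.indicator (fun x => innerSL ℝ (normalW T K x)) x

/-- The operator that sends the family `v` to the function with restrictions `v_K`. -/
noncomputable def brokenOp (T : Finset (Set (Space d))) (p : ℕ) :
    pwPoly T p →ₗ[ℝ] (ℝ → Space d → ℝ) := valOp p (brokenW T)

/-- The broken gradient. -/
noncomputable def brokenGradOp (T : Finset (Set (Space d))) (p : ℕ) :
    pwPoly T p →ₗ[ℝ] (ℝ → Space d → Space d) :=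
  gradOp p fun K x => brokenW T K x • ContinuousLinearMap.id ℝ _

variable {p : ℕ} {Ω : Set (Space d)} {T : Finset (Set (Space d))}

theorem jump_atTime (hd : 1 ≤ d) (hT : IsMesh Ω T) (v : pwPoly T p) (t : ℝ) (x : Space d) :
    jump (atTime v.1 t) x = jumpOp T p v t x := hT.jump_eq hd _ x

theorem avg_flux (a : Space d → ℝ) (v : pwPoly T p) (t : ℝ) (x : Space d) :
    avg (flux a v.1 t) x = avgFluxOp a T p v t x := by
  rw [avg_eq]
  exact Finset.sum_congr rfl fun K _ => by simp [flux, mul_smul]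

theorem jumpVec_flux (hd : 1 ≤ d) (hT : IsMesh Ω T) (a : Space d → ℝ) (v : pwPoly T p) (t : ℝ)
    (x : Space d) : jumpVec Ω (flux a v.1 t) x = jumpFluxOp Ω a T p v t x := by
  rw [hT.jumpVec_eq hd]
  exact Finset.sum_congr rfl fun K _ => by simp [flux]

theorem broken_atTime (v : pwPoly T p) (t : ℝ) (x : Space d) :
    broken (atTime v.1 t) x = brokenOp T p v t x := by
  rw [broken_eq]
  exact Finset.sum_congr rfl fun K _ => by simp [atTime, mul_comm]

theorem broken_grad (v : pwPoly T p) (t : ℝ) (x : Space d) :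
    broken (grad v.1 t) x = brokenGradOp T p v t x := by
  rw [broken_eq]
  exact Finset.sum_congr rfl fun K _ => by simp [grad]

theorem sum_brokenW_smul {F : Type*} [AddCommGroup F] [Module ℝ F] (hd : 1 ≤ d) (hT : IsMesh Ω T)
    (f : T → F) {K : T} {x : Space d} (hx : x ∈ (K : Set (Space d))) :
    ∑ K', brokenW T K' x • f K' = f K := by
  rw [Finset.sum_eq_single_of_mem K (Finset.mem_univ K)]
  · simp [brokenW, hx]
  · intro K' _ hne
    have : x ∉ (K' : Set (Space d)) := fun h =>
      hne (Subtype.ext (hT.eq_of_mem_of_mem_closure hd K'.2 K.2 h (subset_closure hx)))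
    simp [brokenW, this]

theorem brokenOp_of_mem (hd : 1 ≤ d) (hT : IsMesh Ω T) (v : pwPoly T p) (t : ℝ) {K : T}
    {x : Space d} (hx : x ∈ (K : Set (Space d))) : brokenOp T p v t x = v.1 K t x := by
  rw [← sum_brokenW_smul hd hT (fun K => v.1 K t x) hx]
  exact Finset.sum_congr rfl fun K _ => by simp [mul_comm]

theorem brokenGradOp_of_mem (hd : 1 ≤ d) (hT : IsMesh Ω T) (v : pwPoly T p) (t : ℝ) {K : T}
    {x : Space d} (hx : x ∈ (K : Set (Space d))) :
    brokenGradOp T p v t x = gradient (fun y => v.1 K t y) x := by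
  rw [← sum_brokenW_smul hd hT (fun K => gradient (fun y => v.1 K t y) x) hx]
  rfl

section EssBddOps

variable {Z : Type*} [MeasurableSpace Z] {μ : Measure Z} {τ : Z → ℝ} {ξ : Z → Space d}

theorem essBdd_jumpOp (hd : 1 ≤ d) (hT : IsMesh Ω T) (h : IsBoundedChart μ τ ξ)
    (hξ : Measure.QuasiMeasurePreserving ξ μ (surf d)) (v : pwPoly T p) :
    EssBdd μ fun z => jumpOp T p v (τ z) (ξ z) :=
  h.essBdd_valOp (fun K => (hT.essBdd_normalW hd K).comp_quasiMeasurePreserving hξ) v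

theorem essBdd_avgW (hξ : AEMeasurable ξ μ) (K : T) : EssBdd μ fun z => avgW T K (ξ z) := by
  open scoped Classical in
  exact essBdd_adjacent₂ (T := T) (T' := T) hξ
    (fun S _ => if K ∈ S then (S.card : ℝ)⁻¹ else 0)

theorem essBdd_avgFluxOp (h : IsBoundedChart μ τ ξ) (a : Space d → ℝ) (v : pwPoly T p) :
    EssBdd μ fun z => avgFluxOp a T p v (τ z) (ξ z) :=
  h.essBdd_gradOp (fun K => ((essBdd_avgW h.space K).mul (EssBdd.const _)).smul (EssBdd.const _)) v

theorem essBdd_jumpFluxOp (hd : 1 ≤ d) (hT : IsMesh Ω T) (h : IsBoundedChart μ τ ξ)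
    (hξ : Measure.QuasiMeasurePreserving ξ μ (surf d)) (a : Space d → ℝ) (v : pwPoly T p) :
    EssBdd μ fun z => jumpFluxOp Ω a T p v (τ z) (ξ z) := by
  refine h.essBdd_gradOp (fun K => (EssBdd.const _).smul ?_) v
  have h1 : EssBdd (surf d) fun x => innerSL ℝ (normalW T K x) :=
    (hT.essBdd_normalW hd K).comp_clm (innerSL ℝ)
  exact (h1.indicator isClosed_frontier.measurableSet.compl).comp_quasiMeasurePreserving hξ

theorem essBdd_brokenOp (hd : 1 ≤ d) (hT : IsMesh Ω T) (h : IsBoundedChart μ τ ξ)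
    (v : pwPoly T p) : EssBdd μ fun z => brokenOp T p v (τ z) (ξ z) :=
  h.essBdd_valOp (hT.essBdd_brokenW hd h.space) v

theorem essBdd_brokenGradOp (hd : 1 ≤ d) (hT : IsMesh Ω T) (h : IsBoundedChart μ τ ξ)
    (v : pwPoly T p) : EssBdd μ fun z => brokenGradOp T p v (τ z) (ξ z) :=
  h.essBdd_gradOp (fun K => (hT.essBdd_brokenW hd h.space K).smul (EssBdd.const _)) v

theorem isBoundedChart_static {S : Set (Space d)} {ν : Measure (Space d)} (hS : MeasurableSet S)
    (hb : Bornology.IsBounded S) (s : ℝ) :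
    IsBoundedChart (ν.restrict S) (fun _ => s) id where
  time := aemeasurable_const
  space := aemeasurable_id
  bounded := ⟨{s} ×ˢ closure S, isCompact_singleton.prod hb.isCompact_closure, by
    filter_upwards [ae_restrict_mem hS] with x hx
    exact ⟨rfl, subset_closure hx⟩⟩

theorem quasiMeasurePreserving_id_restrict (ν : Measure (Space d)) (S : Set (Space d)) :
    Measure.QuasiMeasurePreserving id (ν.restrict S) ν :=
  ⟨measurable_id, by simpa using Measure.absolutelyContinuous_of_le Measure.restrict_le_self⟩

end EssBddOps

/-! ### Coefficient and meshsize -/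

variable (D : Discretization d)

theorem coeffOn_eq {n : Fin (D.M + 1)} {K : Set (Space d)} (hK : K ∈ D.mesh n) {x : Space d}
    (hx : x ∈ K) : coeffOn D.a K = D.a x := by
  have hne : K.Nonempty := ⟨x, hx⟩
  rw [coeffOn, dif_pos hne]
  exact D.a_const n K hK _ hne.some_mem x hx

theorem ae_mem_element (hd : 1 ≤ d) {T : Finset (Set (Space d))} (hT : IsMesh Ω T) :
    ∀ᵐ x ∂volume.restrict Ω, ∃ K : T, x ∈ (K : Set (Space d)) := by
  have h1 := hT.ae_eq_iUnion hd
  have h2 : ∀ᵐ x ∂volume.restrict (⋃ K ∈ T, K), ∃ K : T, x ∈ (K : Set (Space d)) := by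
    filter_upwards [ae_restrict_mem (Finset.measurableSet_biUnion _ fun K hK =>
      (hT.isOpen hd hK).measurableSet)] with x hx
    obtain ⟨K, hK, hxK⟩ := mem_iUnion₂.1 hx
    exact ⟨⟨K, hK⟩, hxK⟩
  rwa [Measure.restrict_congr_set h1]

theorem essBdd_coeff (hd : 1 ≤ d) : EssBdd (volume.restrict D.Ω) D.a := by
  have hT := D.isMesh 0
  have h1 : EssBdd (volume.restrict D.Ω) fun x =>
      ∑ K : D.mesh 0, brokenW (D.mesh 0) K x * coeffOn D.a (K : Set (Space d)) :=
    EssBdd.sum _ fun K _ => (hT.essBdd_brokenW hd aemeasurable_id K).mul (EssBdd.const _)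
  have h2 : D.a =ᵐ[volume.restrict D.Ω] fun x =>
      ∑ K : D.mesh 0, brokenW (D.mesh 0) K x * coeffOn D.a (K : Set (Space d)) := by
    filter_upwards [ae_mem_element hd hT] with x ⟨K, hxK⟩
    rw [← coeffOn_eq D K.2 hxK]
    exact (sum_brokenW_smul hd hT (fun K => coeffOn D.a (K : Set (Space d))) hxK).symm
  obtain ⟨C, hC⟩ := h1.2
  exact ⟨h1.1.congr h2.symm, C, by filter_upwards [hC, h2] with x h h'; rwa [h']⟩

theorem diam_element_pos (hd : 1 ≤ d) {T : Finset (Set (Space d))} (hT : IsMesh Ω T)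
    {K : Set (Space d)} (hK : K ∈ T) : 0 < Metric.diam K := by
  obtain ⟨-, ⟨x, hx⟩, hb⟩ := hT.exists_isPolyhedron hd hK
  have hlim : Tendsto (fun s : ℝ => x + s • (EuclideanSpace.single ⟨0, hd⟩ 1 : Space d))
      (𝓝[>] 0) (𝓝 x) := by
    have : Continuous fun s : ℝ => x + s • (EuclideanSpace.single ⟨0, hd⟩ 1 : Space d) := by
      fun_prop
    simpa using (this.tendsto 0).mono_left nhdsWithin_le_nhds
  obtain ⟨s, hs, hs0⟩ := ((hlim.eventually ((hT.isOpen hd hK).mem_nhds hx)).and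
    self_mem_nhdsWithin).exists
  have hs0' : (0 : ℝ) < s := hs0
  refine lt_of_lt_of_le ?_ (Metric.dist_le_diam_of_mem hb hs hx)
  rw [dist_eq_norm, add_sub_cancel_left, norm_smul]
  simpa using hs0'.ne'

/-- Elements that touch the same point of the skeleton have, almost everywhere, comparable
diameters. -/
theorem ae_diam_le {T : Finset (Set (Space d))} {c : ℝ} (hq : LocallyQuasiUniform T c) :
    ∀ᵐ x ∂surf d, ∀ K ∈ adjacent T x, ∀ K' ∈ adjacent T x,
      Metric.diam (K : Set (Space d)) ≤ (1 + |c|) * Metric.diam (K' : Set (Space d)) := by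
  have h : ∀ᵐ x ∂surf d, ∀ K K' : T, x ∈ closure (K : Set (Space d)) →
      x ∈ closure (K' : Set (Space d)) →
      Metric.diam (K : Set (Space d)) ≤ (1 + |c|) * Metric.diam (K' : Set (Space d)) := by
    rw [Filter.eventually_all]
    intro K
    rw [Filter.eventually_all]
    intro K'
    have hd0 : 0 ≤ Metric.diam (K' : Set (Space d)) := Metric.diam_nonneg
    by_cases hle : Metric.diam (K : Set (Space d)) ≤ (1 + |c|) * Metric.diam (K' : Set (Space d))
    · exact Eventually.of_forall fun _ _ _ => hle
    · have hne : (K : Set (Space d)) ≠ K' := by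
        intro h
        rw [h] at hle
        exact hle (by nlinarith [abs_nonneg c])
      have h0 : surf d (closure (K : Set (Space d)) ∩ closure (K' : Set (Space d))) = 0 := by
        by_contra h0
        have := hq K K.2 K' K'.2 hne h0
        exact hle (by nlinarith [le_abs_self c])
      filter_upwards [measure_eq_zero_iff_ae_notMem.1 h0] with x hx h1 h2
      exact absurd ⟨h1, h2⟩ hx
  filter_upwards [h] with x hx K hK K' hK'
  exact hx K K' (mem_adjacent.1 hK) (mem_adjacent.1 hK')

theorem meshsize_le {T : Finset (Set (Space d))} {x : Space d} {c : ℝ}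
    (h : ∀ K ∈ adjacent T x, ∀ K' ∈ adjacent T x,
      Metric.diam (K : Set (Space d)) ≤ c * Metric.diam (K' : Set (Space d)))
    {K : T} (hK : K ∈ adjacent T x) : meshsize T x ≤ c * Metric.diam (K : Set (Space d)) := by
  have hc : (0 : ℝ) < (adjacent T x).card := by
    exact_mod_cast Finset.card_pos.2 ⟨K, hK⟩
  rw [meshsize, avg, smul_eq_mul, inv_mul_le_iff₀ hc, ← nsmul_eq_mul]
  exact Finset.sum_le_card_nsmul _ _ _ fun K' hK' => h K' hK' K hK

theorem meshsize_pos (hd : 1 ≤ d) {T : Finset (Set (Space d))} (hT : IsMesh Ω T) {x : Space d}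
    (hne : (adjacent T x).Nonempty) : 0 < meshsize T x := by
  have hc : (0 : ℝ) < (adjacent T x).card := by exact_mod_cast Finset.card_pos.2 hne
  rw [meshsize, avg, smul_eq_mul]
  exact mul_pos (inv_pos.2 hc) (Finset.sum_pos (fun K _ => diam_element_pos hd hT K.2) hne)

theorem adjacent_nonempty {T : Finset (Set (Space d))} (hT : IsMesh Ω T) {x : Space d}
    (hx : x ∈ closure Ω) : (adjacent T x).Nonempty := by
  rw [hT.cover] at hx
  obtain ⟨K, hK, hxK⟩ := mem_iUnion₂.1 hx
  exact ⟨⟨K, hK⟩, mem_adjacent.2 hxK⟩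

/-- Jensen's inequality for the square of the norm. -/
theorem norm_sum_smul_sq_le {ι E : Type*} [NormedAddCommGroup E] [NormedSpace ℝ E] (s : Finset ι)
    {θ : ι → ℝ} (hθ : ∀ i ∈ s, 0 ≤ θ i) (h1 : ∑ i ∈ s, θ i = 1) (z : ι → E) :
    ‖∑ i ∈ s, θ i • z i‖ ^ 2 ≤ ∑ i ∈ s, θ i * ‖z i‖ ^ 2 := by
  have hconv : ConvexOn ℝ univ fun x : E => ‖x‖ ^ 2 :=
    convexOn_univ_norm.pow (fun _ _ => norm_nonneg _) 2
  simpa using hconv.map_sum_le hθ h1 fun i _ => mem_univ (z i)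

theorem mem_closure_inter_of_convex {K K' : Set (Space d)} (hK : IsOpen K) (hK' : IsOpen K')
    (hc : Convex ℝ K) (hc' : Convex ℝ K') (hne : (K ∩ K').Nonempty) {x : Space d}
    (hx : x ∈ closure K) (hx' : x ∈ closure K') : x ∈ closure (K ∩ K') := by
  obtain ⟨y, hy, hy'⟩ := hne
  have hlim : Tendsto (fun s : ℝ => (1 - s) • x + s • y) (𝓝[>] 0) (𝓝 x) := by
    have : Continuous fun s : ℝ => (1 - s) • x + s • y := by fun_prop
    simpa using (this.tendsto 0).mono_left nhdsWithin_le_nhds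
  refine mem_closure_of_tendsto hlim ?_
  have h1 : ∀ᶠ s in 𝓝[>] (0 : ℝ), s < 1 := nhdsWithin_le_nhds (eventually_lt_nhds one_pos)
  filter_upwards [h1, self_mem_nhdsWithin] with s hs1 (hs0 : 0 < s)
  constructor
  · have := hc.combo_closure_interior_mem_interior hx (by rwa [hK.interior_eq]) (a := 1 - s)
      (b := s) (by linarith) hs0 (by ring)
    rwa [hK.interior_eq] at this
  · have := hc'.combo_closure_interior_mem_interior hx' (by rwa [hK'.interior_eq]) (a := 1 - s)
      (b := s) (by linarith) hs0 (by ring)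
    rwa [hK'.interior_eq] at this

end Operators

section Overlay

/-! ### Consistency terms on the overlay of two meshes -/

variable {d : ℕ} {p : ℕ} {Ω : Set (Space d)} {T T' : Finset (Set (Space d))}

theorem IsMesh.setIntegral_inter_eq_sum (hd : 1 ≤ d) (hT : IsMesh Ω T) {g : Space d → ℝ}
    {S : Set (Space d)}
    (hS : MeasurableSet S) (hg : IntegrableOn g (Ω ∩ S)) :
    ∫ x in Ω ∩ S, g x = ∑ K : T, ∫ x in (K : Set (Space d)) ∩ S, g x := by
  have h1 : (Ω ∩ S : Set (Space d)) =ᵐ[volume] (⋃ K ∈ T, K ∩ S : Set (Space d)) := by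
    rw [← iUnion₂_inter]
    exact (hT.ae_eq_iUnion hd).inter (ae_eq_refl _)
  rw [setIntegral_congr_set h1, integral_biUnion_finset]
  · exact (Finset.sum_coe_sort T fun K => ∫ x in K ∩ S, g x).symm
  · exact fun K hK => (hT.isOpen hd hK).measurableSet.inter hS
  · intro K hK K' hK' hne
    exact (hT.disjoint K hK K' hK' hne).mono inter_subset_left inter_subset_left
  · exact fun K hK => hg.mono_set (inter_subset_inter_left _ (hT.subset K hK))

/-- The penalty weight takes finitely many values, as it depends on `x` through the sets of adjacent
elements only. -/
theorem essBdd_sigma0 {Z : Type*} [MeasurableSpace Z] {μ : Measure Z} {ξ : Z → Space d}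
    (hξ : AEMeasurable ξ μ) (C : ℝ) (p : ℕ) (T T' : Finset (Set (Space d))) :
    EssBdd μ fun z => sigma0 C p (max (meshsize T (ξ z)) (meshsize T' (ξ z))) :=
  essBdd_adjacent₂ hξ fun S S' => sigma0 C p
    (max ((S.card : ℝ)⁻¹ • ∑ K ∈ S, Metric.diam (K : Set (Space d)))
      ((S'.card : ℝ)⁻¹ • ∑ K ∈ S', Metric.diam (K : Set (Space d))))

/-- The inverse estimate on an element of the overlay of two meshes: a trace inequality with a ball
in `K ∩ K'` of at least half the largest possible radius. The factor `q` accounts for the local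
quasi-uniformity, and `(p + 1) (p + d) ≤ 2 (d + 1) p²` for the order. -/
theorem penalty_mul_integral_frontier_le (hd : 1 ≤ d) (hT : IsMesh Ω T) (hT' : IsMesh Ω T')
    {c_a C_a c_T C_σ b q : ℝ} (hca : 0 < c_a) (hb : c_a < b) (hbC : b < C_a) (hcT : 0 < c_T)
    (hq : 0 < q) (hp : 1 ≤ p) (hC : c_T * C_a ^ 2 * (8 * (d + 1) * q) / c_a ≤ C_σ)
    {K K' : Set (Space d)} (hK : K ∈ T) (hK' : K' ∈ T')
    (h : Metric.diam K ≤ c_T * inradius (K ∩ K') ∧ Metric.diam K' ≤ c_T * inradius (K ∩ K'))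
    {F : Space d → Space d} (hF : ∀ i, ∃ f ∈ polySpace d p, ∃ t, ∀ x, F x i = f t x) :
    q * max (Metric.diam K) (Metric.diam K') / (C_σ * p ^ 2) * b ^ 2 *
      ∫ x in frontier (K ∩ K'), ‖F x‖ ^ 2 ∂surf d ≤ 1 / 2 * (b * ∫ x in K ∩ K', ‖F x‖ ^ 2) := by
  have hdiam := diam_element_pos hd hT hK
  have hr : 0 < inradius (K ∩ K') := by
    by_contra hr
    nlinarith [h.1]
  obtain ⟨ρ, ⟨x₀, hball⟩, hρ⟩ := exists_lt_of_lt_csSup (by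
    by_contra hne
    rw [not_nonempty_iff_eq_empty] at hne
    rw [inradius, hne, Real.sSup_empty] at hr
    exact lt_irrefl _ hr) (half_lt_self hr)
  replace hρ : inradius (K ∩ K') / 2 < ρ := hρ
  have hρ0 : 0 < ρ := (half_pos hr).trans hρ
  obtain ⟨⟨H, hH⟩, -, hbK⟩ := hT.exists_isPolyhedron hd hK
  obtain ⟨⟨H', hH'⟩, -, -⟩ := hT'.exists_isPolyhedron hd hK'
  have key := (hH.inter hH').integral_frontier_sq_le hd (hbK.subset inter_subset_left) hρ0 hball hF
  set A := ∫ x in frontier (K ∩ K'), ‖F x‖ ^ 2 ∂surf d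
  set B := ∫ x in K ∩ K', ‖F x‖ ^ 2
  have hA : 0 ≤ A := integral_nonneg fun x => by positivity
  have hB : 0 ≤ B := integral_nonneg fun x => by positivity
  have hb0 : 0 < b := hca.trans hb
  have hCa : 0 < C_a := hb0.trans hbC
  have hC0 : 0 < C_σ := lt_of_lt_of_le (by positivity) hC
  have hp1 : (1 : ℝ) ≤ p := by exact_mod_cast hp
  have hd1 : (1 : ℝ) ≤ d := by exact_mod_cast hd
  have hm : max (Metric.diam K) (Metric.diam K') ≤ 2 * c_T * ρ := by
    refine max_le (h.1.trans ?_) (h.2.trans ?_) <;> nlinarith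
  have hpoly : ((p : ℝ) + 1) * (p + d) ≤ 2 * (d + 1) * p ^ 2 := by
    have h1 : (p : ℝ) + 1 ≤ 2 * p := by linarith
    have h2 : (p : ℝ) + d ≤ (d + 1) * p := by nlinarith
    calc ((p : ℝ) + 1) * (p + d) ≤ (2 * p) * ((d + 1) * p) := by gcongr
      _ = _ := by ring
  have hCb : 8 * (d + 1) * q * c_T * b ≤ C_σ := by
    refine le_trans ?_ hC
    rw [le_div_iff₀ hca]
    have : b * c_a ≤ C_a ^ 2 := by nlinarith
    have h8 : 0 ≤ 8 * ((d : ℝ) + 1) * q * c_T := by positivity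
    nlinarith
  calc q * max (Metric.diam K) (Metric.diam K') / (C_σ * p ^ 2) * b ^ 2 * A
      ≤ q * (2 * c_T * ρ) / (C_σ * p ^ 2) * b ^ 2 * A := by gcongr
    _ = 2 * q * c_T * b ^ 2 / (C_σ * p ^ 2) * (ρ * A) := by ring
    _ ≤ 2 * q * c_T * b ^ 2 / (C_σ * p ^ 2) * ((p + 1) * (p + d) * B) := by gcongr
    _ ≤ 2 * q * c_T * b ^ 2 / (C_σ * p ^ 2) * (2 * (d + 1) * p ^ 2 * B) := by gcongr
    _ = 8 * (d + 1) * q * c_T * b / C_σ * (1 / 2 * (b * B)) := by field_simp; ring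
    _ ≤ 1 * (1 / 2 * (b * B)) := by
        gcongr
        rwa [div_le_one hC0]
    _ = _ := one_mul _

/-- The difference of the averages of two vector fields is a convex combination of their
differences on the pairs of overlapping elements. -/
theorem norm_avg_sub_avg_sq_le (hd : 1 ≤ d) (hΩ : IsOpen Ω) (hT : IsMesh Ω T) (hT' : IsMesh Ω T')
    {x : Space d} (hxΩ : x ∈ closure Ω) (hx : IsGeneric T x) (hx' : IsGeneric T' x)
    (f : T → Space d) (g : T' → Space d) {R : T → T' → ℝ} (hR0 : ∀ K K', 0 ≤ R K K')
    (hR : ∀ K K', K ∈ adjacent T x → K' ∈ adjacent T' x → ((K : Set (Space d)) ∩ K').Nonempty →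
      ‖g K' - f K‖ ^ 2 ≤ R K K') :
    ‖(∑ K', avgW T' K' x • g K') - ∑ K, avgW T K x • f K‖ ^ 2 ≤ ∑ K, ∑ K', R K K' := by
  obtain ⟨θ, hθ0, hθ, hm, hm'⟩ := hT.exists_weights hd hΩ hT' hxΩ hx hx'
  have hsum : ∑ q : T × T', θ q.1 q.2 = 1 := by
    rw [Fintype.sum_prod_type]
    simp only [hm, Finset.sum_ite_mem, Finset.univ_inter, Finset.sum_const, nsmul_eq_mul]
    have := Finset.card_pos.2 (adjacent_nonempty hT hxΩ)
    exact mul_inv_cancel₀ (by exact_mod_cast this.ne')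
  have hrep : (∑ K', avgW T' K' x • g K') - ∑ K, avgW T K x • f K =
      ∑ q : T × T', θ q.1 q.2 • (g q.2 - f q.1) := by
    simp only [smul_sub, Finset.sum_sub_distrib]
    rw [Fintype.sum_prod_type_right, Fintype.sum_prod_type]
    simp only [← Finset.sum_smul, hm, hm', avgW]
  rw [hrep]
  refine (norm_sum_smul_sq_le _ (fun q _ => hθ0 _ _) hsum _).trans ?_
  rw [← Fintype.sum_prod_type' R]
  refine Finset.sum_le_sum fun q _ => ?_
  by_cases h0 : θ q.1 q.2 = 0
  · simpa [h0] using hR0 q.1 q.2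
  · obtain ⟨h1, h2, h3⟩ := hθ _ _ h0
    have hle : θ q.1 q.2 ≤ 1 := hsum ▸
      Finset.single_le_sum (f := fun q : T × T' => θ q.1 q.2) (fun _ _ => hθ0 _ _)
        (Finset.mem_univ q)
    have := hR _ _ h1 h2 h3
    nlinarith [hθ0 q.1 q.2, sq_nonneg ‖g q.2 - f q.1‖]

theorem setIntegral_indicator_le {X : Type*} [MeasurableSpace X] {μ : Measure X} {S A : Set X}
    (hA : MeasurableSet A) {g : X → ℝ} (hg : ∀ x, 0 ≤ g x) (hi : IntegrableOn g A μ) :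
    ∫ x in S, A.indicator g x ∂μ ≤ ∫ x in A, g x ∂μ := by
  rw [setIntegral_indicator hA]
  exact setIntegral_mono_set hi (Eventually.of_forall hg) (LE.le.eventuallyLE inter_subset_right)

/-- For `p = 0`, where the penalty weight vanishes, there are no gradients. -/
theorem gradOp_eq_zero_of_degree_zero {E : Type*} [NormedAddCommGroup E] [NormedSpace ℝ E]
    (W : T → Space d → Space d →L[ℝ] E) (v : pwPoly T 0) (t : ℝ) (x : Space d) :
    gradOp 0 W v t x = 0 := by
  refine Finset.sum_eq_zero fun K _ => ?_
  obtain ⟨c, hc⟩ := polySpace_zero_const (pwPoly_apply v.2 K)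
  rw [hc]
  simp [gradient]

/-- The consistency terms are controlled by the energy and the penalty terms, for the difference of
functions on two meshes. The average fluxes are compared on the pairs of overlapping elements, on
each of which the difference of the gradients is one polynomial. -/
theorem Discretization.integral_inner_avgFlux_jump_le (hd : 1 ≤ d) (D : Discretization d)
    {c_a C_a c_T C_σ c_q : ℝ} (hca : 0 < c_a) (ha : ∀ x ∈ D.Ω, c_a < D.a x ∧ D.a x < C_a)
    (hcT : 0 < c_T) (hq : ∀ n, LocallyQuasiUniform (D.mesh n) c_q)
    (hC : c_T * C_a ^ 2 * (8 * (d + 1) * (1 + |c_q|)) / c_a ≤ C_σ) (m n : Fin (D.M + 1))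
    (hmn : OverlayRegular (D.mesh m) (D.mesh n) c_T)
    (u : pwPoly (D.mesh m) p) (v : pwPoly (D.mesh n) p) (s : ℝ) :
    ∫ x in skeleton (D.mesh m) ∪ skeleton (D.mesh n),
        inner ℝ (avgFluxOp D.a _ p v s x - avgFluxOp D.a _ p u s x)
          (jumpOp _ p v s x - jumpOp _ p u s x) ∂surf d ≤
      1 / 4 * (∫ x in D.Ω, D.a x * ‖brokenGradOp _ p v s x - brokenGradOp _ p u s x‖ ^ 2) +
      1 / 2 * ∫ x in skeleton (D.mesh m) ∪ skeleton (D.mesh n),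
        sigma0 C_σ p (max (meshsize (D.mesh m) x) (meshsize (D.mesh n) x)) *
          ‖jumpOp _ p v s x - jumpOp _ p u s x‖ ^ 2 ∂surf d := by
  classical
  have hT := D.isMesh m
  have hT' := D.isMesh n
  rcases Nat.eq_zero_or_pos p with rfl | hp
  · have h1 : ∀ x, avgFluxOp D.a (D.mesh n) 0 v s x = 0 := gradOp_eq_zero_of_degree_zero _ v s
    have h2 : ∀ x, avgFluxOp D.a (D.mesh m) 0 u s x = 0 := gradOp_eq_zero_of_degree_zero _ u s
    have h3 : ∀ x, brokenGradOp (D.mesh n) 0 v s x = 0 := gradOp_eq_zero_of_degree_zero _ v s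
    have h4 : ∀ x, brokenGradOp (D.mesh m) 0 u s x = 0 := gradOp_eq_zero_of_degree_zero _ u s
    simp [h1, h2, h3, h4, sigma0]
  set S := skeleton (D.mesh m) ∪ skeleton (D.mesh n) with hSdef
  have hSm : MeasurableSet S := ((isClosed_skeleton _).union (isClosed_skeleton _)).measurableSet
  have hSΩ : S ⊆ closure D.Ω :=
    union_subset (skeleton_subset_closure hT) (skeleton_subset_closure hT')
  have hSb : Bornology.IsBounded S := D.isBounded.closure.subset hSΩ
  have hSt : surf d S < ⊤ := (measure_union_lt_top (hT.surf_skeleton_lt_top hd)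
    (hT'.surf_skeleton_lt_top hd))
  have hfin : IsFiniteMeasure ((surf d).restrict S) := ⟨by simpa using hSt⟩
  have hchart := isBoundedChart_static hSm hSb (ν := surf d) s
  have hqmp := quasiMeasurePreserving_id_restrict (surf d) S
  have hfinΩ : IsFiniteMeasure (volume.restrict D.Ω) := ⟨by simpa using D.isBounded.measure_lt_top⟩
  have hchartΩ := isBoundedChart_static D.isOpen.measurableSet D.isBounded
    (ν := volume) s
  have hW : EssBdd ((surf d).restrict S) fun x =>
      avgFluxOp D.a _ p v s x - avgFluxOp D.a _ p u s x :=
    (essBdd_avgFluxOp hchart D.a v).sub (essBdd_avgFluxOp hchart D.a u)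
  have hJ : EssBdd ((surf d).restrict S) fun x => jumpOp _ p v s x - jumpOp _ p u s x :=
    (essBdd_jumpOp hd hT' hchart hqmp v).sub (essBdd_jumpOp hd hT hchart hqmp u)
  have hσ := essBdd_sigma0 (Z := Space d) (μ := (surf d).restrict S) aemeasurable_id C_σ p
    (D.mesh m) (D.mesh n)
  simp only [id] at hσ
  set σ : Space d → ℝ := fun x =>
    sigma0 C_σ p (max (meshsize (D.mesh m) x) (meshsize (D.mesh n) x)) with hσdef
  set W : Space d → Space d := fun x => avgFluxOp D.a _ p v s x - avgFluxOp D.a _ p u s x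
  set J : Space d → Space d := fun x => jumpOp _ p v s x - jumpOp _ p u s x
  let F : D.mesh m → D.mesh n → Space d → Space d := fun K K' x =>
    gradient (fun y => v.1 K' s y) x - gradient (fun y => u.1 K s y) x
  have hF : ∀ K K' i, ∃ f ∈ polySpace d p, ∃ t, ∀ x, F K K' x i = f t x := by
    intro K K' i
    exact ⟨_, sub_mem (polySpace_gradient (pwPoly_apply v.2 K') i)
      (polySpace_gradient (pwPoly_apply u.2 K) i), s, fun x => rfl⟩
  have hFc : ∀ K K', Continuous (F K K') := by
    intro K K'
    have h1 := (polySpace_continuous_gradient (pwPoly_apply v.2 K')).comp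
      (by fun_prop : Continuous fun x : Space d => (s, x))
    have h2 := (polySpace_continuous_gradient (pwPoly_apply u.2 K)).comp
      (by fun_prop : Continuous fun x : Space d => (s, x))
    exact h1.sub h2
  rcases isEmpty_or_nonempty (D.mesh m) with hne | hne
  · have hΩ : closure D.Ω = ∅ := by
      rw [hT.cover]
      simp only [iUnion_eq_empty]
      exact fun K hK => hne.elim ⟨K, hK⟩
    have hS0 : S = ∅ := subset_empty_iff.1 (hΩ ▸ hSΩ)
    simp [hS0, (closure_empty_iff D.Ω).1 hΩ]
  set Q : ℝ := 1 + |c_q|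
  have hQ : 0 < Q := by positivity
  let α : D.mesh m → ℝ := fun K => coeffOn D.a (K : Set (Space d))
  -- an upper bound for `a² / σ₀` on the faces of `K ∩ K'`
  let κ : D.mesh m → D.mesh n → ℝ := fun K K' =>
    if ((K : Set (Space d)) ∩ K').Nonempty then
      Q * max (Metric.diam (K : Set (Space d))) (Metric.diam (K' : Set (Space d))) /
        (C_σ * p ^ 2) * α K ^ 2
    else 0
  have hα : ∀ (K : D.mesh m) (x : Space d), x ∈ (K : Set (Space d)) → α K = D.a x :=
    fun K x hx => coeffOn_eq D K.2 hx
  have hα' : ∀ (K' : D.mesh n) (x : Space d), x ∈ (K' : Set (Space d)) →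
      coeffOn D.a (K' : Set (Space d)) = D.a x := fun K' x hx => coeffOn_eq D K'.2 hx
  have hαb : ∀ K, c_a < α K ∧ α K < C_a := by
    intro K
    obtain ⟨x, hx⟩ := (hT.exists_isPolyhedron hd K.2).2.1
    rw [hα K x hx]
    exact ha x (hT.subset K K.2 hx)
  have hp0 : (0 : ℝ) < p := by exact_mod_cast hp
  have hCpos : 0 < C_σ := by
    refine lt_of_lt_of_le ?_ hC
    obtain ⟨K⟩ : Nonempty (D.mesh m) := hne
    have := hca.trans ((hαb K).1.trans (hαb K).2)
    positivity
  have hκ0 : ∀ K K', 0 ≤ κ K K' := by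
    intro K K'
    simp only [κ]
    split_ifs
    · have := Metric.diam_nonneg (s := (K : Set (Space d)))
      positivity
    · exact le_rfl
  let Φ : D.mesh m → D.mesh n → Space d → ℝ := fun K K' =>
    (frontier ((K : Set (Space d)) ∩ K')).indicator fun x => κ K K' * ‖F K K' x‖ ^ 2
  have hfr : ∀ K K', MeasurableSet (frontier ((K : Set (Space d)) ∩ K')) := fun K K' =>
    isClosed_frontier.measurableSet
  have hΦb : ∀ K K', EssBdd ((surf d).restrict S) (Φ K K') := fun K K' =>
    (hchart.essBdd_comp (g := fun z : ℝ × Space d => κ K K' * ‖F K K' z.2‖ ^ 2)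
      (by have := hFc K K'; fun_prop)).indicator (hfr K K')
  -- Young's inequality with the weight `σ`; the averages are compared on overlapping elements
  have hpt : ∀ᵐ x ∂(surf d).restrict S,
      inner ℝ (W x) (J x) ≤ 1 / 2 * (∑ K, ∑ K', Φ K K' x) + 1 / 2 * (σ x * ‖J x‖ ^ 2) := by
    filter_upwards [ae_restrict_mem hSm, ae_restrict_of_ae (hT.ae_isGeneric hd),
      ae_restrict_of_ae (hT'.ae_isGeneric hd), ae_restrict_of_ae (ae_diam_le (hq m)),
      ae_restrict_of_ae (ae_diam_le (hq n))] with x hxS hxg hxg' hxd hxd'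
    have hh : 0 < max (meshsize (D.mesh m) x) (meshsize (D.mesh n) x) :=
      lt_max_of_lt_left (meshsize_pos hd hT (adjacent_nonempty hT (hSΩ hxS)))
    have hσx : 0 < σ x := by
      simp only [hσdef, sigma0]
      positivity
    have hWx : W x = (∑ K', avgW (D.mesh n) K' x •
          (coeffOn D.a (K' : Set (Space d)) • gradient (fun y => v.1 K' s y) x)) -
        ∑ K, avgW (D.mesh m) K x • (α K • gradient (fun y => u.1 K s y) x) := by
      simp only [W, avgFluxOp, gradOp, LinearMap.coe_mk, AddHom.coe_mk, α, smul_smul,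
        _root_.smul_apply, ContinuousLinearMap.id_apply]
    have hW2 : ‖W x‖ ^ 2 ≤ ∑ K, ∑ K', σ x * Φ K K' x := by
      rw [hWx]
      refine norm_avg_sub_avg_sq_le hd D.isOpen hT hT' (hSΩ hxS) hxg hxg' _ _ ?_ ?_
      · intro K K'
        exact mul_nonneg hσx.le (indicator_nonneg (fun y _ =>
          mul_nonneg (hκ0 K K') (by positivity)) x)
      · intro K K' hK hK' hne
        obtain ⟨y, hyK, hyK'⟩ := id hne
        have hxf : x ∈ frontier ((K : Set (Space d)) ∩ K') := by
          rw [((hT.isOpen hd K.2).inter (hT'.isOpen hd K'.2)).frontier_eq]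
          refine ⟨mem_closure_inter_of_convex (hT.isOpen hd K.2) (hT'.isOpen hd K'.2)
            (hT.convex hd K.2) (hT'.convex hd K'.2) hne (mem_adjacent.1 hK) (mem_adjacent.1 hK'),
            fun hx => ?_⟩
          rcases hxS with hxS | hxS
          · have := hT.mem_frontier_of_mem_closure hd K.2 (mem_adjacent.1 hK) hxS
            rw [(hT.isOpen hd K.2).frontier_eq] at this
            exact this.2 hx.1
          · have := hT'.mem_frontier_of_mem_closure hd K'.2 (mem_adjacent.1 hK') hxS
            rw [(hT'.isOpen hd K'.2).frontier_eq] at this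
            exact this.2 hx.2
        have hle : max (meshsize (D.mesh m) x) (meshsize (D.mesh n) x) ≤
            Q * max (Metric.diam (K : Set (Space d))) (Metric.diam (K' : Set (Space d))) :=
          max_le ((meshsize_le hxd hK).trans (by gcongr; exact le_max_left _ _))
            ((meshsize_le hxd' hK').trans (by gcongr; exact le_max_right _ _))
        simp only [Φ, indicator_of_mem hxf, κ, if_pos hne]
        rw [hα' K' y hyK', ← hα K y hyK, ← smul_sub, norm_smul, mul_pow, Real.norm_eq_abs, sq_abs]
        simp only [hσdef, sigma0]
        set h := max (meshsize (D.mesh m) x) (meshsize (D.mesh n) x)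
        set δ := max (Metric.diam (K : Set (Space d))) (Metric.diam (K' : Set (Space d)))
        calc α K ^ 2 * ‖F K K' x‖ ^ 2 = 1 * (α K ^ 2 * ‖F K K' x‖ ^ 2) := (one_mul _).symm
          _ ≤ (Q * δ / h) * (α K ^ 2 * ‖F K K' x‖ ^ 2) := by
              gcongr
              rwa [one_le_div hh]
          _ = _ := by field_simp
    simp only [← Finset.mul_sum] at hW2
    set Ψ := ∑ K, ∑ K', Φ K K' x
    have h1 := real_inner_le_norm (W x) (J x)
    have h2 : ‖W x‖ * ‖J x‖ ≤ 1 / 2 * Ψ + 1 / 2 * (σ x * ‖J x‖ ^ 2) := by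
      have h3 : 0 ≤ (‖W x‖ - σ x * ‖J x‖) ^ 2 := sq_nonneg _
      have h4 : 0 ≤ σ x * (1 / 2 * Ψ + 1 / 2 * (σ x * ‖J x‖ ^ 2) - ‖W x‖ * ‖J x‖) := by nlinarith
      nlinarith [(mul_nonneg_iff_of_pos_left hσx).1 h4]
    exact h1.trans h2
  have hΦi : ∀ K ∈ Finset.univ, Integrable (fun x => ∑ K', Φ K K' x) ((surf d).restrict S) :=
    fun K _ => (EssBdd.sum _ fun K' _ => hΦb K K').integrable
  have hJi : Integrable (fun x => σ x * ‖J x‖ ^ 2) ((surf d).restrict S) := by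
    simp only [← real_inner_self_eq_norm_sq]
    exact (hσ.mul (hJ.inner hJ)).integrable
  have h1 : ∫ x in S, inner ℝ (W x) (J x) ∂surf d ≤
      1 / 2 * (∫ x in S, ∑ K, ∑ K', Φ K K' x ∂surf d) +
        1 / 2 * ∫ x in S, σ x * ‖J x‖ ^ 2 ∂surf d := by
    rw [← integral_const_mul, ← integral_const_mul, ← integral_add
      ((integrable_finsetSum _ hΦi).const_mul _) (hJi.const_mul _)]
    exact integral_mono_ae (hW.inner hJ).integrable
      (((integrable_finsetSum _ hΦi).const_mul _).add (hJi.const_mul _)) hpt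
  -- the inverse estimate on every element of the overlay
  have h2 : ∫ x in S, ∑ K, ∑ K', Φ K K' x ∂surf d ≤
      ∑ K : D.mesh m, ∑ K' : D.mesh n,
          1 / 2 * ∫ x in (K : Set (Space d)) ∩ K', α K * ‖F K K' x‖ ^ 2 := by
    rw [integral_finsetSum _ hΦi]
    refine Finset.sum_le_sum fun K _ => ?_
    rw [integral_finsetSum _ fun K' _ => (hΦb K K').integrable]
    refine Finset.sum_le_sum fun K' _ => ?_
    obtain ⟨⟨H, hH⟩, -, hbK⟩ := hT.exists_isPolyhedron hd K.2
    obtain ⟨⟨H', hH'⟩, -, -⟩ := hT'.exists_isPolyhedron hd K'.2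
    have hbKK' : Bornology.IsBounded ((K : Set (Space d)) ∩ K') := hbK.subset inter_subset_left
    refine (setIntegral_indicator_le (hfr K K')
      (fun x => mul_nonneg (hκ0 K K') (by positivity)) ?_).trans ?_
    · exact integrableOn_of_continuous_of_isBounded (hfr K K')
        (hbKK'.closure.subset frontier_subset_closure)
        ((hH.inter hH').surf_frontier_lt_top hbKK').ne (by have := hFc K K'; fun_prop)
    · rw [integral_const_mul, integral_const_mul]
      by_cases hne : ((K : Set (Space d)) ∩ K').Nonempty
      · simp only [κ, if_pos hne]
        exact penalty_mul_integral_frontier_le hd hT hT' hca (hαb K).1 (hαb K).2 hcT hQ hp hC K.2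
          K'.2 (hmn K K.2 K' K'.2 hne) (hF K K')
      · simp [κ, if_neg hne, not_nonempty_iff_eq_empty.1 hne]
  have hG : EssBdd (volume.restrict D.Ω) fun x =>
      D.a x * ‖brokenGradOp _ p v s x - brokenGradOp _ p u s x‖ ^ 2 := by
    simp only [← real_inner_self_eq_norm_sq]
    have h3 : EssBdd (volume.restrict D.Ω) fun x =>
        brokenGradOp _ p v s x - brokenGradOp _ p u s x :=
      (essBdd_brokenGradOp hd hT' hchartΩ v).sub (essBdd_brokenGradOp hd hT hchartΩ u)
    exact (essBdd_coeff D hd).mul (h3.inner h3)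
  -- the elements of the overlay partition the domain
  have h3 : ∫ x in D.Ω, D.a x * ‖brokenGradOp _ p v s x - brokenGradOp _ p u s x‖ ^ 2 =
      ∑ K : D.mesh m, ∑ K' : D.mesh n,
        ∫ x in (K : Set (Space d)) ∩ K', α K * ‖F K K' x‖ ^ 2 := by
    have hGi : IntegrableOn (fun x =>
      D.a x * ‖brokenGradOp _ p v s x - brokenGradOp _ p u s x‖ ^ 2) D.Ω := hG.integrable
    have h4 := hT.setIntegral_inter_eq_sum hd MeasurableSet.univ (by rwa [inter_univ])
    simp only [inter_univ] at h4
    rw [h4]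
    refine Finset.sum_congr rfl fun K _ => ?_
    have h5 := hT'.setIntegral_inter_eq_sum hd (hT.isOpen hd K.2).measurableSet
      (hGi.mono_set inter_subset_left)
    rw [inter_eq_right.2 (hT.subset K K.2)] at h5
    rw [h5]
    refine Finset.sum_congr rfl fun K' _ => ?_
    rw [inter_comm]
    refine setIntegral_congr_fun
      ((hT.isOpen hd K.2).inter (hT'.isOpen hd K'.2)).measurableSet fun x hx => ?_
    simp only [F, brokenGradOp_of_mem hd hT u s hx.1, brokenGradOp_of_mem hd hT' v s hx.2,
      hα K x hx.1]
  simp only [← Finset.mul_sum] at h2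
  rw [← h3] at h2
  linarith

end Overlay

section Forms

/-! ### Bilinear forms, and integration by parts in time -/

section IsBilin

variable {V V' Z E : Type*} [AddCommGroup V] [Module ℝ V] [AddCommGroup V'] [Module ℝ V']
  [MeasurableSpace Z] [NormedAddCommGroup E] [InnerProductSpace ℝ E]

/-- The function `f` of two variables is bilinear. -/
def IsBilin (f : V → V' → ℝ) : Prop := ∃ B : V →ₗ[ℝ] V' →ₗ[ℝ] ℝ, ∀ u v, B u v = f u v

theorem IsBilin.add {f g : V → V' → ℝ} (hf : IsBilin f) (hg : IsBilin g) :
    IsBilin fun u v => f u v + g u v := by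
  obtain ⟨B, hB⟩ := hf
  obtain ⟨B', hB'⟩ := hg
  exact ⟨B + B', fun u v => by simp [hB, hB']⟩

theorem IsBilin.sub {f g : V → V' → ℝ} (hf : IsBilin f) (hg : IsBilin g) :
    IsBilin fun u v => f u v - g u v := by
  obtain ⟨B, hB⟩ := hf
  obtain ⟨B', hB'⟩ := hg
  exact ⟨B - B', fun u v => by simp [hB, hB']⟩

theorem IsBilin.sum {ι : Type*} (s : Finset ι) {f : ι → V → V' → ℝ} (hf : ∀ i, IsBilin (f i)) :
    IsBilin fun u v => ∑ i ∈ s, f i u v := by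
  choose B hB using hf
  exact ⟨∑ i ∈ s, B i, fun u v => by simp [hB]⟩

theorem IsBilin.comp {U U' : Type*} [AddCommGroup U] [Module ℝ U] [AddCommGroup U'] [Module ℝ U']
    {f : V → V' → ℝ} (hf : IsBilin f) (A : U →ₗ[ℝ] V) (A' : U' →ₗ[ℝ] V') :
    IsBilin fun u v => f (A u) (A' v) := by
  obtain ⟨B, hB⟩ := hf
  exact ⟨B.compl₁₂ A A', fun u v => by simp [hB]⟩

theorem isBilin_integral {μ : Measure Z} {σ : Z → ℝ} (hσ : Integrable σ μ) {A : V → Z → E}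
    {A' : V' → Z → E} (hadd : ∀ u v z, A (u + v) z = A u z + A v z)
    (hsmul : ∀ (c : ℝ) u z, A (c • u) z = c • A u z)
    (hadd' : ∀ u v z, A' (u + v) z = A' u z + A' v z)
    (hsmul' : ∀ (c : ℝ) u z, A' (c • u) z = c • A' u z)
    (hA : ∀ u, EssBdd μ (A u)) (hA' : ∀ v, EssBdd μ (A' v)) :
    IsBilin fun u v => ∫ z, σ z * inner ℝ (A u z) (A' v z) ∂μ := by
  have hi : ∀ u v, Integrable (fun z => σ z * inner ℝ (A u z) (A' v z)) μ := fun u v =>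
    ((hA u).inner (hA' v)).integrable_mul hσ
  refine ⟨LinearMap.mk₂ ℝ (fun u v => ∫ z, σ z * inner ℝ (A u z) (A' v z) ∂μ) ?_ ?_ ?_ ?_,
    fun u v => rfl⟩
  · intro u v w
    simp only [hadd, inner_add_left, mul_add]
    exact integral_add (hi u w) (hi v w)
  · intro c u w
    simp only [hsmul, real_inner_smul_left, mul_left_comm _ c]
    exact integral_const_mul c _
  · intro u v w
    simp only [hadd', inner_add_right, mul_add]
    exact integral_add (hi u v) (hi u w)
  · intro c u w
    simp only [hsmul', real_inner_smul_right, mul_left_comm _ c]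
    exact integral_const_mul c _

end IsBilin

variable {d p : ℕ} {Ω : Set (Space d)} {T T' : Finset (Set (Space d))} {E : Type*}
  [NormedAddCommGroup E] [InnerProductSpace ℝ E]

/-- A linear operator on piecewise polynomials that commutes with the time derivative and has
essentially bounded values along every bounded chart of `ν`. -/
structure IsTimeOp (ν : Measure (Space d)) (A : pwPoly T p →ₗ[ℝ] (ℝ → Space d → E)) : Prop where
  hasDerivAt : ∀ v t x, HasDerivAt (fun s => A v s x) (A (dtL T p v) t x) t
  essBdd : ∀ (Z : Type) [MeasurableSpace Z] (μ : Measure Z) (τ : Z → ℝ) (ξ : Z → Space d),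
    IsBoundedChart μ τ ξ → Measure.QuasiMeasurePreserving ξ μ ν →
    ∀ v, EssBdd μ fun z => A v (τ z) (ξ z)

theorem isTimeOp_jumpOp (hd : 1 ≤ d) (hT : IsMesh Ω T) : IsTimeOp (surf d) (jumpOp T p) where
  hasDerivAt := hasDerivAt_valOp _
  essBdd _ _ _ _ _ h hξ v := essBdd_jumpOp hd hT h hξ v

theorem isTimeOp_avgFluxOp (ν : Measure (Space d)) (a : Space d → ℝ) :
    IsTimeOp ν (avgFluxOp a T p) where
  hasDerivAt := hasDerivAt_gradOp _
  essBdd _ _ _ _ _ h _ v := essBdd_avgFluxOp h a v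

theorem isTimeOp_jumpFluxOp (hd : 1 ≤ d) (hT : IsMesh Ω T) (a : Space d → ℝ) :
    IsTimeOp (surf d) (jumpFluxOp Ω a T p) where
  hasDerivAt := hasDerivAt_gradOp _
  essBdd _ _ _ _ _ h hξ v := essBdd_jumpFluxOp hd hT h hξ a v

theorem isTimeOp_brokenOp (hd : 1 ≤ d) (hT : IsMesh Ω T) (ν : Measure (Space d)) :
    IsTimeOp ν (brokenOp T p) where
  hasDerivAt := hasDerivAt_valOp _
  essBdd _ _ _ _ _ h _ v := essBdd_brokenOp hd hT h v

theorem isTimeOp_brokenGradOp (hd : 1 ≤ d) (hT : IsMesh Ω T) (ν : Measure (Space d)) :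
    IsTimeOp ν (brokenGradOp T p) where
  hasDerivAt := hasDerivAt_gradOp _
  essBdd _ _ _ _ _ h _ v := essBdd_brokenGradOp hd hT h v

theorem IsTimeOp.comp_dtL {ν : Measure (Space d)} {A : pwPoly T p →ₗ[ℝ] (ℝ → Space d → E)}
    (hA : IsTimeOp ν A) : IsTimeOp ν (A ∘ₗ dtL T p) where
  hasDerivAt v := hA.hasDerivAt (dtL T p v)
  essBdd Z _ μ τ ξ h hξ v := hA.essBdd Z μ τ ξ h hξ (dtL T p v)

variable {ν : Measure (Space d)} {S : Set (Space d)}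

theorem isBoundedChart_slab (hS : MeasurableSet S) (hb : Bornology.IsBounded S) (hν : ν S < ⊤)
    (t₀ t₁ : ℝ) :
    IsBoundedChart ((volume.restrict (Ioo t₀ t₁)).prod (ν.restrict S)) Prod.fst Prod.snd := by
  have : IsFiniteMeasure (ν.restrict S) := ⟨by simpa using hν⟩
  refine ⟨measurable_fst.aemeasurable, measurable_snd.aemeasurable,
    Icc t₀ t₁ ×ˢ closure S, isCompact_Icc.prod hb.isCompact_closure, ?_⟩
  have h1 : ∀ᵐ z ∂(volume.restrict (Ioo t₀ t₁)).prod (ν.restrict S), z.1 ∈ Ioo t₀ t₁ :=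
    Measure.quasiMeasurePreserving_fst.ae (ae_restrict_mem measurableSet_Ioo)
  have h2 : ∀ᵐ z ∂(volume.restrict (Ioo t₀ t₁)).prod (ν.restrict S), z.2 ∈ S :=
    Measure.quasiMeasurePreserving_snd.ae (ae_restrict_mem hS)
  filter_upwards [h1, h2] with z hz1 hz2
  exact ⟨Ioo_subset_Icc_self hz1, subset_closure hz2⟩

theorem quasiMeasurePreserving_snd_restrict (t₀ t₁ : ℝ) (ν : Measure (Space d))
    (S : Set (Space d)) : Measure.QuasiMeasurePreserving Prod.snd
      ((volume.restrict (Ioo t₀ t₁)).prod (ν.restrict S)) ν :=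
  (quasiMeasurePreserving_id_restrict ν S).comp Measure.quasiMeasurePreserving_snd

theorem IsTimeOp.essBdd_static {A : pwPoly T p →ₗ[ℝ] (ℝ → Space d → E)} (hA : IsTimeOp ν A)
    (hS : MeasurableSet S) (hb : Bornology.IsBounded S) (s : ℝ)
    (v : pwPoly T p) : EssBdd (ν.restrict S) (A v s) :=
  hA.essBdd _ _ _ _ (isBoundedChart_static hS hb s) (quasiMeasurePreserving_id_restrict ν S) v

theorem IsTimeOp.essBdd_slab {A : pwPoly T p →ₗ[ℝ] (ℝ → Space d → E)} (hA : IsTimeOp ν A)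
    (hS : MeasurableSet S) (hb : Bornology.IsBounded S) (hν : ν S < ⊤) (t₀ t₁ : ℝ)
    (v : pwPoly T p) : EssBdd ((volume.restrict (Ioo t₀ t₁)).prod (ν.restrict S))
      fun z => A v z.1 z.2 :=
  hA.essBdd _ _ _ _ (isBoundedChart_slab hS hb hν t₀ t₁)
    (quasiMeasurePreserving_snd_restrict t₀ t₁ ν S) v

theorem IsTimeOp.isBilin_static {A : pwPoly T p →ₗ[ℝ] (ℝ → Space d → E)}
    {A' : pwPoly T' p →ₗ[ℝ] (ℝ → Space d → E)} (hA : IsTimeOp ν A) (hA' : IsTimeOp ν A')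
    (hS : MeasurableSet S) (hb : Bornology.IsBounded S) {σ : Space d → ℝ}
    (hσ : IntegrableOn σ S ν) (s : ℝ) :
    IsBilin fun u v => ∫ x in S, σ x * inner ℝ (A u s x) (A' v s x) ∂ν :=
  isBilin_integral (A := fun u => A u s) (A' := fun v => A' v s) hσ (by simp) (by simp) (by simp)
    (by simp) (hA.essBdd_static hS hb s) (hA'.essBdd_static hS hb s)

theorem IsTimeOp.isBilin_slab {A A' : pwPoly T p →ₗ[ℝ] (ℝ → Space d → E)} (hA : IsTimeOp ν A)
    (hA' : IsTimeOp ν A') (hS : MeasurableSet S) (hb : Bornology.IsBounded S) (hν : ν S < ⊤)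
    {t₀ t₁ : ℝ} {σ : ℝ × Space d → ℝ}
    (hσ : Integrable σ ((volume.restrict (Ioo t₀ t₁)).prod (ν.restrict S))) :
    IsBilin fun u v => ∫ z, σ z * inner ℝ (A u z.1 z.2) (A' v z.1 z.2)
      ∂(volume.restrict (Ioo t₀ t₁)).prod (ν.restrict S) :=
  isBilin_integral (A := fun u (z : ℝ × Space d) => A u z.1 z.2)
    (A' := fun u (z : ℝ × Space d) => A' u z.1 z.2) hσ (by simp) (by simp) (by simp) (by simp)
    (hA.essBdd_slab hS hb hν t₀ t₁) (hA'.essBdd_slab hS hb hν t₀ t₁)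

/-- Integration by parts in time. -/
theorem IsTimeOp.integral_slab_add {A A' : pwPoly T p →ₗ[ℝ] (ℝ → Space d → E)} (hA : IsTimeOp ν A)
    (hA' : IsTimeOp ν A') (hS : MeasurableSet S) (hb : Bornology.IsBounded S) (hν : ν S < ⊤)
    {t₀ t₁ : ℝ} (ht : t₀ ≤ t₁) {σ : Space d → ℝ} (hσ : EssBdd (ν.restrict S) σ)
    (u v : pwPoly T p) :
    (∫ z, σ z.2 * inner ℝ (A (dtL T p u) z.1 z.2) (A' v z.1 z.2)
      ∂(volume.restrict (Ioo t₀ t₁)).prod (ν.restrict S)) +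
    (∫ z, σ z.2 * inner ℝ (A u z.1 z.2) (A' (dtL T p v) z.1 z.2)
      ∂(volume.restrict (Ioo t₀ t₁)).prod (ν.restrict S)) =
    (∫ x in S, σ x * inner ℝ (A u t₁ x) (A' v t₁ x) ∂ν) -
      ∫ x in S, σ x * inner ℝ (A u t₀ x) (A' v t₀ x) ∂ν := by
  have hfin : IsFiniteMeasure (ν.restrict S) := ⟨by simpa using hν⟩
  have hσ' : EssBdd ((volume.restrict (Ioo t₀ t₁)).prod (ν.restrict S)) fun z => σ z.2 :=
    hσ.comp_quasiMeasurePreserving Measure.quasiMeasurePreserving_snd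
  have hi : ∀ u v, EssBdd ((volume.restrict (Ioo t₀ t₁)).prod (ν.restrict S))
      fun z => σ z.2 * inner ℝ (A u z.1 z.2) (A' v z.1 z.2) := fun u v =>
    hσ'.mul ((hA.essBdd_slab hS hb hν t₀ t₁ u).inner (hA'.essBdd_slab hS hb hν t₀ t₁ v))
  have hi0 : ∀ s, Integrable (fun x => σ x * inner ℝ (A u s x) (A' v s x)) (ν.restrict S) :=
    fun s => (hσ.mul ((hA.essBdd_static hS hb s u).inner
      (hA'.essBdd_static hS hb s v))).integrable
  rw [← integral_add (hi _ _).integrable (hi _ _).integrable,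
    integral_prod_symm _ ((hi _ _).add (hi _ _)).integrable, ← integral_sub (hi0 _) (hi0 _)]
  refine integral_congr_ae (Eventually.of_forall fun x => ?_)
  have hc : ∀ w, Continuous fun s => A w s x := fun w =>
    continuous_iff_continuousAt.2 fun s => (hA.hasDerivAt w s x).continuousAt
  have hc' : ∀ w, Continuous fun s => A' w s x := fun w =>
    continuous_iff_continuousAt.2 fun s => (hA'.hasDerivAt w s x).continuousAt
  have hder : ∀ s, HasDerivAt (fun s => σ x * inner ℝ (A u s x) (A' v s x))
      (σ x * inner ℝ (A (dtL T p u) s x) (A' v s x) +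
        σ x * inner ℝ (A u s x) (A' (dtL T p v) s x)) s := by
    intro s
    have := ((hA.hasDerivAt u s x).inner ℝ (hA'.hasDerivAt v s x)).const_mul (σ x)
    rwa [mul_add, add_comm] at this
  have hcont : Continuous fun s => σ x * inner ℝ (A (dtL T p u) s x) (A' v s x) +
      σ x * inner ℝ (A u s x) (A' (dtL T p v) s x) :=
    (continuous_const.mul ((hc _).inner (hc' _))).add
      (continuous_const.mul ((hc _).inner (hc' _)))
  have := intervalIntegral.integral_eq_sub_of_hasDerivAt (a := t₀) (b := t₁) (fun s _ => hder s)
    (hcont.intervalIntegrable _ _)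
  rwa [intervalIntegral.integral_of_le ht, integral_Ioc_eq_integral_Ioo] at this

end Forms

section Energy

/-! ### The forms of the method -/

theorem IsBilin.flip {V V' : Type*} [AddCommGroup V] [Module ℝ V] [AddCommGroup V'] [Module ℝ V']
    {f : V → V' → ℝ} (hf : IsBilin f) : IsBilin fun v u => f u v := by
  obtain ⟨B, hB⟩ := hf
  exact ⟨B.flip, fun v u => by simp [hB]⟩

variable {d p : ℕ} (D : Discretization d)

theorem dt_coe {T : Finset (Set (Space d))} (v : pwPoly T p) : dt v.1 = (dtL T p v).1 := rfl

theorem real_inner_eq_mul (a b : ℝ) : inner ℝ a b = a * b := by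
  rw [RCLike.inner_apply, conj_trivial, mul_comm]

/-- The product measure on `I_n × Ω`. -/
noncomputable def slabVolume (n : Fin (D.M + 1)) : Measure (ℝ × Space d) :=
  (volume.restrict (D.slab n)).prod (volume.restrict D.Ω)

/-- The form `a_n`, with all terms as weighted inner products of operators. -/
theorem aSlab_eq (hd : 1 ≤ d) (C : ℝ) (σ₁ σ₂ : ℝ → Space d → ℝ) (n : Fin (D.M + 1))
    (u v : pwPoly (D.mesh n) p) : aSlab D p C σ₁ σ₂ n u.1 v.1 =
  (∫ z, 1 * inner ℝ (brokenOp _ p (dtL _ p (dtL _ p u)) z.1 z.2) (brokenOp _ p (dtL _ p v) z.1 z.2)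
    ∂slabVolume D n)
  + (∫ x in D.Ω, 1 * inner ℝ (brokenOp _ p (dtL _ p u) (D.node n.castSucc) x)
      (brokenOp _ p (dtL _ p v) (D.node n.castSucc) x))
  + (∫ z, D.a z.2 * inner ℝ (brokenGradOp _ p u z.1 z.2) (brokenGradOp _ p (dtL _ p v) z.1 z.2)
      ∂slabVolume D n)
  + (∫ x in D.Ω, D.a x * inner ℝ (brokenGradOp _ p u (D.node n.castSucc) x)
      (brokenGradOp _ p v (D.node n.castSucc) x))
  - (∫ z, 1 * inner ℝ (avgFluxOp D.a _ p u z.1 z.2) (jumpOp _ p (dtL _ p v) z.1 z.2)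
      ∂slabSkeleton D n)
  - (∫ x in skeleton (D.mesh n), 1 * inner ℝ (avgFluxOp D.a _ p u (D.node n.castSucc) x)
      (jumpOp _ p v (D.node n.castSucc) x) ∂surf d)
  - (∫ z, 1 * inner ℝ (avgFluxOp D.a _ p (dtL _ p v) z.1 z.2) (jumpOp _ p u z.1 z.2)
      ∂slabSkeleton D n)
  - (∫ x in skeleton (D.mesh n), 1 * inner ℝ (avgFluxOp D.a _ p v (D.node n.castSucc) x)
      (jumpOp _ p u (D.node n.castSucc) x) ∂surf d)
  + (∫ z, sigma0 C p (meshsize (D.mesh n) z.2) *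
      inner ℝ (jumpOp _ p u z.1 z.2) (jumpOp _ p (dtL _ p v) z.1 z.2) ∂slabSkeleton D n)
  + (∫ x in skeleton (D.mesh n), sigma0 C p (meshsize (D.mesh n) x) *
      inner ℝ (jumpOp _ p u (D.node n.castSucc) x) (jumpOp _ p v (D.node n.castSucc) x) ∂surf d)
  + (∫ z, σ₁ z.1 z.2 * inner ℝ (jumpOp _ p u z.1 z.2) (jumpOp _ p v z.1 z.2) ∂slabSkeleton D n)
  + (∫ z, σ₂ z.1 z.2 * inner ℝ (jumpFluxOp D.Ω D.a _ p u z.1 z.2)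
      (jumpFluxOp D.Ω D.a _ p v z.1 z.2) ∂slabSkeleton D n) := by
  have hT := D.isMesh n
  have hv : volume.restrict (D.slab n ×ˢ D.Ω) = slabVolume D n := by
    rw [slabVolume, Measure.prod_restrict, Measure.volume_eq_prod]
  simp only [aSlab, dt_coe, broken_atTime, broken_grad, jump_atTime hd hT, avg_flux,
    jumpVec_flux hd hT, one_mul, real_inner_eq_mul, hv]
  simp only [real_inner_comm (avgFluxOp D.a (D.mesh n) p _ _ _)]

theorem integral_skeleton_eq {T : Finset (Set (Space d))} {S : Set (Space d)}
    (hS : MeasurableSet S) (hTS : skeleton T ⊆ S) {f : Space d → ℝ}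
    (hf : ∀ x ∉ skeleton T, f x = 0) :
    ∫ x in skeleton T, f x ∂surf d = ∫ x in S, f x ∂surf d :=
  (setIntegral_eq_of_subset_of_forall_sdiff_eq_zero hS hTS fun x hx => hf x hx.2).symm

theorem jumpOp_eq_zero {T : Finset (Set (Space d))} (v : pwPoly T p) (t : ℝ) {x : Space d}
    (hx : x ∉ skeleton T) : jumpOp T p v t x = 0 := by
  refine Finset.sum_eq_zero fun K _ => ?_
  rw [normalW, indicator_of_notMem fun h => hx (mem_iUnion₂.2 ⟨K, K.2, h⟩), smul_zero]

/-- The union of the skeletons of two meshes. -/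
def skeleton₂ (m n : Fin (D.M + 1)) : Set (Space d) := skeleton (D.mesh m) ∪ skeleton (D.mesh n)

/-- The penalty weight with the larger meshsize of two meshes. -/
noncomputable def sigma0₂ (p : ℕ) (C : ℝ) (m n : Fin (D.M + 1)) (x : Space d) : ℝ :=
  sigma0 C p (max (meshsize (D.mesh m) x) (meshsize (D.mesh n) x))

theorem measurableSet_skeleton₂ (m n : Fin (D.M + 1)) : MeasurableSet (skeleton₂ D m n) :=
  ((isClosed_skeleton _).union (isClosed_skeleton _)).measurableSet

theorem isBounded_skeleton₂ (m n : Fin (D.M + 1)) : Bornology.IsBounded (skeleton₂ D m n) :=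
  D.isBounded.closure.subset (union_subset (skeleton_subset_closure (D.isMesh m))
    (skeleton_subset_closure (D.isMesh n)))

theorem surf_skeleton₂_lt_top (hd : 1 ≤ d) (m n : Fin (D.M + 1)) :
    surf d (skeleton₂ D m n) < ⊤ :=
  measure_union_lt_top ((D.isMesh m).surf_skeleton_lt_top hd)
    ((D.isMesh n).surf_skeleton_lt_top hd)

theorem essBdd_sigma0₂ (C : ℝ) (m n : Fin (D.M + 1)) (μ : Measure (Space d)) :
    EssBdd μ (sigma0₂ D p C m n) := essBdd_sigma0 aemeasurable_id C p _ _

theorem essBdd_sigma0_meshsize (C : ℝ) (p : ℕ) (T : Finset (Set (Space d)))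
    (μ : Measure (Space d)) : EssBdd μ fun x => sigma0 C p (meshsize T x) := by
  simpa only [max_self, id] using essBdd_sigma0 (μ := μ) aemeasurable_id C p T T

/-- The form `b_n`, with all terms as weighted inner products of operators. -/
theorem bSlab_eq (hd : 1 ≤ d) (C : ℝ) (m : Fin D.M) (u : pwPoly (D.mesh m.castSucc) p)
    (v : pwPoly (D.mesh m.succ) p) : bSlab D p C m u.1 v.1 =
  (∫ x in D.Ω, 1 * inner ℝ (brokenOp _ p (dtL _ p u) (D.node m.succ.castSucc) x)
      (brokenOp _ p (dtL _ p v) (D.node m.succ.castSucc) x))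
  + (∫ x in D.Ω, D.a x * inner ℝ (brokenGradOp _ p u (D.node m.succ.castSucc) x)
      (brokenGradOp _ p v (D.node m.succ.castSucc) x))
  - (∫ x in skeleton₂ D m.castSucc m.succ,
      1 * inner ℝ (avgFluxOp D.a _ p u (D.node m.succ.castSucc) x)
      (jumpOp _ p v (D.node m.succ.castSucc) x) ∂surf d)
  - (∫ x in skeleton₂ D m.castSucc m.succ,
      1 * inner ℝ (avgFluxOp D.a _ p v (D.node m.succ.castSucc) x)
      (jumpOp _ p u (D.node m.succ.castSucc) x) ∂surf d)
  + (∫ x in skeleton₂ D m.castSucc m.succ, sigma0₂ D p C m.castSucc m.succ x *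
      inner ℝ (jumpOp _ p u (D.node m.succ.castSucc) x)
        (jumpOp _ p v (D.node m.succ.castSucc) x) ∂surf d) := by
  have hT := D.isMesh m.castSucc
  have hT' := D.isMesh m.succ
  have hS := measurableSet_skeleton₂ D m.castSucc m.succ
  simp only [bSlab, dt_coe, broken_atTime, broken_grad, jump_atTime hd hT, jump_atTime hd hT',
    avg_flux, one_mul, real_inner_eq_mul]
  rw [integral_skeleton_eq hS subset_union_right fun x hx => by
      rw [jumpOp_eq_zero v _ hx, inner_zero_right],
    integral_skeleton_eq hS subset_union_left fun x hx => by
      rw [jumpOp_eq_zero u _ hx, inner_zero_left]]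
  simp only [real_inner_comm (avgFluxOp D.a (D.mesh m.succ) p _ _ _)]
  rfl

theorem isBilin_aSlab (hd : 1 ≤ d) (C : ℝ) {σ₁ σ₂ : ℝ → Space d → ℝ} (h₁ : IsPenalty D σ₁)
    (h₂ : IsPenalty D σ₂) (n : Fin (D.M + 1)) :
    IsBilin fun u v : pwPoly (D.mesh n) p => aSlab D p C σ₁ σ₂ n u.1 v.1 := by
  simp only [aSlab_eq D hd]
  have hT := D.isMesh n
  have mΩ := D.isOpen.measurableSet
  have fΩ := D.isBounded.measure_lt_top (μ := volume)
  have mΓ := (isClosed_skeleton (D.mesh n)).measurableSet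
  have bΓ := D.isBounded.closure.subset (skeleton_subset_closure hT)
  have fΓ := hT.surf_skeleton_lt_top hd
  have iΩ : IsFiniteMeasure (volume.restrict D.Ω) := ⟨by simpa using fΩ⟩
  have iΓ : IsFiniteMeasure ((surf d).restrict (skeleton (D.mesh n))) := ⟨by simpa using fΓ⟩
  have hJ := isTimeOp_jumpOp (p := p) hd hT
  have hA := isTimeOp_avgFluxOp (p := p) (T := D.mesh n) (surf d) D.a
  have hB := isTimeOp_brokenOp (p := p) hd hT volume
  have hG := isTimeOp_brokenGradOp (p := p) hd hT volume
  have hF := isTimeOp_jumpFluxOp (p := p) hd hT D.a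
  have ha := (essBdd_coeff D hd)
  have hσ := essBdd_sigma0_meshsize C p (D.mesh n) ((surf d).restrict (skeleton (D.mesh n)))
  refine IsBilin.add (IsBilin.add (IsBilin.add (IsBilin.add (IsBilin.sub (IsBilin.sub (IsBilin.sub
    (IsBilin.sub (IsBilin.add (IsBilin.add (IsBilin.add ?_ ?_) ?_) ?_) ?_) ?_) ?_) ?_) ?_) ?_) ?_)
    ?_
  · exact hB.comp_dtL.comp_dtL.isBilin_slab hB.comp_dtL mΩ D.isBounded fΩ (integrable_const _)
  · exact hB.comp_dtL.isBilin_static hB.comp_dtL mΩ D.isBounded (integrable_const _) _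
  · exact hG.isBilin_slab hG.comp_dtL mΩ D.isBounded fΩ
      (ha.comp_quasiMeasurePreserving Measure.quasiMeasurePreserving_snd).integrable
  · exact hG.isBilin_static hG mΩ D.isBounded ha.integrable _
  · exact hA.isBilin_slab hJ.comp_dtL mΓ bΓ fΓ (integrable_const _)
  · exact hA.isBilin_static hJ mΓ bΓ (integrable_const _) _
  · exact (hA.comp_dtL.isBilin_slab hJ mΓ bΓ fΓ (integrable_const _)).flip
  · exact (hA.isBilin_static hJ mΓ bΓ (integrable_const _) _).flip
  · exact hJ.isBilin_slab hJ.comp_dtL mΓ bΓ fΓ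
      (hσ.comp_quasiMeasurePreserving Measure.quasiMeasurePreserving_snd).integrable
  · exact hJ.isBilin_static hJ mΓ bΓ hσ.integrable _
  · exact hJ.isBilin_slab hJ mΓ bΓ fΓ (h₁ n).2
  · exact hF.isBilin_slab hF mΓ bΓ fΓ (h₂ n).2

theorem isBilin_bSlab (hd : 1 ≤ d) (C : ℝ) (m : Fin D.M) :
    IsBilin fun (u : pwPoly (D.mesh m.castSucc) p) (v : pwPoly (D.mesh m.succ) p) =>
      bSlab D p C m u.1 v.1 := by
  simp only [bSlab_eq D hd]
  have hT := D.isMesh m.castSucc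
  have hT' := D.isMesh m.succ
  have mΩ := D.isOpen.measurableSet
  have fΩ := D.isBounded.measure_lt_top (μ := volume)
  have mΓ := measurableSet_skeleton₂ D m.castSucc m.succ
  have bΓ := isBounded_skeleton₂ D m.castSucc m.succ
  have fΓ := surf_skeleton₂_lt_top D hd m.castSucc m.succ
  have iΩ : IsFiniteMeasure (volume.restrict D.Ω) := ⟨by simpa using fΩ⟩
  have iΓ : IsFiniteMeasure ((surf d).restrict (skeleton₂ D m.castSucc m.succ)) :=
    ⟨by simpa using fΓ⟩
  have hJ := isTimeOp_jumpOp (p := p) hd hT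
  have hJ' := isTimeOp_jumpOp (p := p) hd hT'
  have hA := isTimeOp_avgFluxOp (p := p) (T := D.mesh m.castSucc) (surf d) D.a
  have hA' := isTimeOp_avgFluxOp (p := p) (T := D.mesh m.succ) (surf d) D.a
  refine IsBilin.add (IsBilin.sub (IsBilin.sub (IsBilin.add ?_ ?_) ?_) ?_) ?_
  · exact (isTimeOp_brokenOp hd hT volume).comp_dtL.isBilin_static
      (isTimeOp_brokenOp hd hT' volume).comp_dtL mΩ D.isBounded (integrable_const _) _
  · exact (isTimeOp_brokenGradOp hd hT volume).isBilin_static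
      (isTimeOp_brokenGradOp hd hT' volume) mΩ D.isBounded (essBdd_coeff D hd).integrable _
  · exact hA.isBilin_static hJ' mΓ bΓ (integrable_const _) _
  · exact (hA'.isBilin_static hJ mΓ bΓ (integrable_const _) _).flip
  · exact hJ.isBilin_static hJ' mΓ bΓ (essBdd_sigma0₂ D C _ _ _).integrable _

/-! ### The energy identity -/

/-- The energy `½ ‖v̇‖² + ½ ‖a^{1/2} ∇v‖² - ({a ∇v}, [v]) + ½ (σ₀ [v], [v])` of a function `v` on
the slab `n` at time `s`. -/
noncomputable def energy (C : ℝ) (n : Fin (D.M + 1)) (v : pwPoly (D.mesh n) p) (s : ℝ) : ℝ :=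
  1 / 2 * (∫ x in D.Ω, 1 * inner ℝ (brokenOp _ p (dtL _ p v) s x) (brokenOp _ p (dtL _ p v) s x))
  + 1 / 2 * (∫ x in D.Ω, D.a x * inner ℝ (brokenGradOp _ p v s x) (brokenGradOp _ p v s x))
  - (∫ x in skeleton (D.mesh n),
      1 * inner ℝ (avgFluxOp D.a _ p v s x) (jumpOp _ p v s x) ∂surf d)
  + 1 / 2 * (∫ x in skeleton (D.mesh n), sigma0 C p (meshsize (D.mesh n) x) *
      inner ℝ (jumpOp _ p v s x) (jumpOp _ p v s x) ∂surf d)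

/-- The energy identity on a slab. The space-time integrals that contain `v̇` are derivatives in
time; together with the terms at `t_n` they leave the energies at both ends. -/
theorem aSlab_self (hd : 1 ≤ d) (C : ℝ) (σ₁ σ₂ : ℝ → Space d → ℝ) (n : Fin (D.M + 1))
    (v : pwPoly (D.mesh n) p) : aSlab D p C σ₁ σ₂ n v.1 v.1 =
      energy D C n v (D.node n.castSucc) + energy D C n v (D.node n.succ) +
      (∫ z, σ₁ z.1 z.2 * inner ℝ (jumpOp _ p v z.1 z.2) (jumpOp _ p v z.1 z.2)
        ∂slabSkeleton D n) +
      (∫ z, σ₂ z.1 z.2 * inner ℝ (jumpFluxOp D.Ω D.a _ p v z.1 z.2)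
        (jumpFluxOp D.Ω D.a _ p v z.1 z.2) ∂slabSkeleton D n) := by
  have hT := D.isMesh n
  have mΩ := D.isOpen.measurableSet
  have fΩ := D.isBounded.measure_lt_top (μ := volume)
  have mΓ := (isClosed_skeleton (D.mesh n)).measurableSet
  have bΓ := D.isBounded.closure.subset (skeleton_subset_closure hT)
  have fΓ := hT.surf_skeleton_lt_top hd
  have hJ := isTimeOp_jumpOp (p := p) hd hT
  have hA := isTimeOp_avgFluxOp (p := p) (T := D.mesh n) (surf d) D.a
  have hB := isTimeOp_brokenOp (p := p) hd hT volume
  have hG := isTimeOp_brokenGradOp (p := p) hd hT volume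
  have hσ := essBdd_sigma0_meshsize C p (D.mesh n) ((surf d).restrict (skeleton (D.mesh n)))
  have ht : D.node n.castSucc ≤ D.node n.succ :=
    (D.node_strictMono (Fin.castSucc_lt_succ (i := n))).le
  have f1 := hB.integral_slab_add hB mΩ D.isBounded fΩ ht (EssBdd.const 1) (dtL _ p v) (dtL _ p v)
  have f2 := hG.integral_slab_add hG mΩ D.isBounded fΩ ht (essBdd_coeff D hd) v v
  have f3 := hA.integral_slab_add hJ mΓ bΓ fΓ ht (EssBdd.const 1) v v
  have f4 := hJ.integral_slab_add hJ mΓ bΓ fΓ ht hσ v v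
  simp only [real_inner_comm (brokenOp _ p (dtL _ p (dtL _ p v)) _ _)] at f1
  simp only [real_inner_comm (brokenGradOp _ p v _ _) (brokenGradOp _ p (dtL _ p v) _ _)] at f2
  simp only [real_inner_comm (jumpOp _ p v _ _) (jumpOp _ p (dtL _ p v) _ _)] at f4
  rw [aSlab_eq D hd]
  simp only [energy, slabVolume, slabSkeleton, Discretization.slab] at *
  linarith

end Energy

section Positivity

/-! ### Domination of the consistency terms by the penalty terms -/

/-- The assumptions under which the penalty terms dominate the consistency terms: bounds for the
coefficient, shape regularity, local quasi-uniformity and a sufficiently large penalty parameter. -/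
structure PenaltyDominates {d : ℕ} (D : Discretization d) (c_a C_a c_T c_q C : ℝ) : Prop where
  pos : 0 < c_a
  coeff : ∀ x ∈ D.Ω, c_a < D.a x ∧ D.a x < C_a
  shape_pos : 0 < c_T
  shape : ∀ n, ShapeRegular (D.mesh n) c_T
  quasiUniform : ∀ n, LocallyQuasiUniform (D.mesh n) c_q
  le : c_T * C_a ^ 2 * (8 * (d + 1) * (1 + |c_q|)) / c_a ≤ C

variable {d p : ℕ} {D : Discretization d} {c_a C_a c_T c_q C : ℝ}

theorem PenaltyDominates.nonneg (h : PenaltyDominates D c_a C_a c_T c_q C) : 0 ≤ C := by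
  refine le_trans ?_ h.le
  have := h.pos
  have := h.shape_pos
  positivity

theorem integral_inner_sub_sub {Z E : Type*} [MeasurableSpace Z] [NormedAddCommGroup E]
    [InnerProductSpace ℝ E] {μ : Measure Z} {σ : Z → ℝ} (hσ : Integrable σ μ) {f₁ f₂ g₁ g₂ : Z → E}
    (hf₁ : EssBdd μ f₁) (hf₂ : EssBdd μ f₂) (hg₁ : EssBdd μ g₁) (hg₂ : EssBdd μ g₂) :
    ∫ z, σ z * inner ℝ (f₁ z - f₂ z) (g₁ z - g₂ z) ∂μ =
      (∫ z, σ z * inner ℝ (f₁ z) (g₁ z) ∂μ) - (∫ z, σ z * inner ℝ (f₁ z) (g₂ z) ∂μ) -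
        (∫ z, σ z * inner ℝ (f₂ z) (g₁ z) ∂μ) + ∫ z, σ z * inner ℝ (f₂ z) (g₂ z) ∂μ := by
  have i₁₁ := (hf₁.inner hg₁).integrable_mul hσ
  have i₁₂ := (hf₁.inner hg₂).integrable_mul hσ
  have i₂₁ := (hf₂.inner hg₁).integrable_mul hσ
  have i₂₂ := (hf₂.inner hg₂).integrable_mul hσ
  have i₃ : Integrable (fun z => σ z * inner ℝ (f₁ z) (g₁ z) - σ z * inner ℝ (f₁ z) (g₂ z)) μ :=
    i₁₁.sub i₁₂
  have i₄ : Integrable (fun z => σ z * inner ℝ (f₁ z) (g₁ z) - σ z * inner ℝ (f₁ z) (g₂ z) -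
    σ z * inner ℝ (f₂ z) (g₁ z)) μ := i₃.sub i₂₁
  rw [← integral_sub i₁₁ i₁₂, ← integral_sub i₃ i₂₁, ← integral_add i₄ i₂₂]
  refine integral_congr_ae (Eventually.of_forall fun z => ?_)
  simp only [inner_sub_left, inner_sub_right]
  ring

/-- Coercivity of the energy: the bound for two meshes with the same mesh twice and one function
equal to zero, as the overlay of a mesh with itself is the mesh. -/
theorem PenaltyDominates.le_energy (hd : 1 ≤ d) (h : PenaltyDominates D c_a C_a c_T c_q C)
    (n : Fin (D.M + 1)) (v : pwPoly (D.mesh n) p) (s : ℝ) :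
    1 / 2 * (∫ x in D.Ω, ‖brokenOp _ p (dtL _ p v) s x‖ ^ 2) +
      1 / 4 * (∫ x in D.Ω, D.a x * ‖brokenGradOp _ p v s x‖ ^ 2) ≤ energy D C n v s := by
  have hov : OverlayRegular (D.mesh n) (D.mesh n) c_T := by
    rintro K hK K' hK' ⟨x, hx, hx'⟩
    have := (D.isMesh n).eq_of_mem_of_mem_closure hd hK hK' hx (subset_closure hx')
    subst this
    rw [inter_self]
    exact ⟨h.shape n K hK, h.shape n K hK⟩
  have key := D.integral_inner_avgFlux_jump_le hd h.pos h.coeff h.shape_pos h.quasiUniform h.le n n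
    hov 0 v s
  simp only [map_zero, Pi.zero_apply, sub_zero, union_self, max_self] at key
  simp only [energy, real_inner_self_eq_norm_sq, one_mul]
  linarith

/-- The energy lost at a time node is nonnegative: it is at least the energy of the difference of
the two one-sided limits on the overlay of the meshes, since the meshsize at the node is the larger
one. -/
theorem PenaltyDominates.bSlab_le (hd : 1 ≤ d) (h : PenaltyDominates D c_a C_a c_T c_q C)
    (m : Fin D.M) (hm : OverlayRegular (D.mesh m.castSucc) (D.mesh m.succ) c_T)
    (u : pwPoly (D.mesh m.castSucc) p) (v : pwPoly (D.mesh m.succ) p) :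
    bSlab D p C m u.1 v.1 ≤ energy D C m.castSucc u (D.node m.succ.castSucc) +
      energy D C m.succ v (D.node m.succ.castSucc) := by
  have hT := D.isMesh m.castSucc
  have hT' := D.isMesh m.succ
  have mΩ := D.isOpen.measurableSet
  have fΩ := D.isBounded.measure_lt_top (μ := volume)
  have mΓ := measurableSet_skeleton₂ D m.castSucc m.succ
  have bΓ := isBounded_skeleton₂ D m.castSucc m.succ
  have fΓ := surf_skeleton₂_lt_top D hd m.castSucc m.succ
  have iΩ : IsFiniteMeasure (volume.restrict D.Ω) := ⟨by simpa using fΩ⟩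
  have iΓ : IsFiniteMeasure ((surf d).restrict (skeleton₂ D m.castSucc m.succ)) :=
    ⟨by simpa using fΓ⟩
  set s := D.node m.succ.castSucc
  have key := D.integral_inner_avgFlux_jump_le hd h.pos h.coeff h.shape_pos h.quasiUniform h.le
    m.castSucc m.succ hm u v s
  have hJ := (isTimeOp_jumpOp (p := p) hd hT).essBdd_static mΓ bΓ s u
  have hJ' := (isTimeOp_jumpOp (p := p) hd hT').essBdd_static mΓ bΓ s v
  have hA := (isTimeOp_avgFluxOp (p := p) (T := D.mesh m.castSucc) (surf d) D.a).essBdd_static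
    mΓ bΓ s u
  have hA' := (isTimeOp_avgFluxOp (p := p) (T := D.mesh m.succ) (surf d) D.a).essBdd_static
    mΓ bΓ s v
  have hB := (isTimeOp_brokenOp (p := p) hd hT volume).comp_dtL.essBdd_static
    mΩ D.isBounded s u
  have hB' := (isTimeOp_brokenOp (p := p) hd hT' volume).comp_dtL.essBdd_static
    mΩ D.isBounded s v
  have hG := (isTimeOp_brokenGradOp (p := p) hd hT volume).essBdd_static mΩ D.isBounded s u
  have hG' := (isTimeOp_brokenGradOp (p := p) hd hT' volume).essBdd_static mΩ D.isBounded s v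
  have hσ := essBdd_sigma0₂ (p := p) D C m.castSucc m.succ
    ((surf d).restrict (skeleton₂ D m.castSucc m.succ))
  have eB := integral_inner_sub_sub (integrable_const (1 : ℝ)) hB' hB hB' hB
  have eG := integral_inner_sub_sub (essBdd_coeff D hd).integrable hG' hG hG' hG
  have eA := integral_inner_sub_sub (integrable_const (1 : ℝ)) hA' hA hJ' hJ
  have eJ := integral_inner_sub_sub hσ.integrable hJ' hJ hJ' hJ
  have pB : 0 ≤ ∫ x in D.Ω, 1 * inner ℝ
      (brokenOp _ p (dtL _ p v) s x - brokenOp _ p (dtL _ p u) s x)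
      (brokenOp _ p (dtL _ p v) s x - brokenOp _ p (dtL _ p u) s x) :=
    integral_nonneg fun x => mul_nonneg zero_le_one real_inner_self_nonneg
  have pG : 0 ≤ ∫ x in D.Ω, D.a x * inner ℝ (brokenGradOp _ p v s x - brokenGradOp _ p u s x)
      (brokenGradOp _ p v s x - brokenGradOp _ p u s x) :=
    setIntegral_nonneg mΩ fun x hx =>
      mul_nonneg (h.pos.trans (h.coeff x hx).1).le real_inner_self_nonneg
  -- the penalty of either function alone is at least its penalty with the larger meshsize
  have pen : ∀ (n : Fin (D.M + 1)) (w : pwPoly (D.mesh n) p),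
      skeleton (D.mesh n) ⊆ skeleton₂ D m.castSucc m.succ →
      (∀ x, meshsize (D.mesh n) x ≤
        max (meshsize (D.mesh m.castSucc) x) (meshsize (D.mesh m.succ) x)) →
      (∫ x in skeleton₂ D m.castSucc m.succ, sigma0₂ D p C m.castSucc m.succ x *
        inner ℝ (jumpOp _ p w s x) (jumpOp _ p w s x) ∂surf d) ≤
      ∫ x in skeleton (D.mesh n), sigma0 C p (meshsize (D.mesh n) x) *
        inner ℝ (jumpOp _ p w s x) (jumpOp _ p w s x) ∂surf d := by
    intro n w hsub hle
    rw [integral_skeleton_eq mΓ hsub fun x hx => by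
      rw [jumpOp_eq_zero w _ hx, inner_zero_right, mul_zero]]
    have hw := (isTimeOp_jumpOp (p := p) hd (D.isMesh n)).essBdd_static mΓ bΓ s w
    refine integral_mono (hσ.mul (hw.inner hw)).integrable
      ((essBdd_sigma0_meshsize C p _ _).mul (hw.inner hw)).integrable fun x => ?_
    by_cases hx : x ∈ skeleton (D.mesh n)
    · have hpos := meshsize_pos hd (D.isMesh n)
        (adjacent_nonempty (D.isMesh n) (skeleton_subset_closure (D.isMesh n) hx))
      refine mul_le_mul_of_nonneg_right ?_ real_inner_self_nonneg
      have := h.nonneg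
      exact mul_le_mul_of_nonneg_left (inv_anti₀ hpos (hle x)) (by positivity)
    · simp [jumpOp_eq_zero w s hx]
  have pen₁ := pen m.castSucc u subset_union_left fun x => le_max_left _ _
  have pen₂ := pen m.succ v subset_union_right fun x => le_max_right _ _
  have ext₁ := integral_skeleton_eq (T := D.mesh m.castSucc) mΓ subset_union_left
    (f := fun x => 1 * inner ℝ (avgFluxOp D.a _ p u s x) (jumpOp _ p u s x)) fun x hx => by
      rw [jumpOp_eq_zero u _ hx, inner_zero_right, mul_zero]
  have ext₂ := integral_skeleton_eq (T := D.mesh m.succ) mΓ subset_union_right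
    (f := fun x => 1 * inner ℝ (avgFluxOp D.a _ p v s x) (jumpOp _ p v s x)) fun x hx => by
      rw [jumpOp_eq_zero v _ hx, inner_zero_right, mul_zero]
  simp only [real_inner_comm (jumpOp _ p u _ _) (jumpOp _ p v _ _)] at eJ
  simp only [LinearMap.comp_apply, real_inner_comm (brokenOp _ p (dtL _ p u) _ _)
    (brokenOp _ p (dtL _ p v) _ _)] at eB
  simp only [real_inner_comm (brokenGradOp _ p u _ _) (brokenGradOp _ p v _ _)] at eG
  simp only [← real_inner_self_eq_norm_sq] at key
  rw [bSlab_eq D hd, energy, energy, ext₁, ext₂]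
  simp only [one_mul, sigma0₂, skeleton₂] at *
  linarith

end Positivity

section Definiteness

/-! ### Definiteness on a slab -/

variable {d p : ℕ} {D : Discretization d} {c_a C_a c_T c_q C : ℝ} {σ₁ σ₂ : ℝ → Space d → ℝ}

theorem ae_slabSkeleton (D : Discretization d) (n : Fin (D.M + 1)) :
    ∀ᵐ z ∂slabSkeleton D n, z.1 ∈ D.slab n ∧ z.2 ∈ skeleton (D.mesh n) := by
  have h1 : ∀ᵐ z ∂slabSkeleton D n, z.1 ∈ D.slab n :=
    Measure.quasiMeasurePreserving_fst.ae (ae_restrict_mem measurableSet_Ioo)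
  have h2 : ∀ᵐ z ∂slabSkeleton D n, z.2 ∈ skeleton (D.mesh n) :=
    Measure.quasiMeasurePreserving_snd.ae (ae_restrict_mem (isClosed_skeleton _).measurableSet)
  filter_upwards [h1, h2] with z hz1 hz2 using ⟨hz1, hz2⟩

theorem IsPenalty.integral_nonneg {σ : ℝ → Space d → ℝ} (hσ : IsPenalty D σ) (n : Fin (D.M + 1))
    {E : Type*} [NormedAddCommGroup E] [InnerProductSpace ℝ E] (f : ℝ × Space d → E) :
    0 ≤ ∫ z, σ z.1 z.2 * inner ℝ (f z) (f z) ∂slabSkeleton D n := by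
  refine integral_nonneg_of_ae ?_
  filter_upwards [ae_slabSkeleton D n] with z hz
  exact mul_nonneg ((hσ n).1 _ hz.1 _ hz.2).le real_inner_self_nonneg

theorem PenaltyDominates.energy_nonneg (hd : 1 ≤ d) (h : PenaltyDominates D c_a C_a c_T c_q C)
    (n : Fin (D.M + 1)) (v : pwPoly (D.mesh n) p) (s : ℝ) : 0 ≤ energy D C n v s := by
  refine le_trans ?_ (h.le_energy hd n v s)
  have h1 : 0 ≤ ∫ x in D.Ω, ‖brokenOp _ p (dtL _ p v) s x‖ ^ 2 :=
    MeasureTheory.integral_nonneg fun x => by positivity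
  have h2 : 0 ≤ ∫ x in D.Ω, D.a x * ‖brokenGradOp _ p v s x‖ ^ 2 :=
    setIntegral_nonneg D.isOpen.measurableSet fun x hx =>
      mul_nonneg (h.pos.trans (h.coeff x hx).1).le (by positivity)
  positivity

/-- A function whose jump vanishes almost everywhere on a slab has no jump at the initial time. -/
theorem ae_jumpOp_eq_zero (hd : 1 ≤ d) (n : Fin (D.M + 1)) (v : pwPoly (D.mesh n) p)
    (h : ∀ᵐ z ∂slabSkeleton D n, jumpOp _ p v z.1 z.2 = 0) :
    ∀ᵐ x ∂(surf d).restrict (skeleton (D.mesh n)), jumpOp _ p v (D.node n.castSucc) x = 0 := by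
  have h1 : ∀ᵐ z ∂((surf d).restrict (skeleton (D.mesh n))).prod (volume.restrict (D.slab n)),
      jumpOp _ p v z.2 z.1 = 0 := by
    have := (D.isMesh n).surf_skeleton_lt_top hd
    have : IsFiniteMeasure ((surf d).restrict (skeleton (D.mesh n))) := ⟨by simpa using this⟩
    exact Measure.measurePreserving_swap.quasiMeasurePreserving.ae h
  filter_upwards [Measure.ae_ae_of_ae_prod h1] with x hx
  have hc : Continuous fun s => jumpOp _ p v s x :=
    continuous_iff_continuousAt.2 fun s => (hasDerivAt_valOp _ v s x).continuousAt
  have hlt : D.node n.castSucc < D.node n.succ := D.node_strictMono (Fin.castSucc_lt_succ (i := n))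
  have h2 : (fun s => jumpOp _ p v s x)
      =ᵐ[volume.restrict (Icc (D.node n.castSucc) (D.node n.succ))]
      fun _ => 0 := by
    rw [← restrict_Ioo_eq_restrict_Icc]
    exact hx
  exact Measure.eqOn_Icc_of_ae_eq volume hlt.ne h2 hc.continuousOn continuousOn_const
    (left_mem_Icc.2 hlt.le)

/-- A Trefftz function with zero initial energy and zero penalty term vanishes: at the initial time
its time derivative is zero and it is piecewise constant without jumps, hence zero, and the wave
equation determines it by its initial data. -/
theorem PenaltyDominates.eq_zero_of_energy_eq_zero (hd : 1 ≤ d)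
    (h : PenaltyDominates D c_a C_a c_T c_q C) (h₁ : IsPenalty D σ₁) (n : Fin (D.M + 1))
    (v : pwPoly (D.mesh n) p) (hv : v.1 ∈ slabTrefftz D p n)
    (hE : energy D C n v (D.node n.castSucc) = 0)
    (hP : ∫ z, σ₁ z.1 z.2 * inner ℝ (jumpOp _ p v z.1 z.2) (jumpOp _ p v z.1 z.2)
      ∂slabSkeleton D n = 0) : v = 0 := by
  have hT := D.isMesh n
  have mΩ := D.isOpen.measurableSet
  have fΩ := D.isBounded.measure_lt_top (μ := volume)
  have mΓ := (isClosed_skeleton (D.mesh n)).measurableSet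
  have bΓ := D.isBounded.closure.subset (skeleton_subset_closure hT)
  have fΓ := hT.surf_skeleton_lt_top hd
  have iΩ : IsFiniteMeasure (volume.restrict D.Ω) := ⟨by simpa using fΩ⟩
  have hlt : D.node n.castSucc < D.node n.succ := D.node_strictMono (Fin.castSucc_lt_succ (i := n))
  have hle := h.le_energy hd n v (D.node n.castSucc)
  set s := D.node n.castSucc
  have hB := (isTimeOp_brokenOp (p := p) hd hT volume).comp_dtL.essBdd_static
    mΩ D.isBounded s v
  have hG := (isTimeOp_brokenGradOp (p := p) hd hT volume).essBdd_static mΩ D.isBounded s v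
  have pB : 0 ≤ ∫ x in D.Ω, ‖brokenOp _ p (dtL _ p v) s x‖ ^ 2 :=
    MeasureTheory.integral_nonneg fun x => by positivity
  have pG' : 0 ≤ᵐ[volume.restrict D.Ω] fun x => D.a x * ‖brokenGradOp _ p v s x‖ ^ 2 := by
    filter_upwards [ae_restrict_mem mΩ] with x hx
    exact mul_nonneg (h.pos.trans (h.coeff x hx).1).le (by positivity)
  have pG := integral_nonneg_of_ae pG'
  have zB : ∫ x in D.Ω, ‖brokenOp _ p (dtL _ p v) s x‖ ^ 2 = 0 := by linarith
  have zG : ∫ x in D.Ω, D.a x * ‖brokenGradOp _ p v s x‖ ^ 2 = 0 := by linarith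
  rw [integral_eq_zero_iff_of_nonneg (fun x => by positivity) (by
    simp only [← real_inner_self_eq_norm_sq]; exact (hB.inner hB).integrable)] at zB
  rw [integral_eq_zero_iff_of_nonneg_ae pG' (by
    simp only [← real_inner_self_eq_norm_sq]
    exact ((essBdd_coeff D hd).mul (hG.inner hG)).integrable)] at zG
  have hJ := ae_jumpOp_eq_zero hd n v (by
    rw [integral_eq_zero_iff_of_nonneg_ae] at hP
    · filter_upwards [hP, ae_slabSkeleton D n] with z hz hz'
      rw [Pi.zero_apply, mul_eq_zero, inner_self_eq_zero] at hz
      exact hz.resolve_left ((h₁ n).1 _ hz'.1 _ hz'.2).ne'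
    · filter_upwards [ae_slabSkeleton D n] with z hz
      exact mul_nonneg ((h₁ n).1 _ hz.1 _ hz.2).le real_inner_self_nonneg
    · have hJ := (isTimeOp_jumpOp (p := p) hd hT).essBdd_slab mΓ bΓ fΓ s (D.node n.succ) v
      exact (hJ.inner hJ).integrable_mul (h₁ n).2)
  have hdt : ∀ K : D.mesh n, ∀ x ∈ (K : Set (Space d)), deriv (fun r => v.1 K r x) s = 0 := by
    intro K
    have hc : Continuous fun x => deriv (fun r => v.1 K r x) s :=
      (polySpace_continuous (polySpace_dt (pwPoly_apply v.2 K))).comp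
        (by fun_prop : Continuous fun x : Space d => (s, x))
    refine Measure.eqOn_open_of_ae_eq (μ := volume) (g := fun _ => (0 : ℝ)) ?_ (hT.isOpen hd K.2)
      hc.continuousOn continuousOn_const
    filter_upwards [ae_restrict_of_ae_restrict_of_subset (hT.subset K K.2) zB,
      ae_restrict_mem (hT.isOpen hd K.2).measurableSet] with x hx hxK
    rw [brokenOp_of_mem hd hT _ s hxK, Pi.zero_apply, sq_eq_zero_iff, norm_eq_zero] at hx
    exact hx
  have hgrad : ∀ K : D.mesh n, ∀ x ∈ (K : Set (Space d)),
      gradient (fun y => v.1 K s y) x = 0 := by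
    intro K
    have hc : Continuous fun x => gradient (fun y => v.1 K s y) x :=
      (polySpace_continuous_gradient (pwPoly_apply v.2 K)).comp
        (by fun_prop : Continuous fun x : Space d => (s, x))
    refine Measure.eqOn_open_of_ae_eq (μ := volume) (g := fun _ => (0 : Space d)) ?_
      (hT.isOpen hd K.2) hc.continuousOn continuousOn_const
    filter_upwards [ae_restrict_of_ae_restrict_of_subset (hT.subset K K.2) zG,
      ae_restrict_mem (hT.isOpen hd K.2).measurableSet] with x hx hxK
    rw [brokenGradOp_of_mem hd hT _ s hxK, Pi.zero_apply, mul_eq_zero, sq_eq_zero_iff,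
      norm_eq_zero] at hx
    exact hx.resolve_left (h.pos.trans (h.coeff x (hT.subset K K.2 hxK)).1).ne'
  have hconst : ∀ K : D.mesh n, ∀ x, v.1 K s x = v.1 K s 0 := by
    intro K x
    have hne := (hT.exists_isPolyhedron hd K.2).2.1
    have hg : ∀ y, HasFDerivAt (fun y => v.1 K s y) (0 : Space d →L[ℝ] ℝ) y := by
      intro y
      have h1 := (polySpace_hasGradientAt (pwPoly_apply v.2 K) s y).hasFDerivAt
      have h2 : gradient (fun y => v.1 K s y) y = 0 := by
        ext i
        exact polySpace_eq_zero_of_open (polySpace_gradient (pwPoly_apply v.2 K) i)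
          (hT.isOpen hd K.2) hne (fun z hz => by rw [hgrad K z hz]; rfl) y
      rwa [h2, map_zero] at h1
    exact is_const_of_fderiv_eq_zero (fun y => (hg y).differentiableAt) (fun y => (hg y).fderiv) x 0
  have hc0 := hT.eq_zero_of_jump_eq_zero hd (c := fun K => v.1 K s 0) (by
    filter_upwards [hJ] with x hx
    rw [← jump_atTime hd hT] at hx
    refine Eq.trans ?_ hx
    congr 1
    funext K y
    exact (hconst K y).symm)
  refine Subtype.ext (funext fun K => ?_)
  exact eq_zero_of_waveOp_eq_zero (pwPoly_apply v.2 K) (I := D.slab n) isOpen_Ioo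
    (nonempty_Ioo.2 hlt) (hT.isOpen hd K.2) (hT.exists_isPolyhedron hd K.2).2.1 (hv.2 K)
    (t₀ := s) (fun x _ => (hconst K x).trans (congrFun hc0 K)) (hdt K)

end Definiteness

section LinearAlgebra

/-! ### Nonnegative bilinear forms -/

variable {V : Type*} [AddCommGroup V] [Module ℝ V]

/-- The square root of a nonnegative quadratic form is a seminorm. -/
theorem IsBilin.exists_seminorm {f : V → V → ℝ} (hf : IsBilin f) (h0 : ∀ v, 0 ≤ f v v) :
    ∃ q : Seminorm ℝ V, ∀ v, q v = √(f v v) := by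
  obtain ⟨B, hB⟩ := hf
  simp only [← hB] at h0 ⊢
  have hadd : ∀ u v, B (u + v) (u + v) = B u u + (B u v + B v u) + B v v := by
    intro u v
    simp only [map_add, LinearMap.add_apply]
    ring
  have cs : ∀ u v, B u v + B v u ≤ 2 * (√(B u u) * √(B v v)) := by
    intro u v
    -- `t ↦ B (u + t v) (u + t v)` is a nonnegative quadratic polynomial
    have hdisc : discrim (B v v) (B u v + B v u) (B u u) ≤ 0 := by
      refine discrim_le_zero fun t => ?_
      have := h0 (u + t • v)
      rw [hadd] at this
      simp only [map_smul, LinearMap.smul_apply, smul_eq_mul] at this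
      linarith
    rw [discrim] at hdisc
    have h1 : (B u v + B v u) ^ 2 ≤ (2 * (√(B u u) * √(B v v))) ^ 2 := by
      rw [mul_pow, mul_pow, Real.sq_sqrt (h0 u), Real.sq_sqrt (h0 v)]
      linarith
    exact (abs_le_of_sq_le_sq' h1 (by positivity)).2
  refine ⟨Seminorm.of (fun v => √(B v v)) (fun u v => ?_) (fun c v => ?_), fun v => rfl⟩
  · refine Real.sqrt_le_iff.2 ⟨by positivity, ?_⟩
    rw [hadd, add_sq, Real.sq_sqrt (h0 u), Real.sq_sqrt (h0 v)]
    linarith [cs u v]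
  · simp only [map_smul, LinearMap.smul_apply, smul_eq_mul]
    rw [← mul_assoc, Real.sqrt_mul (mul_self_nonneg c), Real.sqrt_mul_self_eq_abs]
    rfl

/-- In finite dimension, a definite bilinear form represents every linear functional. -/
theorem IsBilin.existsUnique [FiniteDimensional ℝ V] {f : V → V → ℝ} (hf : IsBilin f)
    (h0 : ∀ v, f v v = 0 → v = 0) (ℓ : V →ₗ[ℝ] ℝ) : ∃! u, ∀ v, f u v = ℓ v := by
  obtain ⟨B, hB⟩ := hf
  simp only [← hB] at h0 ⊢
  have hinj : Function.Injective B := by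
    refine (injective_iff_map_eq_zero B).2 fun u hu => h0 u ?_
    rw [hu]; rfl
  have hsurj : Function.Surjective (B : V →ₗ[ℝ] Module.Dual ℝ V) :=
    (LinearMap.injective_iff_surjective_of_finrank_eq_finrank
      Subspace.dual_finrank_eq.symm).1 hinj
  obtain ⟨u, hu⟩ := hsurj ℓ
  exact ⟨u, fun v => by rw [hu], fun w hw => hinj (hu ▸ LinearMap.ext hw)⟩

end LinearAlgebra

section SpaceTime

/-! ### The space-time form -/

variable {d p : ℕ} (D : Discretization d) {c_a C_a c_T c_q C : ℝ} {σ₁ σ₂ : ℝ → Space d → ℝ}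

/-- The restriction of a function to a slab. -/
def slabPart (p : ℕ) (n : Fin (D.M + 1)) : fullSpace D p →ₗ[ℝ] pwPoly (D.mesh n) p where
  toFun v := ⟨v.1 n, v.2 n (mem_univ n)⟩
  map_add' _ _ := rfl
  map_smul' _ _ := rfl

theorem isBilin_aForm (hd : 1 ≤ d) (C : ℝ) (h₁ : IsPenalty D σ₁) (h₂ : IsPenalty D σ₂) :
    IsBilin fun u v : fullSpace D p => aForm D p C σ₁ σ₂ u v :=
  (IsBilin.sum _ fun n => (isBilin_aSlab D hd C h₁ h₂ n).comp (slabPart D p n)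
    (slabPart D p n)).sub (IsBilin.sum _ fun m => (isBilin_bSlab D hd C m).comp
      (slabPart D p m.castSucc) (slabPart D p m.succ))

/-- The quadratic form of `a` is the sum of the initial and the final energy, of the penalty terms,
and of the energies that are lost at the inner time nodes. -/
theorem aForm_self (hd : 1 ≤ d) (C : ℝ) (v : fullSpace D p) :
    aForm D p C σ₁ σ₂ v v =
      energy D C 0 (slabPart D p 0 v) (D.node 0) +
      energy D C (Fin.last D.M) (slabPart D p (Fin.last D.M) v) (D.node (Fin.last (D.M + 1))) +
      (∑ n, (∫ z, σ₁ z.1 z.2 * inner ℝ (jumpOp _ p (slabPart D p n v) z.1 z.2)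
        (jumpOp _ p (slabPart D p n v) z.1 z.2) ∂slabSkeleton D n)) +
      (∑ n, ∫ z, σ₂ z.1 z.2 * inner ℝ (jumpFluxOp D.Ω D.a _ p (slabPart D p n v) z.1 z.2)
        (jumpFluxOp D.Ω D.a _ p (slabPart D p n v) z.1 z.2) ∂slabSkeleton D n) +
      ∑ m : Fin D.M, (energy D C m.castSucc (slabPart D p m.castSucc v) (D.node m.succ.castSucc) +
        energy D C m.succ (slabPart D p m.succ v) (D.node m.succ.castSucc) -
        bSlab D p C m (slabPart D p m.castSucc v).1 (slabPart D p m.succ v).1) := by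
  have h1 : ∀ n, aSlab D p C σ₁ σ₂ n (v.1 n) (v.1 n) = _ := fun n =>
    aSlab_self D hd C σ₁ σ₂ n (slabPart D p n v)
  have h2 := Fin.sum_univ_succ fun n =>
    energy D C n (slabPart D p n v) (D.node n.castSucc)
  have h3 := Fin.sum_univ_castSucc fun n =>
    energy D C n (slabPart D p n v) (D.node n.succ)
  simp only [Fin.succ_castSucc, Fin.succ_last, Fin.castSucc_zero] at h2 h3
  simp only [aForm, h1, Finset.sum_add_distrib, Finset.sum_sub_distrib, h2, h3]
  simp only [slabPart, LinearMap.coe_mk, AddHom.coe_mk, Nat.succ_eq_add_one]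
  ring

variable {D}

theorem PenaltyDominates.aSlab_nonneg (hd : 1 ≤ d) (h : PenaltyDominates D c_a C_a c_T c_q C)
    (h₁ : IsPenalty D σ₁) (h₂ : IsPenalty D σ₂) (n : Fin (D.M + 1)) (v : pwPoly (D.mesh n) p) :
    0 ≤ aSlab D p C σ₁ σ₂ n v.1 v.1 := by
  rw [aSlab_self D hd]
  have e1 := h.energy_nonneg hd n v (D.node n.castSucc)
  have e2 := h.energy_nonneg hd n v (D.node n.succ)
  have e3 := h₁.integral_nonneg n fun z => jumpOp _ p v z.1 z.2
  have e4 := h₂.integral_nonneg n fun z => jumpFluxOp D.Ω D.a _ p v z.1 z.2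
  positivity

theorem PenaltyDominates.eq_zero_of_aSlab_eq_zero (hd : 1 ≤ d)
    (h : PenaltyDominates D c_a C_a c_T c_q C) (h₁ : IsPenalty D σ₁) (h₂ : IsPenalty D σ₂)
    (n : Fin (D.M + 1)) (v : pwPoly (D.mesh n) p) (hv : v.1 ∈ slabTrefftz D p n)
    (h0 : aSlab D p C σ₁ σ₂ n v.1 v.1 = 0) : v = 0 := by
  rw [aSlab_self D hd] at h0
  have e1 := h.energy_nonneg hd n v (D.node n.castSucc)
  have e2 := h.energy_nonneg hd n v (D.node n.succ)
  have e3 := h₁.integral_nonneg n fun z => jumpOp _ p v z.1 z.2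
  have e4 := h₂.integral_nonneg n fun z => jumpFluxOp D.Ω D.a _ p v z.1 z.2
  exact h.eq_zero_of_energy_eq_zero hd h₁ n v hv (by linarith) (by linarith)

theorem PenaltyDominates.aForm_nonneg (hd : 1 ≤ d) (h : PenaltyDominates D c_a C_a c_T c_q C)
    (h₁ : IsPenalty D σ₁) (h₂ : IsPenalty D σ₂)
    (hov : ∀ m : Fin D.M, OverlayRegular (D.mesh m.castSucc) (D.mesh m.succ) c_T)
    (v : fullSpace D p) : 0 ≤ aForm D p C σ₁ σ₂ v v := by
  rw [aForm_self D hd]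
  refine add_nonneg (add_nonneg (add_nonneg (add_nonneg ?_ ?_) ?_) ?_) ?_
  · exact h.energy_nonneg hd _ _ _
  · exact h.energy_nonneg hd _ _ _
  · exact Finset.sum_nonneg fun n _ => h₁.integral_nonneg n fun z => jumpOp _ p _ z.1 z.2
  · exact Finset.sum_nonneg fun n _ => h₂.integral_nonneg n fun z =>
      jumpFluxOp D.Ω D.a _ p _ z.1 z.2
  · exact Finset.sum_nonneg fun m _ => sub_nonneg.2 (h.bSlab_le hd m (hov m) _ _)

/-- Definiteness: the initial energy vanishes, hence the function vanishes on the first slab, and no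
energy is lost at the time nodes, so that it vanishes on one slab after the other. -/
theorem PenaltyDominates.eq_zero_of_aForm_eq_zero (hd : 1 ≤ d)
    (h : PenaltyDominates D c_a C_a c_T c_q C) (h₁ : IsPenalty D σ₁) (h₂ : IsPenalty D σ₂)
    (hov : ∀ m : Fin D.M, OverlayRegular (D.mesh m.castSucc) (D.mesh m.succ) c_T)
    (v : fullSpace D p) (hv : v.1 ∈ trefftz D p) (h0 : aForm D p C σ₁ σ₂ v v = 0) : v = 0 := by
  rw [aForm_self D hd] at h0
  have q1 : ∀ n ∈ Finset.univ, 0 ≤ ∫ z, σ₁ z.1 z.2 * inner ℝ (jumpOp _ p (slabPart D p n v) z.1 z.2)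
        (jumpOp _ p (slabPart D p n v) z.1 z.2) ∂slabSkeleton D n :=
    fun n _ => h₁.integral_nonneg n fun z => jumpOp _ p (slabPart D p n v) z.1 z.2
  have q3 : ∀ m ∈ Finset.univ, 0 ≤
      energy D C m.castSucc (slabPart D p m.castSucc v) (D.node m.succ.castSucc) +
        energy D C m.succ (slabPart D p m.succ v) (D.node m.succ.castSucc) -
        bSlab D p C m (slabPart D p m.castSucc v).1 (slabPart D p m.succ v).1 :=
    fun m _ => sub_nonneg.2 (h.bSlab_le hd m (hov m) _ _)
  have p1 := Finset.sum_nonneg q1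
  have p2 := Finset.sum_nonneg fun n (_ : n ∈ Finset.univ) => h₂.integral_nonneg n
    fun z => jumpFluxOp D.Ω D.a _ p (slabPart D p n v) z.1 z.2
  have p3 := Finset.sum_nonneg q3
  have e1 := h.energy_nonneg hd 0 (slabPart D p 0 v) (D.node 0)
  have e2 := h.energy_nonneg hd (Fin.last D.M) (slabPart D p (Fin.last D.M) v)
    (D.node (Fin.last (D.M + 1)))
  have z1 := (Finset.sum_eq_zero_iff_of_nonneg q1).1 (by linarith)
  have z3 := (Finset.sum_eq_zero_iff_of_nonneg q3).1 (by linarith)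
  have hslab : ∀ n, slabPart D p n v = 0 := by
    intro n
    induction n using Fin.induction with
    | zero =>
      exact h.eq_zero_of_energy_eq_zero hd h₁ 0 _ (hv 0 (mem_univ _)) (le_antisymm
        (by rw [Fin.castSucc_zero]; linarith) (h.energy_nonneg hd _ _ _)) (z1 0 (Finset.mem_univ _))
    | succ m ih =>
      refine h.eq_zero_of_energy_eq_zero hd h₁ m.succ _ (hv m.succ (mem_univ _)) ?_
        (z1 m.succ (Finset.mem_univ _))
      have := z3 m (Finset.mem_univ _)
      -- the limit from the preceding slab is zero, so the loss is the energy of the next slab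
      rw [ih] at this
      have hb : bSlab D p C m (0 : pwPoly (D.mesh m.castSucc) p).1
            (slabPart D p m.succ v).1 = 0 := by
        obtain ⟨B, hB⟩ := isBilin_bSlab (p := p) D hd C m
        exact (hB 0 _).symm.trans (by rw [map_zero, LinearMap.zero_apply])
      have he : energy D C m.castSucc (0 : pwPoly (D.mesh m.castSucc) p)
          (D.node m.succ.castSucc) = 0 := by
        simp [energy]
      linarith
  exact Subtype.ext (funext fun n => congrArg Subtype.val (hslab n))

end SpaceTime

section FiniteDimensional

/-! ### Finite dimension -/

variable {d : ℕ}

instance finiteDimensional_polySpace (d p : ℕ) : FiniteDimensional ℝ (polySpace d p) := by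
  let ev : MvPolynomial (Option (Fin d)) ℝ →ₗ[ℝ] (ℝ → Space d → ℝ) :=
    { toFun := fun P t x => MvPolynomial.eval (fun o : Option (Fin d) => o.elim t fun i => x i) P
      map_add' := fun P Q => by funext t x; simp
      map_smul' := fun c P => by funext t x; simp [MvPolynomial.smul_eval] }
  have hle : polySpace d p ≤ (MvPolynomial.restrictTotalDegree (Option (Fin d)) ℝ p).map ev := by
    rintro f ⟨P, hP, hf⟩
    exact ⟨P, (MvPolynomial.mem_restrictTotalDegree _ _ _).2 hP, funext fun t => funext fun x =>
      (hf t x).symm⟩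
  exact Submodule.finiteDimensional_of_le hle

instance finiteDimensional_trefftz (D : Discretization d) (p : ℕ) :
    FiniteDimensional ℝ (trefftz D p) := by
  let A : trefftz D p →ₗ[ℝ] ((n : Fin (D.M + 1)) → D.mesh n → polySpace d p) :=
    { toFun := fun v n K => ⟨v.1 n K, (v.2 n (mem_univ n)).1 K (mem_univ K)⟩
      map_add' := fun _ _ => rfl
      map_smul' := fun _ _ => rfl }
  refine FiniteDimensional.of_injective A fun u v huv => ?_
  refine Subtype.ext (funext fun n => funext fun K => ?_)
  exact congrArg Subtype.val (congrFun (congrFun huv n) K)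

/-- The inclusion of the Trefftz space in the finite element space. -/
def trefftzIncl (D : Discretization d) (p : ℕ) : trefftz D p →ₗ[ℝ] fullSpace D p :=
  Submodule.inclusion fun _ hv n _ => (hv n (mem_univ n)).1

end FiniteDimensional

section InitialData

/-! ### The linear form of the initial data -/

section IsLin

variable {V Z E : Type*} [AddCommGroup V] [Module ℝ V] [MeasurableSpace Z]
  [NormedAddCommGroup E] {μ : Measure Z}

theorem EssBdd.integrable_smul [NormedSpace ℝ E] {c : Z → ℝ} {f : Z → E} (hc : EssBdd μ c)
    (hf : Integrable f μ) : Integrable (fun z => c z • f z) μ := by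
  obtain ⟨C, hC⟩ := hc.2
  refine (hf.norm.const_mul C).mono' (hc.1.smul hf.1) ?_
  filter_upwards [hC] with z hz
  rw [norm_smul]
  gcongr

/-- The function `f` is linear. -/
def IsLin (f : V → ℝ) : Prop := ∃ ℓ : V →ₗ[ℝ] ℝ, ∀ v, ℓ v = f v

theorem IsLin.add {f g : V → ℝ} (hf : IsLin f) (hg : IsLin g) : IsLin fun v => f v + g v := by
  obtain ⟨ℓ, h⟩ := hf
  obtain ⟨ℓ', h'⟩ := hg
  exact ⟨ℓ + ℓ', fun v => by simp [h, h']⟩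

theorem IsLin.sub {f g : V → ℝ} (hf : IsLin f) (hg : IsLin g) : IsLin fun v => f v - g v := by
  obtain ⟨ℓ, h⟩ := hf
  obtain ⟨ℓ', h'⟩ := hg
  exact ⟨ℓ - ℓ', fun v => by simp [h, h']⟩

theorem IsLin.comp {U : Type*} [AddCommGroup U] [Module ℝ U] {f : V → ℝ} (hf : IsLin f)
    (A : U →ₗ[ℝ] V) : IsLin fun u => f (A u) := by
  obtain ⟨ℓ, h⟩ := hf
  exact ⟨ℓ ∘ₗ A, fun v => by simp [h]⟩

theorem isLin_integral [InnerProductSpace ℝ E] {f : Z → E} (hf : Integrable f μ) (A : V →ₗ[ℝ] Z → E)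
    (hA : ∀ v, EssBdd μ (A v)) : IsLin fun v => ∫ z, inner ℝ (f z) (A v z) ∂μ := by
  have hi : ∀ v, Integrable (fun z => inner ℝ (f z) (A v z)) μ := by
    intro v
    obtain ⟨C, hC⟩ := (hA v).2
    refine (hf.norm.mul_const C).mono' (hf.1.inner (hA v).1) ?_
    filter_upwards [hC] with z hz
    exact (norm_inner_le_norm _ _).trans (by gcongr)
  refine ⟨⟨⟨fun v => ∫ z, inner ℝ (f z) (A v z) ∂μ, fun u v => ?_⟩, fun c v => ?_⟩, fun v => rfl⟩
  · simp only [map_add, Pi.add_apply, inner_add_right]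
    exact integral_add (hi u) (hi v)
  · simp only [map_smul, Pi.smul_apply, real_inner_smul_right, RingHom.id_apply, smul_eq_mul]
    exact integral_const_mul c _

end IsLin

variable {d p : ℕ} {Ω : Set (Space d)} {T : Finset (Set (Space d))} {E : Type*}
  [NormedAddCommGroup E] [NormedSpace ℝ E]

theorem HasTrace.integrable (hd : 1 ≤ d) (hT : IsMesh Ω T) {K : T} {f g : Space d → E}
    (h : HasTrace (K : Set (Space d)) f g) :
    Integrable ((frontier (K : Set (Space d))).indicator g) (surf d) := by
  obtain ⟨⟨H, hH⟩, -, hb⟩ := hT.exists_isPolyhedron hd K.2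
  have : IsFiniteMeasure ((surf d).restrict (frontier (K : Set (Space d)))) :=
    ⟨by simpa using hH.surf_frontier_lt_top hb⟩
  exact (integrable_indicator_iff isClosed_frontier.measurableSet).2 (h.1.integrable one_le_two)

/-- The average of traces is integrable on the skeleton. -/
theorem integrableOn_avg (hd : 1 ≤ d) (hT : IsMesh Ω T) (c : T → ℝ) {f : Space d → E}
    {g : T → Space d → E} (h : ∀ K : T, HasTrace (K : Set (Space d)) f (g K)) :
    IntegrableOn (avg fun K x => c K • g K x) (skeleton T) (surf d) := by
  have h1 : IntegrableOn (fun x => ∑ K : T, (avgW T K x * c K) •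
      (frontier (K : Set (Space d))).indicator (g K) x) (skeleton T) (surf d) := by
    refine integrable_finsetSum _ fun K _ => ?_
    exact ((essBdd_avgW (ξ := id) aemeasurable_id K).mul (EssBdd.const (c K))).integrable_smul
      ((h K).integrable hd hT).restrict
  refine h1.congr ?_
  filter_upwards [ae_restrict_mem (isClosed_skeleton T).measurableSet] with x hx
  rw [avg_eq]
  refine Finset.sum_congr rfl fun K _ => ?_
  by_cases hK : K ∈ adjacent T x
  · rw [indicator_of_mem (hT.mem_frontier_of_mem_closure hd K.2 (mem_adjacent.1 hK) hx), mul_smul]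
  · simp [avgW, hK]

/-- The jump of traces is integrable. -/
theorem integrable_jump (hd : 1 ≤ d) (hT : IsMesh Ω T) {f : Space d → ℝ}
    {g : T → Space d → ℝ} (h : ∀ K : T, HasTrace (K : Set (Space d)) f (g K)) :
    Integrable (jump g) (surf d) := by
  have h1 : Integrable (fun x => ∑ K : T,
      (frontier (K : Set (Space d))).indicator (g K) x • normalW T K x) (surf d) := by
    refine integrable_finsetSum _ fun K _ => ?_
    have hW := hT.essBdd_normalW hd K
    obtain ⟨C, hC⟩ := hW.2
    have hg := (h K).integrable hd hT
    refine (hg.norm.mul_const C).mono' (hg.1.smul hW.1) ?_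
    filter_upwards [hC] with z hz
    rw [norm_smul]
    gcongr
  refine h1.congr (Eventually.of_forall fun x => ?_)
  rw [hT.jump_eq hd]
  refine Finset.sum_congr rfl fun K _ => ?_
  by_cases hx : x ∈ frontier (K : Set (Space d))
  · rw [indicator_of_mem hx]
  · simp [normalW, hx]

variable (D : Discretization d)

/-- The evaluation of an operator at a fixed time. -/
def evalTime {E : Type*} [AddCommGroup E] [Module ℝ E]
    (A : pwPoly T p →ₗ[ℝ] (ℝ → Space d → E)) (s : ℝ) : pwPoly T p →ₗ[ℝ] (Space d → E) :=
  LinearMap.proj s ∘ₗ A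

theorem isLin_bInit (hd : 1 ≤ d) (C : ℝ) {u₀ v₀ : Space d → ℝ} {G : Space d → Space d}
    {τ : D.mesh 0 → Space d → ℝ} {γ : D.mesh 0 → Space d → Space d}
    (hG : MemLp G 2 (volume.restrict D.Ω)) (hv₀ : MemLp v₀ 2 (volume.restrict D.Ω))
    (hτ : ∀ K : D.mesh 0, HasTrace (K : Set (Space d)) u₀ (τ K))
    (hγ : ∀ K : D.mesh 0, HasTrace (K : Set (Space d)) G (γ K)) :
    IsLin fun v : fullSpace D p => bInit D p C G v₀ τ γ v := by
  have hT := D.isMesh 0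
  have mΩ := D.isOpen.measurableSet
  have fΩ := D.isBounded.measure_lt_top (μ := volume)
  have mΓ := (isClosed_skeleton (D.mesh 0)).measurableSet
  have bΓ := D.isBounded.closure.subset (skeleton_subset_closure hT)
  have fΓ := hT.surf_skeleton_lt_top hd
  have iΩ : IsFiniteMeasure (volume.restrict D.Ω) := ⟨by simpa using fΩ⟩
  set s := D.node 0 with hs
  have hJ := (isTimeOp_jumpOp (p := p) hd hT).essBdd_static mΓ bΓ s
  have hA := (isTimeOp_avgFluxOp (p := p) (T := D.mesh 0) (surf d) D.a).essBdd_static mΓ bΓ s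
  have hB := (isTimeOp_brokenOp (p := p) hd hT volume).comp_dtL.essBdd_static mΩ D.isBounded s
  have hGr := (isTimeOp_brokenGradOp (p := p) hd hT volume).essBdd_static mΩ D.isBounded s
  have hj := integrable_jump hd hT hτ
  have hb : ∀ v : fullSpace D p, bInit D p C G v₀ τ γ v =
      (∫ x in D.Ω, inner ℝ (v₀ x) (brokenOp _ p (dtL _ p (slabPart D p 0 v)) s x))
      + (∫ x in D.Ω, inner ℝ (D.a x • G x) (brokenGradOp _ p (slabPart D p 0 v) s x))
      - (∫ x in skeleton (D.mesh 0),
          inner ℝ (avg (fun (K : D.mesh 0) y => coeffOn D.a (K : Set (Space d)) • γ K y) x)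
            (jumpOp _ p (slabPart D p 0 v) s x) ∂surf d)
      - (∫ x in skeleton (D.mesh 0),
          inner ℝ (jump τ x) (avgFluxOp D.a _ p (slabPart D p 0 v) s x) ∂surf d)
      + (∫ x in skeleton (D.mesh 0), inner ℝ (sigma0 C p (meshsize (D.mesh 0) x) • jump τ x)
          (jumpOp _ p (slabPart D p 0 v) s x) ∂surf d) := by
    intro v
    simp only [← broken_atTime, ← broken_grad, ← jump_atTime hd hT, ← avg_flux, ← dt_coe,
      real_inner_smul_left, real_inner_eq_mul]
    rfl
  simp only [hb]
  refine IsLin.comp (f := fun w : pwPoly (D.mesh 0) p =>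
      (∫ x in D.Ω, inner ℝ (v₀ x) (brokenOp _ p (dtL _ p w) s x))
      + (∫ x in D.Ω, inner ℝ (D.a x • G x) (brokenGradOp _ p w s x))
      - (∫ x in skeleton (D.mesh 0),
          inner ℝ (avg (fun (K : D.mesh 0) y => coeffOn D.a (K : Set (Space d)) • γ K y) x)
            (jumpOp _ p w s x) ∂surf d)
      - (∫ x in skeleton (D.mesh 0), inner ℝ (jump τ x) (avgFluxOp D.a _ p w s x) ∂surf d)
      + (∫ x in skeleton (D.mesh 0), inner ℝ (sigma0 C p (meshsize (D.mesh 0) x) • jump τ x)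
          (jumpOp _ p w s x) ∂surf d)) ?_ (slabPart D p 0)
  refine IsLin.add (IsLin.sub (IsLin.sub (IsLin.add ?_ ?_) ?_) ?_) ?_
  · exact isLin_integral (hv₀.integrable one_le_two) (evalTime (brokenOp _ p ∘ₗ dtL _ p) s) hB
  · exact isLin_integral ((essBdd_coeff D hd).integrable_smul (hG.integrable one_le_two))
      (evalTime (brokenGradOp _ p) s) hGr
  · exact isLin_integral (integrableOn_avg hd hT (fun K => coeffOn D.a (K : Set (Space d))) hγ)
      (evalTime (jumpOp _ p) s) hJ
  · exact isLin_integral hj.restrict (evalTime (avgFluxOp D.a _ p) s) hA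
  · exact isLin_integral ((essBdd_sigma0_meshsize C p _ _).integrable_smul hj.restrict)
      (evalTime (jumpOp _ p) s) hJ

end InitialData

end TrefftzDG

open TrefftzDG in
theorem mainTheorem6 (d : ℕ) (hd : 1 ≤ d) (c_q : ℝ) :
    ∃ C_inv : ℝ, 0 < C_inv ∧
      ∀ (D : Discretization d) (c_a C_a c_T C_σ : ℝ) (p : ℕ) (σ₁ σ₂ : ℝ → Space d → ℝ),
        0 < c_a → (∀ x ∈ D.Ω, c_a < D.a x ∧ D.a x < C_a) →
        0 < c_T → (∀ n, ShapeRegular (D.mesh n) c_T) →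
        (∀ n, LocallyQuasiUniform (D.mesh n) c_q) →
        IsPenalty D σ₁ → IsPenalty D σ₂ →
        c_T * C_a ^ 2 * C_inv / c_a ≤ C_σ →
        -- the slab forms
        (∀ n,
          (∀ v ∈ slabSpace D p n, 0 ≤ aSlab D p C_σ σ₁ σ₂ n v v) ∧
          (∃ q : Seminorm ℝ (slabSpace D p n), ∀ v : slabSpace D p n,
            q v = √(aSlab D p C_σ σ₁ σ₂ n v v)) ∧
          (∀ v ∈ slabTrefftz D p n, √(aSlab D p C_σ σ₁ σ₂ n v v) = 0 → v = 0)) ∧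
        -- the space-time form and the space-time system
        ((∀ m : Fin D.M, OverlayRegular (D.mesh m.castSucc) (D.mesh m.succ) c_T) →
          (∀ v ∈ fullSpace D p, 0 ≤ aForm D p C_σ σ₁ σ₂ v v) ∧
          (∃ q : Seminorm ℝ (fullSpace D p), ∀ v : fullSpace D p,
            q v = √(aForm D p C_σ σ₁ σ₂ v v)) ∧
          (∀ v ∈ trefftz D p, √(aForm D p C_σ σ₁ σ₂ v v) = 0 → v = 0) ∧
          (∀ ℓ : trefftz D p →ₗ[ℝ] ℝ,
            ∃! u : trefftz D p, ∀ v : trefftz D p, aForm D p C_σ σ₁ σ₂ u v = ℓ v) ∧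
          (∀ (u₀ v₀ : Space d → ℝ) (G : Space d → Space d)
              (τ : D.mesh 0 → Space d → ℝ) (γ : D.mesh 0 → Space d → Space d),
            MemH10 D.Ω u₀ G → MeasureTheory.MemLp v₀ 2 (MeasureTheory.volume.restrict D.Ω) →
            (∀ K : D.mesh 0, HasTrace (K : Set (Space d)) u₀ (τ K)) →
            (∀ K : D.mesh 0, HasTrace (K : Set (Space d)) G (γ K)) →
            ∃! u : trefftz D p, ∀ v : trefftz D p,
              aForm D p C_σ σ₁ σ₂ u v = bInit D p C_σ G v₀ τ γ v)) := by
  -- `1 + |c_q|` bounds the ratio of the diameters of elements that share a face or are equal;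
  -- `8 (d + 1)` is the constant `2 (d + 1)` of the trace inequality, doubled because the radius of
  -- the ball is half the inradius, and doubled again to use up only half of the energy
  refine ⟨8 * (d + 1) * (1 + |c_q|), by positivity, ?_⟩
  intro D c_a C_a c_T C_σ p σ₁ σ₂ hca ha hcT hshape hq h₁ h₂ hC
  have h : PenaltyDominates D c_a C_a c_T c_q C_σ := ⟨hca, ha, hcT, hshape, hq, hC⟩
  refine ⟨fun n => ⟨fun v hv => h.aSlab_nonneg hd h₁ h₂ n ⟨v, hv⟩,
    (isBilin_aSlab D hd C_σ h₁ h₂ n).exists_seminorm fun v => h.aSlab_nonneg hd h₁ h₂ n v,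
    fun v hv h0 => ?_⟩, fun hov => ?_⟩
  · have hn := h.aSlab_nonneg hd h₁ h₂ n ⟨v, hv.1⟩
    exact congrArg Subtype.val (h.eq_zero_of_aSlab_eq_zero hd h₁ h₂ n ⟨v, hv.1⟩ hv
      ((Real.sqrt_eq_zero hn).1 h0))
  have hnonneg : ∀ v : fullSpace D p, 0 ≤ aForm D p C_σ σ₁ σ₂ v v :=
    h.aForm_nonneg hd h₁ h₂ hov
  have hdef : ∀ v : trefftz D p, aForm D p C_σ σ₁ σ₂ v v = 0 → v = 0 := fun v h0 =>
    Subtype.ext (congrArg (fun w : fullSpace D p => w.1)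
      (h.eq_zero_of_aForm_eq_zero hd h₁ h₂ hov (trefftzIncl D p v) v.2 h0))
  have hsolve : ∀ ℓ : trefftz D p →ₗ[ℝ] ℝ,
      ∃! u : trefftz D p, ∀ v : trefftz D p, aForm D p C_σ σ₁ σ₂ u v = ℓ v :=
    ((isBilin_aForm D hd C_σ h₁ h₂).comp (trefftzIncl D p) (trefftzIncl D p)).existsUnique hdef
  refine ⟨fun v hv => hnonneg ⟨v, hv⟩, (isBilin_aForm D hd C_σ h₁ h₂).exists_seminorm hnonneg,
    fun v hv h0 => ?_, hsolve, fun u₀ v₀ G τ γ hu₀ hv₀ hτ hγ => ?_⟩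
  · exact congrArg Subtype.val (hdef ⟨v, hv⟩ ((Real.sqrt_eq_zero
      (hnonneg (trefftzIncl D p ⟨v, hv⟩))).1 h0))
  · obtain ⟨ℓ, hℓ⟩ := isLin_bInit (p := p) D hd C_σ hu₀.2.1 hv₀ hτ hγ
    have := hsolve (ℓ ∘ₗ trefftzIncl D p)
    simp only [LinearMap.comp_apply, hℓ] at this
    exact this
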